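/- **Lemma 3.3 (Local coercivity and boundedness).** *Setting.* Let $\Omega\subset\mathbb R^2$ be a bounded connected open polygonal domain with a finite partition $P_\Omega=\{\Omega_i\}_{i\in I}$ into disjoint open polygons, $\overline\Omega=\bigcup_i\overline{\Omega_i}$, and let $\mathbb A$ be a fourth-order tensor field, equal on each $\Omega_i$ to a constant tensor $\mathbb A_i$ which has the major and minor symmetries and is positive definite on $\mathbb R^{2\times2}_{\rm sym}$. (Polygons are connected and coincide with the interior of their closure.) A *mesh* of $\Omega$ consists of a finite set $\mathcal T_h$ of disjoint open polygons (elements) with $\overline\Omega=\bigcup_T\overline T$ and of a finite set $\mathcal F_h$ of disjoint open segments of nonzero length (faces) contained in $\overline\Omega$ such that each face is contained either in $\partial T_1\cap\partial T_2$ for two distinct elements $T_1,T_2$ or in $\partial T\cap\partial\Omega$ for an element $T$, and $\bigcup_T\partial T=\bigcup_F\overline F$. For $T\in\mathcal T_h$, $h_T$ is its diameter, $\mathcal F_T$ is the set of faces contained in $\partial T$, and $\boldsymbol n_{TF}$ is the unit normal to $F\in\mathcal F_T$ pointing out of $T$. The mesh is *compliant with the data* if each $T\in\mathcal T_h$ is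 contained in a unique $\Omega_i$; then $\mathbb A_T:=\mathbb A_i$, and $\mathcal A_T^+$ is the largest eigenvalue of $\mathbb A_T$ as an endomorphism of $\mathbb R^{2\times2}_{\rm sym}$. For $\varrho>0$, the mesh is *regular with parameter $\varrho$* if there is a conforming triangulation $\mathfrak T_h$ of $\Omega$ such that each element is decomposed into triangles of $\mathfrak T_h$ and each face into edges of $\mathfrak T_h$, with $\varrho h_S\le r_S$ for all $S\in\mathfrak T_h$ of diameter $h_S$ and inradius $r_S$, and $\varrho h_T\le h_S$ whenever $S\subset T\in\mathcal T_h$. *Local objects.* Let $k\ge1$. For an element or face $X$, $\mathbb P^l(X)$ is the space of restrictions to $X$ of two-variate polynomials of total degree at most $l$, $(\cdot,\cdot)_X$ and $\|\cdot\|_X$ are the $L^2(X)$ product and norm, and $\pi^l_X$ is the $L^2(X)$-orthogonal projector on $\mathbb P^l(X)$ ($\boldsymbol\pi_X^l$ if applied componentwise). The discrete unknowns are $$\underline{\mathrm v}_T=(v_T,(\boldsymbol v_{\nabla,F})_{F\in\mathcal F_T},(v_F)_{F\in\mathcal F_T})\in\underline{\mathrm U}_T^k:=\mathbb P^k(T)\times\prod_{F\in\mathcal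 F_T}\mathbb P^k(F)^2\times\prod_{F\in\mathcal F_T}\mathbb P^k(F).$$ With $a_{|T}(u,w):=(\mathbb A_T\nabla^2u,\nabla^2w)_T$ and $\boldsymbol M_{w,T}:=-\mathbb A_T\nabla^2w$, the reconstruction $p:=p_T^{k+2}\underline{\mathrm v}_T\in\mathbb P^{k+2}(T)$ is the unique polynomial such that $\pi_T^1p=\pi_T^1v_T$ and, for all $w\in\mathbb P^{k+2}(T)$, $$a_{|T}(p,w)=-(v_T,\operatorname{div}\mathbf{div}\,\boldsymbol M_{w,T})_T-\sum_{F\in\mathcal F_T}(\boldsymbol v_{\nabla,F},\boldsymbol M_{w,T}\boldsymbol n_{TF})_F+\sum_{F\in\mathcal F_T}(v_F,\mathbf{div}\,\boldsymbol M_{w,T}\cdot\boldsymbol n_{TF})_F.$$ Let $\mathrm a_T(\underline{\mathrm u}_T,\underline{\mathrm v}_T):=a_{|T}(p_T^{k+2}\underline{\mathrm u}_T,p_T^{k+2}\underline{\mathrm v}_T)+\mathrm s_T(\underline{\mathrm u}_T,\underline{\mathrm v}_T)$, where $$\begin{aligned}\mathrm s_T(\underline{\mathrm u}_T,\underline{\mathrm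 v}_T):={}&\frac{\mathcal A_T^+}{h_T^4}\big(\pi_T^k(p_T^{k+2}\underline{\mathrm u}_T-u_T),\pi_T^k(p_T^{k+2}\underline{\mathrm v}_T-v_T)\big)_T\\&+\frac{\mathcal A_T^+}{h_T}\sum_{F\in\mathcal F_T}\big(\boldsymbol\pi_F^k(\nabla p_T^{k+2}\underline{\mathrm u}_T-\boldsymbol u_{\nabla,F}),\boldsymbol\pi_F^k(\nabla p_T^{k+2}\underline{\mathrm v}_T-\boldsymbol v_{\nabla,F})\big)_F\\&+\frac{\mathcal A_T^+}{h_T^3}\sum_{F\in\mathcal F_T}\big(\pi_F^k(p_T^{k+2}\underline{\mathrm u}_T-u_F),\pi_F^k(p_T^{k+2}\underline{\mathrm v}_T-v_F)\big)_F,\end{aligned}$$ and let $$\|\underline{\mathrm v}_T\|_{\mathbb A,T}^2:=\|\mathbb A_T^{1/2}\nabla^2v_T\|_T^2+\frac{\mathcal A_T^+}{h_T}\sum_{F\in\mathcal F_T}\|\boldsymbol v_{\nabla,F}-\nabla v_T\|_F^2+\frac{\mathcal A_T^+}{h_T^3}\sum_{F\in\mathcal F_T}\|v_F-v_T\|_F^2.$$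 *Claim.* For all $k\ge1$, $\varrho>0$ and all tensors $(\mathbb A_i)_{i\in I}$ as above, there is a real number $C>0$, depending only on $k$, $\varrho$ and $(\mathbb A_i)_{i\in I}$, such that, for every such $\Omega$ and partition $P_\Omega$, every mesh of $\Omega$ that is regular with parameter $\varrho$ and compliant with the data, and every element $T$ of the mesh, $$C^{-1}\|\underline{\mathrm v}_T\|_{\mathbb A,T}^2\le\|\underline{\mathrm v}_T\|_{\mathrm a,T}^2:=\mathrm a_T(\underline{\mathrm v}_T,\underline{\mathrm v}_T)\le C\|\underline{\mathrm v}_T\|_{\mathbb A,T}^2\qquad\forall\,\underline{\mathrm v}_T\in\underline{\mathrm U}_T^k.$$ -/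

import Mathlib

open scoped MatrixOrder

noncomputable section

namespace PlateHHO

/-- The Euclidean plane. -/
abbrev Plane := EuclideanSpace ℝ (Fin 2)

/-! ### Material tensors -/

/-- A fourth-order tensor `A i j k l`, written as a matrix indexed by the pairs `(i, j)`, `(k, l)`,
so that composition of tensors is the product of matrices. -/
abbrev Tensor4 := Matrix (Fin 2 × Fin 2) (Fin 2 × Fin 2) ℝ

/-- The action `(A τ) i j = ∑ k l, A i j k l * τ k l` of a fourth-order tensor. -/
def Tensor4.app (A : Tensor4) (τ : Matrix (Fin 2) (Fin 2) ℝ) : Matrix (Fin 2) (Fin 2) ℝ :=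
  fun i j => ∑ p : Fin 2 × Fin 2, A (i, j) p * τ p.1 p.2

/-- The Frobenius product `σ : τ`. -/
def frob (σ τ : Matrix (Fin 2) (Fin 2) ℝ) : ℝ := ∑ i, ∑ j, σ i j * τ i j

/-- Symmetric (major and minor symmetries) and elliptic fourth-order tensors, i.e. symmetric
positive definite endomorphisms of the space of symmetric `2 × 2` matrices. -/
structure Tensor4.IsSymmElliptic (A : Tensor4) : Prop where
  major : ∀ p q, A p q = A q p
  minor : ∀ i j p, A (i, j) p = A (j, i) p
  elliptic : ∀ τ : Matrix (Fin 2) (Fin 2) ℝ, τ.IsSymm → τ ≠ 0 → 0 < frob (A.app τ) τ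

/-- The largest eigenvalue of `A`, regarded as an endomorphism of the space of symmetric
`2 × 2` matrices. -/
def Tensor4.maxEig (A : Tensor4) : ℝ :=
  sSup {c : ℝ | ∃ τ : Matrix (Fin 2) (Fin 2) ℝ, τ.IsSymm ∧ τ ≠ 0 ∧ A.app τ = c • τ}

/-- The positive semidefinite square root `A^{1/2}`. A symmetric elliptic tensor vanishes on
antisymmetric matrices, hence so does its square root, which on symmetric matrices is
the square root of the endomorphism `A`. -/
def Tensor4.sqrt (A : Tensor4) : Tensor4 := CFC.sqrt A

/-! ### Polygonal meshes -/

/-- Open polygons: bounded connected open sets whose closure is a finite union of nondegenerate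
closed triangles, and which coincide with the interior of their closure (no slits). -/
structure IsPolygon (T : Set Plane) : Prop where
  isOpen : IsOpen T
  isConnected : IsConnected T
  interior_closure : interior (closure T) = T
  triangles : ∃ S : Finset (Finset Plane),
    (∀ s ∈ S, s.card = 3 ∧ AffineIndependent ℝ ((↑) : s → Plane)) ∧
      closure T = ⋃ s ∈ S, convexHull ℝ (s : Set Plane)

/-- A finite family of disjoint polygons whose closures cover the closure of `Ω`. -/
structure IsPolygonalPartition {ι : Type*} (Ω : Set Plane) (P : ι → Set Plane) : Prop where
  isPolygon : ∀ i, IsPolygon (P i)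
  disjoint : Pairwise fun i j => Disjoint (P i) (P j)
  cover : closure Ω = ⋃ i, closure (P i)

/-- Open line segments of nonzero length. -/
def IsOpenSegment (F : Set Plane) : Prop := ∃ a b : Plane, a ≠ b ∧ F = openSegment ℝ a b

/-- `n` is the unit normal to the segment `F ⊆ ∂T` that points out of `T`: near every point of `F`,
finitely many excepted (vertices of `T` may lie on `F`), the set `T` is the open
half disc on the side of `-n`. -/
structure IsOutwardNormal (T F : Set Plane) (n : Plane) : Prop where
  norm_eq_one : ‖n‖ = 1
  orthogonal : ∀ x ∈ F, ∀ y ∈ F, inner ℝ n (y - x) = 0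
  outward : ∃ V : Set Plane, V.Finite ∧ ∀ x ∈ F \ V, ∃ r > 0, ∀ y ∈ Metric.ball x r,
    (y ∈ T ↔ inner ℝ n (y - x) < 0)

/-- The unit normal `n_{TF}` to `F` pointing out of `T`. -/
def outwardNormal (T F : Set Plane) : Plane := Classical.epsilon (IsOutwardNormal T F)

/-- A polygonal mesh of `Ω`, given by its elements and its faces. -/
structure Mesh (Ω : Set Plane) where
  elements : Finset (Set Plane)
  faces : Finset (Set Plane)
  isPolygon : ∀ T ∈ elements, IsPolygon T
  elements_disjoint : ∀ T ∈ elements, ∀ T' ∈ elements, T ≠ T' → Disjoint T T'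
  cover : closure Ω = ⋃ T ∈ elements, closure T
  isOpenSegment : ∀ F ∈ faces, IsOpenSegment F
  faces_subset : ∀ F ∈ faces, F ⊆ closure Ω
  faces_disjoint : ∀ F ∈ faces, ∀ F' ∈ faces, F ≠ F' → Disjoint F F'
  /-- Every face is an interface or a boundary face. -/
  interface_or_boundary : ∀ F ∈ faces,
    (∃ T₁ ∈ elements, ∃ T₂ ∈ elements, T₁ ≠ T₂ ∧ F ⊆ frontier T₁ ∩ frontier T₂) ∨
      ∃ T ∈ elements, F ⊆ frontier T ∩ frontier Ω
  /-- The faces partition the mesh skeleton. -/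
  skeleton : (⋃ T ∈ elements, frontier T) = ⋃ F ∈ faces, closure F
  /-- An element lies on one and the same side of each of its faces, so that the outward normal
  to the face is meaningful. -/
  exists_normal : ∀ T ∈ elements, ∀ F ∈ faces, F ⊆ frontier T → ∃ n, IsOutwardNormal T F n

open Classical in
/-- The set `ℱ_T` of the faces that lie on the boundary of `T`. -/
def Mesh.facesOf {Ω : Set Plane} (M : Mesh Ω) (T : Set Plane) : Finset (Set Plane) :=
  M.faces.filter fun F => F ⊆ frontier T

/-- The inradius of a (triangular) set: the supremum of the radii of the discs that it contains. -/
def inradius (S : Set Plane) : ℝ := sSup {r : ℝ | ∃ x, Metric.closedBall x r ⊆ S}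

/-- `K` is a matching simplicial submesh of `M`: a conforming triangulation of `Ω` such that each
element is decomposed into finitely many triangles of `K`, and each face into finitely many
edges of `K`. (The simplices of `K` are given by their vertices.) -/
structure IsMatchingSubmesh {Ω : Set Plane} (M : Mesh Ω)
    (K : Geometry.SimplicialComplex ℝ Plane) : Prop where
  finite : K.faces.Finite
  space_eq : K.space = closure Ω
  element_eq : ∀ T ∈ M.elements, closure T =
    ⋃ s ∈ {s ∈ K.faces | s.card = 3 ∧ convexHull ℝ (s : Set Plane) ⊆ closure T},
      convexHull ℝ (s : Set Plane)
  face_eq : ∀ F ∈ M.faces, closure F =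
    ⋃ s ∈ {s ∈ K.faces | s.card = 2 ∧ convexHull ℝ (s : Set Plane) ⊆ closure F},
      convexHull ℝ (s : Set Plane)

/-- The mesh `M` is regular with regularity parameter `ρ`. -/
def Mesh.IsRegular {Ω : Set Plane} (M : Mesh Ω) (ρ : ℝ) : Prop :=
  ∃ K : Geometry.SimplicialComplex ℝ Plane, IsMatchingSubmesh M K ∧
    (∀ s ∈ K.faces, s.card = 3 →
      ρ * Metric.diam (convexHull ℝ (s : Set Plane)) ≤ inradius (convexHull ℝ (s : Set Plane))) ∧
    (∀ T ∈ M.elements, ∀ s ∈ K.faces, s.card = 3 → convexHull ℝ (s : Set Plane) ⊆ closure T →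
      ρ * Metric.diam T ≤ Metric.diam (convexHull ℝ (s : Set Plane)))

/-! ### Polynomials, projectors, unknowns -/

/-- Two-variate real polynomials. -/
abbrev Poly := MvPolynomial (Fin 2) ℝ

/-- The value of a polynomial at a point of the plane. -/
def ev (p : Poly) (x : Plane) : ℝ := MvPolynomial.eval (fun i => x i) p

/-- `ℙ^l(T)` for an element `T`: two-variate polynomials of total degree at most `l`. (Elements are
open and nonempty, so that a polynomial is determined by its restriction to `T`.) -/
abbrev PolyElem (l : ℕ) := ↥(MvPolynomial.restrictTotalDegree (Fin 2) ℝ l)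

/-- The restriction of polynomials to a subset `F` of the plane, as a linear map. -/
def restrictTo (F : Set Plane) : Poly →ₗ[ℝ] (F → ℝ) where
  toFun p x := ev p x
  map_add' p q := by ext x; simp [ev]
  map_smul' c p := by ext x; simp [ev]

/-- `ℙ^l(F)`: restrictions to `F` of two-variate polynomials of total degree at most `l`. -/
def polyFace (l : ℕ) (F : Set Plane) : Submodule ℝ (F → ℝ) :=
  (MvPolynomial.restrictTotalDegree (Fin 2) ℝ l).map (restrictTo F)

/-- The `L²(T)` product of functions on an element. -/
def innerElem (T : Set Plane) (f g : Plane → ℝ) : ℝ := ∫ x in T, f x * g x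

/-- The `L²(F)` product of functions on a face, with respect to arc length. -/
def innerFace (F : Set Plane) (f g : F → ℝ) : ℝ :=
  ∫ x, f x * g x ∂((MeasureTheory.Measure.hausdorffMeasure 1 : MeasureTheory.Measure Plane).comap
    ((↑) : F → Plane))

/-- The `L²`-orthogonal projector on `ℙ^l(T)`: the unique `q ∈ ℙ^l(T)` with
`(q - f, w)_T = 0` for all `w ∈ ℙ^l(T)`. -/
def projElem (l : ℕ) (T : Set Plane) (f : Plane → ℝ) : PolyElem l :=
  Classical.epsilon fun q : PolyElem l =>
    ∀ w : PolyElem l, innerElem T (fun x => ev q x - f x) (ev w) = 0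

/-- The `L²`-orthogonal projector on `ℙ^l(F)`. -/
def projFace (l : ℕ) (F : Set Plane) (f : F → ℝ) : polyFace l F :=
  Classical.epsilon fun q : polyFace l F =>
    ∀ w : polyFace l F, innerFace F (fun x => (q : F → ℝ) x - f x) w = 0

/-- The partial derivative `∂ᵢ p`. -/
abbrev dd (i : Fin 2) (p : Poly) : Poly := MvPolynomial.pderiv i p

/-- The Hessian matrix `∇²p` at a point. -/
def hess (p : Poly) (x : Plane) : Matrix (Fin 2) (Fin 2) ℝ := fun i j => ev (dd i (dd j p)) x

/-- The local space of discrete unknowns `ℙ^k(T) × ∏_F ℙ^k(F)² × ∏_F ℙ^k(F)` of an element with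
set of faces `FT`. -/
abbrev LocalUnknowns (k : ℕ) (FT : Finset (Set Plane)) :=
  PolyElem k × (∀ F : FT, Fin 2 → polyFace k F.1) × (∀ F : FT, polyFace k F.1)

namespace LocalUnknowns

variable {k : ℕ} {FT : Finset (Set Plane)}

/-- The element unknown `v_T`. -/
def elem (v : LocalUnknowns k FT) : Poly := v.1

/-- The `i`-th component of the gradient unknown `v_{∇,F}`, as a function on `F`. -/
def grad (v : LocalUnknowns k FT) (F : FT) (i : Fin 2) : F.1 → ℝ := v.2.1 F i

/-- The trace unknown `v_F`, as a function on `F`. -/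
def trace (v : LocalUnknowns k FT) (F : FT) : F.1 → ℝ := v.2.2 F

end LocalUnknowns

/-! ### Deflection reconstruction, bilinear form, seminorm -/

/-- `a_{|T}(u, w) = (A ∇²u, ∇²w)_T`. -/
def aElem (A : Tensor4) (T : Set Plane) (u w : Poly) : ℝ :=
  ∫ x in T, frob (A.app (hess u x)) (hess w x)

/-- The virtual moment tensor `M_w = - A ∇²w` (with constant `A`), componentwise. -/
def moment (A : Tensor4) (w : Poly) (i j : Fin 2) : Poly :=
  -∑ p : Fin 2 × Fin 2, MvPolynomial.C (A (i, j) p) * dd p.1 (dd p.2 w)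

/-- The vector field `𝐝𝐢𝐯 M_w`. -/
def divMoment (A : Tensor4) (w : Poly) (i : Fin 2) : Poly := ∑ j, dd j (moment A w i j)

/-- `div 𝐝𝐢𝐯 M_w`. -/
def divDivMoment (A : Tensor4) (w : Poly) : Poly := ∑ i, dd i (divMoment A w i)

section Local

variable {k : ℕ} {FT : Finset (Set Plane)} (A : Tensor4) (T : Set Plane)

/-- The linear form that defines the deflection reconstruction:
`-(v_T, div 𝐝𝐢𝐯 M_w)_T - ∑_F (v_{∇,F}, M_w n_{TF})_F + ∑_F (v_F, 𝐝𝐢𝐯 M_w · n_{TF})_F`. -/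
def recRhs (v : LocalUnknowns k FT) (w : Poly) : ℝ :=
  -innerElem T (ev v.elem) (ev (divDivMoment A w))
    - ∑ F : FT, ∑ i, innerFace F.1 (v.grad F i)
        (fun x => ∑ j, ev (moment A w i j) x * outwardNormal T F.1 j)
    + ∑ F : FT, innerFace F.1 (v.trace F)
        (fun x => ∑ i, ev (divMoment A w i) x * outwardNormal T F.1 i)

/-- The local deflection reconstruction `p_T^{k+2} v`: the unique `p ∈ ℙ^{k+2}(T)` such that
`a_{|T}(p, w)` is the linear form above for all `w ∈ ℙ^{k+2}(T)`, and `π_T^1 p = π_T^1 v_T`. -/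
def reconstruction (v : LocalUnknowns k FT) : PolyElem (k + 2) :=
  Classical.epsilon fun p : PolyElem (k + 2) =>
    (∀ w : PolyElem (k + 2), aElem A T p w = recRhs A T v w) ∧
      projElem 1 T (ev p) = projElem 1 T (ev v.elem)

/-- The element residual `π_T^k (p_T^{k+2} v - v_T)`. -/
def resElem (v : LocalUnknowns k FT) : PolyElem k :=
  projElem k T (fun x => ev (reconstruction A T v) x - ev v.elem x)

/-- The components of the gradient residual `π_F^k (∇ p_T^{k+2} v - v_{∇,F})`. -/
def resGrad (v : LocalUnknowns k FT) (F : FT) (i : Fin 2) : polyFace k F.1 :=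
  projFace k F.1 (fun x => ev (dd i (reconstruction A T v)) x - v.grad F i x)

/-- The trace residual `π_F^k (p_T^{k+2} v - v_F)`. -/
def resTrace (v : LocalUnknowns k FT) (F : FT) : polyFace k F.1 :=
  projFace k F.1 (fun x => ev (reconstruction A T v) x - v.trace F x)

/-- The stabilization bilinear form `s_T`. The diameter of `T` is `h_T`. -/
def stab (u v : LocalUnknowns k FT) : ℝ :=
  A.maxEig / Metric.diam T ^ 4 * innerElem T (ev (resElem A T u)) (ev (resElem A T v))
    + A.maxEig / Metric.diam T *
        ∑ F : FT, ∑ i, innerFace F.1 (resGrad A T u F i) (resGrad A T v F i)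
    + A.maxEig / Metric.diam T ^ 3 *
        ∑ F : FT, innerFace F.1 (resTrace A T u F) (resTrace A T v F)

/-- The local discrete bilinear form `a_T`. -/
def aT (u v : LocalUnknowns k FT) : ℝ :=
  aElem A T (reconstruction A T u) (reconstruction A T v) + stab A T u v

/-- The squared local seminorm `‖v‖²_{A,T} = ‖A^{1/2} ∇² v_T‖²_T
+ A⁺ / h_T ∑_F ‖v_{∇,F} - ∇ v_T‖²_F + A⁺ / h_T³ ∑_F ‖v_F - v_T‖²_F`. -/
def seminormSq (v : LocalUnknowns k FT) : ℝ :=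
  (∫ x in T, frob (A.sqrt.app (hess v.elem x)) (A.sqrt.app (hess v.elem x)))
    + A.maxEig / Metric.diam T *
        ∑ F : FT, ∑ i, innerFace F.1 (fun x => v.grad F i x - ev (dd i v.elem) x)
          (fun x => v.grad F i x - ev (dd i v.elem) x)
    + A.maxEig / Metric.diam T ^ 3 *
        ∑ F : FT, innerFace F.1 (fun x => v.trace F x - ev v.elem x)
          (fun x => v.trace F x - ev v.elem x)

end Local

end PlateHHO

end

noncomputable section

namespace PlateHHO

open MeasureTheory

/-! ### Symmetric bilinear forms -/

/-! Let `p` be the reconstruction of the unknowns `v` with element component `v_T`, and let `h` be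
the diameter of `T`. Everything is governed by the difference `p - v_T`.

Two ingredients make this work. The first is analytic. A regular element lies between concentric
balls of comparable radii and has perimeter at most a multiple of `h`
(`Mesh.IsRegular.exists_ball_and_perimeter`). Polynomials of degree at most `k + 2` therefore
satisfy inverse and trace inequalities and a second-order Poincaré inequality modulo affine
functions, with uniform constants (`exists_localBounds`). These constants arise on a reference ball
from finite dimension: a linear form that vanishes where a semidefinite form does is bounded by it
(`exists_sq_le_of_vanishes_on_ker`). The second is algebraic. Two integrations by parts
(`energy_eq_recForm`) turn the equation for `p` into one for `p - v_T` whose right-hand side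
consists of face terms, linear in the jumps `v_{∇,F} - ∇v_T` and `v_F - v_T`.

Upper bound: testing with `p - v_T` bounds its Hessian by the jumps
(`hessForm_le_of_reconstruction`). As `p - v_T` is orthogonal to affine functions, Poincaré bounds
its norm, then the inverse and trace inequalities bound its traces. The face residuals are
projections of these traces minus the jumps.

Lower bound: if `r` is the element residual, then `p - v_T - r` is `p` minus its projection of
degree `k`. Since `k ≥ 1`, it is controlled by the Hessian of `p`. Hence `r` and the energy of `p`
control `p - v_T`, and the inverse inequality recovers the Hessian of `v_T`. The jumps are in turn
projections of traces of `p - v_T` minus residuals. Both halves meet in `exists_local_equivalence`.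

The divergence formula on an element (`Mesh.divergence_formula`) is obtained by slicing along a
coordinate axis. On all but finitely many lines the element is a finite union of intervals whose
ends are transversal crossings of its faces. This rests on `Mesh.exists_exceptional`: up to finitely
many points, the boundary of an element is covered by its own faces. -/

theorem exists_eq_of_vanishes_on_ker {V : Type*} [AddCommGroup V] [Module ℝ V]
    [FiniteDimensional ℝ V] (B : V →ₗ[ℝ] V →ₗ[ℝ] ℝ) (hB : ∀ x y, B x y = B y x)
    (f : V →ₗ[ℝ] ℝ) (hf : ∀ x, (∀ y, B x y = 0) → f x = 0) : ∃ p, ∀ w, B p w = f w := by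
  -- The range of the transpose of `B` is the annihilator of the kernel of `B`; by reflexivity the
  -- preimage of `f` is evaluation at some `p`.
  have h1 : f ∈ LinearMap.range B.dualMap := by
    rw [LinearMap.range_dualMap_eq_dualAnnihilator_ker, Submodule.mem_dualAnnihilator]
    intro w hw
    exact hf w fun y => by rw [LinearMap.mem_ker.1 hw]; rfl
  obtain ⟨g, hg⟩ := h1
  obtain ⟨p, rfl⟩ := (Module.evalEquiv ℝ V).surjective g
  refine ⟨p, fun w => ?_⟩
  rw [← hg, hB]
  rfl

theorem sq_le_mul_of_quadratic_nonneg {a b c : ℝ}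
    (h : ∀ t : ℝ, 0 ≤ a + 2 * t * b + t ^ 2 * c) : b ^ 2 ≤ a * c := by
  have := discrim_le_zero (a := c) (b := 2 * b) (c := a) fun t => by nlinarith [h t]
  unfold discrim at this
  nlinarith

theorem bilin_sq_le {V : Type*} [AddCommGroup V] [Module ℝ V]
    (B : V →ₗ[ℝ] V →ₗ[ℝ] ℝ) (hB : ∀ x y, B x y = B y x) (h0 : ∀ x, 0 ≤ B x x) (x y : V) :
    B x y ^ 2 ≤ B x x * B y y := by
  refine sq_le_mul_of_quadratic_nonneg fun t => ?_
  have := h0 (x + t • y)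
  simp only [map_add, map_smul, LinearMap.add_apply, LinearMap.smul_apply, smul_eq_mul,
    hB y x] at this
  linarith

/-- The constant is `B p p` for a Riesz representative `p` of `f`, by Cauchy–Schwarz. This replaces
the equivalence of norms in finite dimension and tolerates forms that are only semidefinite. -/
theorem exists_sq_le_of_vanishes_on_ker {V : Type*} [AddCommGroup V] [Module ℝ V]
    [FiniteDimensional ℝ V] (B : V →ₗ[ℝ] V →ₗ[ℝ] ℝ) (hB : ∀ x y, B x y = B y x)
    (h0 : ∀ x, 0 ≤ B x x) (f : V →ₗ[ℝ] ℝ) (hf : ∀ x, B x x = 0 → f x = 0) :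
    ∃ K, 0 ≤ K ∧ ∀ w, f w ^ 2 ≤ K * B w w := by
  obtain ⟨p, hp⟩ := exists_eq_of_vanishes_on_ker B hB f fun x hx => hf x (hx x)
  exact ⟨B p p, h0 p, fun w => hp w ▸ bilin_sq_le B hB h0 p w⟩

/-! ### Polynomials -/

/-- The space of polynomials of total degree at most `l`. -/
abbrev polyDeg (l : ℕ) : Submodule ℝ Poly := MvPolynomial.restrictTotalDegree (Fin 2) ℝ l

theorem mem_polyDeg {l : ℕ} {p : Poly} : p ∈ polyDeg l ↔ p.totalDegree ≤ l :=
  MvPolynomial.mem_restrictTotalDegree _ _ _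

theorem polyDeg_mono {l m : ℕ} (h : l ≤ m) : polyDeg l ≤ polyDeg m := fun _ hp =>
  mem_polyDeg.2 ((mem_polyDeg.1 hp).trans h)

@[simp] theorem ev_add (p q : Poly) (x : Plane) : ev (p + q) x = ev p x + ev q x := by simp [ev]
@[simp] theorem ev_sub (p q : Poly) (x : Plane) : ev (p - q) x = ev p x - ev q x := by simp [ev]
@[simp] theorem ev_neg (p : Poly) (x : Plane) : ev (-p) x = -ev p x := by simp [ev]
@[simp] theorem ev_mul (p q : Poly) (x : Plane) : ev (p * q) x = ev p x * ev q x := by simp [ev]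
@[simp] theorem ev_smul (c : ℝ) (p : Poly) (x : Plane) : ev (c • p) x = c * ev p x := by
  simp [ev]
@[simp] theorem ev_C (c : ℝ) (x : Plane) : ev (MvPolynomial.C c) x = c := by simp [ev]
@[simp] theorem ev_X (i : Fin 2) (x : Plane) : ev (MvPolynomial.X i) x = x i := by simp [ev]
@[simp] theorem ev_zero (x : Plane) : ev 0 x = 0 := by simp [ev]
@[simp] theorem ev_sum {ι : Type*} (s : Finset ι) (p : ι → Poly) (x : Plane) :
    ev (∑ i ∈ s, p i) x = ∑ i ∈ s, ev (p i) x := by simp [ev]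

theorem continuous_ev (p : Poly) : Continuous (ev p) := by
  induction p using MvPolynomial.induction_on with
  | C a => simpa [funext (ev_C a)] using continuous_const
  | add p q hp hq =>
    have := hp.add hq
    rwa [show ev p + ev q = ev (p + q) from (funext (ev_add p q)).symm] at this
  | mul_X p i hp =>
    have : Continuous fun x : Plane => ev p x * x i := by fun_prop
    convert this using 2 with x
    simp

theorem dd_comm (i j : Fin 2) (p : Poly) : dd i (dd j p) = dd j (dd i p) := by
  ext m
  by_cases h : i = j
  · rw [h]
  simp only [dd, MvPolynomial.coeff_pderiv, Finsupp.add_apply, Finsupp.single_apply, h,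
    Ne.symm h, if_false, add_zero]
  rw [add_right_comm]
  ring

theorem dd_mem_polyDeg {l : ℕ} {p : Poly} (hp : p ∈ polyDeg l) (i : Fin 2) :
    dd i p ∈ polyDeg (l - 1) := by
  rw [mem_polyDeg]
  refine Finset.sup_le fun m hm => ?_
  rw [MvPolynomial.mem_support_iff, MvPolynomial.coeff_pderiv] at hm
  have h1 := MvPolynomial.le_totalDegree
    (MvPolynomial.mem_support_iff.2 (left_ne_zero_of_mul hm))
  rw [Finsupp.sum_add_index' (fun _ => rfl) (fun _ _ _ => rfl),
    Finsupp.sum_single_index rfl] at h1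
  exact Nat.le_sub_of_add_le (h1.trans (mem_polyDeg.1 hp))

/-- Only the velocity at `t` matters: it is the `i`-th basis vector. In this form partial
derivatives enter the one-dimensional calculus on slices. -/
theorem ev_hasDerivAt (p : Poly) (i : Fin 2) (γ : ℝ → Plane) (t : ℝ)
    (hi : HasDerivAt (fun t => γ t i) 1 t) (hj : ∀ j ≠ i, HasDerivAt (fun t => γ t j) 0 t) :
    HasDerivAt (fun t => ev p (γ t)) (ev (dd i p) (γ t)) t := by
  induction p using MvPolynomial.induction_on with
  | C a => simpa using hasDerivAt_const t a
  | add p q hp hq =>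
    rw [dd, map_add, ev_add]
    exact (hp.add hq).congr_of_eventuallyEq (.of_forall fun t => ev_add p q _)
  | mul_X p j hp =>
    have hX : HasDerivAt (fun t => γ t j) (ev (dd i (MvPolynomial.X j)) (γ t)) t := by
      by_cases h : j = i
      · subst h
        simpa [ev] using hi
      · simpa [MvPolynomial.pderiv_X_of_ne h] using hj j h
    rw [dd, MvPolynomial.pderiv_mul, ev_add, ev_mul, ev_mul, ev_X]
    exact (hp.mul hX).congr_of_eventuallyEq (.of_forall fun t => by simp)

/-- An open set contains a product of intervals, and a polynomial that vanishes on a product of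
infinite sets is zero. -/
theorem eq_zero_of_ev_eq_zero {U : Set Plane} (hU : IsOpen U) (hne : U.Nonempty) {p : Poly}
    (h : ∀ x ∈ U, ev p x = 0) : p = 0 := by
  obtain ⟨x, hx⟩ := hne
  have hU' : IsOpen ((WithLp.toLp 2 : (Fin 2 → ℝ) → Plane) ⁻¹' U) :=
    hU.preimage (PiLp.continuous_toLp 2 _)
  obtain ⟨ε, hε, hb⟩ := Metric.isOpen_iff.1 hU' (WithLp.ofLp x) hx
  refine MvPolynomial.funext_set (fun i => Metric.ball (x i) ε)
    (fun i => by rw [Real.ball_eq_Ioo]; exact Set.Ioo_infinite (by linarith)) fun y hy => ?_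
  have := h _ (hb (show y ∈ Metric.ball (WithLp.ofLp x) ε by rw [ball_pi _ hε]; exact hy))
  simpa [ev] using this

/-- If `m i ≠ 0`, the coefficient of `∂ᵢ p` at `m - eᵢ` is `m i` times that of `p` at `m`, so only
the constant coefficient survives. -/
theorem eq_C_of_dd_eq_zero {p : Poly} (h : ∀ i, dd i p = 0) : p = MvPolynomial.C (ev p 0) := by
  have h1 : ∀ m : Fin 2 →₀ ℕ, m ≠ 0 → p.coeff m = 0 := by
    intro m hm
    obtain ⟨i, hi⟩ := Finsupp.ne_iff.1 hm
    have h2 := congrArg (MvPolynomial.coeff (m - Finsupp.single i 1)) (h i)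
    have h3 : Finsupp.single i 1 ≤ m := by
      simpa [Finsupp.single_le_iff, Nat.one_le_iff_ne_zero] using hi
    rw [MvPolynomial.coeff_pderiv, tsub_add_cancel_of_le h3] at h2
    rcases mul_eq_zero.1 h2 with h4 | h4
    · exact h4
    · exfalso; revert h4; positivity
  have h4 : p = MvPolynomial.C (p.coeff 0) := by
    ext m
    rw [MvPolynomial.coeff_C]
    split_ifs with hm
    · rw [hm]
    · exact h1 m (Ne.symm hm)
  rw [h4]
  simp

/-- Affine substitution `q ↦ q (x₀ + s ·)`. -/
def subst (x₀ : Plane) (s : ℝ) : Poly →ₐ[ℝ] Poly :=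
  MvPolynomial.aeval fun i => MvPolynomial.C (x₀ i) + MvPolynomial.C s * MvPolynomial.X i

theorem ev_subst (x₀ : Plane) (s : ℝ) (p : Poly) (y : Plane) :
    ev (subst x₀ s p) y = ev p (x₀ + s • y) := by
  induction p using MvPolynomial.induction_on with
  | C a => simp [subst]
  | add p q hp hq => simp [hp, hq]
  | mul_X p j hp => rw [map_mul, ev_mul, hp]; simp [subst]

theorem dd_subst (x₀ : Plane) (s : ℝ) (p : Poly) (i : Fin 2) :
    dd i (subst x₀ s p) = s • subst x₀ s (dd i p) := by
  induction p using MvPolynomial.induction_on with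
  | C a => simp [subst]
  | add p q hp hq => simp [hp, hq]
  | mul_X p j hp =>
    have h1 : dd i (subst x₀ s (MvPolynomial.X j)) = s • subst x₀ s (dd i (MvPolynomial.X j)) := by
      by_cases h : j = i
      · subst h; simp [PlateHHO.subst, MvPolynomial.smul_eq_C_mul]
      · simp [PlateHHO.subst, MvPolynomial.pderiv_X_of_ne h]
    simp only [dd, map_mul, Derivation.leibniz, map_add, smul_eq_mul, smul_add] at *
    rw [hp, h1]
    simp [Algebra.mul_smul_comm]

theorem subst_mem_polyDeg {l : ℕ} (x₀ : Plane) (s : ℝ) {p : Poly} (hp : p ∈ polyDeg l) :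
    subst x₀ s p ∈ polyDeg l := by
  rw [mem_polyDeg] at *
  rw [subst, MvPolynomial.aeval_def, MvPolynomial.eval₂_eq']
  refine MvPolynomial.totalDegree_finsetSum_le fun m hm => ?_
  refine (MvPolynomial.totalDegree_mul _ _).trans ?_
  rw [MvPolynomial.algebraMap_eq, MvPolynomial.totalDegree_C, zero_add]
  refine (MvPolynomial.totalDegree_finsetProd _ _).trans ?_
  refine le_trans ?_ ((MvPolynomial.le_totalDegree hm).trans hp)
  rw [Finsupp.sum_fintype _ _ fun _ => rfl]
  refine Finset.sum_le_sum fun i _ => (MvPolynomial.totalDegree_pow _ _).trans ?_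
  refine (Nat.mul_le_mul_left _ (?_ : _ ≤ 1)).trans (Nat.mul_one _).le
  refine (MvPolynomial.totalDegree_add _ _).trans (max_le (by simp) ?_)
  exact (MvPolynomial.totalDegree_mul _ _).trans (by simp)

/-! ### Integration functionals -/

/-- Finite measures with bounded support, for which all polynomials are integrable. -/
structure IsNice (μ : Measure Plane) : Prop where
  finite : IsFiniteMeasure μ
  bounded : ∃ R : ℝ, ∀ᵐ x ∂μ, ‖x‖ ≤ R

theorem IsNice.integrable {μ : Measure Plane} (h : IsNice μ) {f : Plane → ℝ} (hf : Continuous f) :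
    Integrable f μ := by
  have := h.finite
  obtain ⟨R, hR⟩ := h.bounded
  obtain ⟨C, hC⟩ := (isCompact_closedBall (0 : Plane) R).exists_bound_of_continuousOn
    hf.continuousOn
  exact Integrable.of_bound hf.aestronglyMeasurable C (hR.mono fun x hx => hC x (by simpa using hx))

/-- Integration of polynomials, as a linear form. -/
def intForm {μ : Measure Plane} (h : IsNice μ) : Poly →ₗ[ℝ] ℝ where
  toFun p := ∫ x, ev p x ∂μ
  map_add' p q := by
    simp only [ev_add]
    exact integral_add (h.integrable (continuous_ev p)) (h.integrable (continuous_ev q))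
  map_smul' c p := by simp [integral_const_mul]

theorem intForm_apply {μ : Measure Plane} (h : IsNice μ) (p : Poly) :
    intForm h p = ∫ x, ev p x ∂μ := rfl

theorem intForm_mono {μ : Measure Plane} (h : IsNice μ) {p q : Poly} (hpq : ∀ x, ev p x ≤ ev q x) :
    intForm h p ≤ intForm h q :=
  integral_mono (h.integrable (continuous_ev p)) (h.integrable (continuous_ev q)) hpq

theorem intForm_sq_nonneg {μ : Measure Plane} (h : IsNice μ) (p : Poly) : 0 ≤ intForm h (p * p) :=
  integral_nonneg fun x => by simpa using mul_self_nonneg (ev p x)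

theorem isNice_restrict {T : Set Plane} (hT : Bornology.IsBounded T)
    {μ : Measure Plane} (hμ : μ T ≠ ⊤) (hm : MeasurableSet T) : IsNice (μ.restrict T) := by
  refine ⟨⟨by simpa using hμ.lt_top⟩, ?_⟩
  obtain ⟨R, hR⟩ := hT.exists_norm_le
  exact ⟨R, (ae_restrict_iff' hm).2 (.of_forall hR)⟩

theorem eq_zero_of_intForm_sq_eq_zero {U : Set Plane} (hU : IsOpen U) (hne : U.Nonempty)
    (h : IsNice ((volume : Measure Plane).restrict U)) {p : Poly} (hp : intForm h (p * p) = 0) :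
    p = 0 := by
  refine eq_zero_of_ev_eq_zero hU hne fun x hx => ?_
  rw [intForm_apply, integral_eq_zero_iff_of_nonneg
    (fun x => by simpa using mul_self_nonneg (ev p x)) (h.integrable (continuous_ev _))] at hp
  have := Measure.eqOn_open_of_ae_eq hp hU (continuous_ev _).continuousOn
    continuous_const.continuousOn hx
  simpa using this

/-- The symmetric bilinear form associated with a linear form on polynomials. -/
def mulForm (φ : Poly →ₗ[ℝ] ℝ) : Poly →ₗ[ℝ] Poly →ₗ[ℝ] ℝ :=
  (LinearMap.mul ℝ Poly).compr₂ φ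

@[simp] theorem mulForm_apply (φ : Poly →ₗ[ℝ] ℝ) (p q : Poly) : mulForm φ p q = φ (p * q) := rfl

/-! ### Inequalities for polynomials on scaled balls -/

/-- The image of `D` has a finite basis. The coordinates of `D q` are linear forms in `q` that
vanish where `B` does, hence are bounded by `B`, and the basis polynomials are bounded on the unit
ball. With `D` the identity or a derivative this yields inverse inequalities; with `D` the Taylor
remainder and `B` the Hessian form, polynomial approximation. -/
theorem exists_sup_bound (l : ℕ) (B : Poly →ₗ[ℝ] Poly →ₗ[ℝ] ℝ) (hB : ∀ x y, B x y = B y x)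
    (h0 : ∀ x, 0 ≤ B x x) (D : Poly →ₗ[ℝ] Poly) (hD : ∀ q ∈ polyDeg l, B q q = 0 → D q = 0) :
    ∃ K, 0 ≤ K ∧ ∀ q ∈ polyDeg l, ∀ y : Plane, ‖y‖ ≤ 1 → ev (D q) y ^ 2 ≤ K * B q q := by
  let W := (polyDeg l).map D
  let b := Module.finBasis ℝ W
  let D' : polyDeg l →ₗ[ℝ] W :=
    (D.comp (polyDeg l).subtype).codRestrict W fun q => Submodule.mem_map_of_mem q.2
  have key : ∀ i, ∃ K, 0 ≤ K ∧ ∀ w : polyDeg l, b.coord i (D' w) ^ 2 ≤ K * B w w := fun i =>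
    exists_sq_le_of_vanishes_on_ker (B.compl₁₂ (polyDeg l).subtype (polyDeg l).subtype)
      (fun x y => hB _ _) (fun x => h0 _) (b.coord i ∘ₗ D') fun x hx => by
        have : D' x = 0 := Subtype.ext (hD x x.2 hx)
        simp [this]
  choose K hK0 hK using key
  have hM : ∀ i, ∃ M, ∀ y : Plane, ‖y‖ ≤ 1 → ev (b i : Poly) y ^ 2 ≤ M := fun i => by
    obtain ⟨C, hC⟩ := (isCompact_closedBall (0 : Plane) 1).exists_bound_of_continuousOn
      (continuous_ev (b i : Poly)).continuousOn
    refine ⟨C ^ 2, fun y hy => ?_⟩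
    have := hC y (by simpa using hy)
    exact sq_le_sq' (abs_le.1 this).1 (abs_le.1 this).2
  choose M hM using hM
  have hM0 : 0 ≤ ∑ i, M i := Finset.sum_nonneg fun i _ => (sq_nonneg _).trans (hM i 0 (by simp))
  refine ⟨(∑ i, K i) * ∑ i, M i, mul_nonneg (Finset.sum_nonneg fun i _ => hK0 i) hM0,
    fun q hq y hy => ?_⟩
  have h1 : D q = ∑ i, b.coord i (D' ⟨q, hq⟩) • (b i : Poly) := by
    have := congrArg W.subtype (b.sum_repr (D' ⟨q, hq⟩))
    rw [map_sum] at this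
    exact this.symm
  rw [h1, ev_sum]
  simp only [ev_smul]
  refine (Finset.sum_mul_sq_le_sq_mul_sq _ _ _).trans ?_
  rw [mul_right_comm]
  refine mul_le_mul ?_ (Finset.sum_le_sum fun i _ => hM i y hy)
    (Finset.sum_nonneg fun i _ => sq_nonneg _) ?_
  · rw [Finset.sum_mul]
    exact Finset.sum_le_sum fun i _ => hK i ⟨q, hq⟩
  · exact mul_nonneg (Finset.sum_nonneg fun i _ => hK0 i) (h0 _)

theorem isNice_ball (x : Plane) (r : ℝ) :
    IsNice ((volume : Measure Plane).restrict (Metric.ball x r)) :=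
  isNice_restrict Metric.isBounded_ball measure_ball_lt_top.ne measurableSet_ball

theorem setIntegral_ball_eq (f : Plane → ℝ) (x₀ : Plane) {h : ℝ} (hh : 0 < h) (c : ℝ) :
    ∫ x in Metric.ball x₀ (h * c), f x
      = h ^ 2 * ∫ y in Metric.ball (0 : Plane) c, f (x₀ + h • y) := by
  rw [← integral_indicator measurableSet_ball, ← integral_indicator measurableSet_ball]
  let g : Plane → ℝ := (Metric.ball x₀ (h * c)).indicator f
  have h1 : (fun y => (Metric.ball (0 : Plane) c).indicator (fun y => f (x₀ + h • y)) y)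
      = fun y => (fun z => g (x₀ + z)) (h • y) := by
    ext y
    have : x₀ + h • y ∈ Metric.ball x₀ (h * c) ↔ y ∈ Metric.ball (0 : Plane) c := by
      simp [dist_eq_norm, norm_smul, abs_of_pos hh, hh]
    by_cases hy : y ∈ Metric.ball (0 : Plane) c
    · simp only [g, Set.indicator_of_mem hy, Set.indicator_of_mem (this.2 hy)]
    · simp only [g, Set.indicator_of_notMem hy, Set.indicator_of_notMem (mt this.1 hy)]
  rw [h1, Measure.integral_comp_smul volume (fun z => g (x₀ + z)) h, integral_add_left_eq_self g x₀]
  simp only [finrank_euclideanSpace, Fintype.card_fin, smul_eq_mul, g]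
  rw [abs_of_pos (by positivity), mul_inv_cancel_left₀ (by positivity)]

theorem intForm_ball (q : Poly) (x₀ : Plane) {h : ℝ} (hh : 0 < h) (c : ℝ) :
    intForm (isNice_ball x₀ (h * c)) q = h ^ 2 * intForm (isNice_ball 0 c) (subst x₀ h q) := by
  simp only [intForm_apply, ev_subst]
  exact setIntegral_ball_eq _ _ hh _

theorem intForm_sq_mono {S T : Set Plane} (hST : S ⊆ T)
    (hS : IsNice ((volume : Measure Plane).restrict S))
    (hT : IsNice ((volume : Measure Plane).restrict T)) (q : Poly) :
    intForm hS (q * q) ≤ intForm hT (q * q) :=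
  setIntegral_mono_set (hT.integrable (continuous_ev _))
    (.of_forall fun x => by simpa using mul_self_nonneg (ev q x)) (.of_forall hST)

theorem mulForm_symm (φ : Poly →ₗ[ℝ] ℝ) (p q : Poly) : mulForm φ p q = mulForm φ q p := by
  simp [mul_comm]

/-- The polynomial minus its first order Taylor polynomial at the origin. -/
def taylorRem : Poly →ₗ[ℝ] Poly where
  toFun q := q - (MvPolynomial.C (ev q 0) + ∑ i, ev (dd i q) 0 • MvPolynomial.X i)
  map_add' p q := by simp [add_smul]; ring
  map_smul' c q := by
    simp [smul_sub, smul_add, mul_smul, MvPolynomial.smul_eq_C_mul]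

theorem taylorRem_sub_mem (q : Poly) : q - taylorRem q ∈ polyDeg 1 := by
  simp only [taylorRem, LinearMap.coe_mk, AddHom.coe_mk, sub_sub_cancel]
  refine add_mem (mem_polyDeg.2 (by simp)) (Submodule.sum_mem _ fun i _ => ?_)
  exact Submodule.smul_mem _ _ (mem_polyDeg.2 (by simp))

/-- The first derivatives are constants, so the remainder has zero gradient; its value at the origin
is zero. -/
theorem taylorRem_eq_zero {q : Poly} (h : ∀ i j, dd i (dd j q) = 0) : taylorRem q = 0 := by
  have h1 : ∀ i, dd i q = MvPolynomial.C (ev (dd i q) 0) := fun i =>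
    eq_C_of_dd_eq_zero fun j => h j i
  have h2 : ∀ i, dd i (taylorRem q) = 0 := by
    intro i
    simp only [taylorRem, LinearMap.coe_mk, AddHom.coe_mk, map_sub, map_add, map_sum,
      Derivation.map_smul, MvPolynomial.pderiv_C, zero_add]
    rw [Finset.sum_eq_single i (fun j _ hj => by simp [MvPolynomial.pderiv_X_of_ne hj])
      (by simp), MvPolynomial.pderiv_X_self, ← dd, h1 i, MvPolynomial.smul_eq_C_mul]
    simp
  rw [eq_C_of_dd_eq_zero h2]
  simp [taylorRem]

/-- The `L²` form of Hessians. -/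
def hessForm (φ : Poly →ₗ[ℝ] ℝ) : Poly →ₗ[ℝ] Poly →ₗ[ℝ] ℝ :=
  ∑ i, ∑ j, (mulForm φ).compl₁₂
    ((MvPolynomial.pderiv i).toLinearMap ∘ₗ (MvPolynomial.pderiv j).toLinearMap)
    ((MvPolynomial.pderiv i).toLinearMap ∘ₗ (MvPolynomial.pderiv j).toLinearMap)

theorem hessForm_apply (φ : Poly →ₗ[ℝ] ℝ) (p q : Poly) :
    hessForm φ p q = ∑ i, ∑ j, φ (dd i (dd j p) * dd i (dd j q)) := by
  simp [hessForm]

section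

variable {c : ℝ}

/-- Scaling to the reference ball: the area contributes `h⁻²`, and each derivative a factor `h⁻¹`
before squaring. -/
theorem exists_ball_sup_bound (hc : 0 < c) (l : ℕ) : ∃ K, 0 ≤ K ∧
    ∀ (x₀ : Plane) (h : ℝ), 0 < h → ∀ q ∈ polyDeg l, ∀ x ∈ Metric.closedBall x₀ h,
      ev q x ^ 2 ≤ K / h ^ 2 * intForm (isNice_ball x₀ (h * c)) (q * q) ∧
      ∀ i, ev (dd i q) x ^ 2 ≤ K / h ^ 4 * intForm (isNice_ball x₀ (h * c)) (q * q) := by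
  have hpd : ∀ q ∈ polyDeg l, mulForm (intForm (isNice_ball 0 c)) q q = 0 → q = 0 :=
    fun q _ hq => eq_zero_of_intForm_sq_eq_zero Metric.isOpen_ball
      (Metric.nonempty_ball.2 hc) (isNice_ball 0 c) hq
  have hnn := intForm_sq_nonneg (isNice_ball 0 c)
  obtain ⟨K₀, hK₀, h₀⟩ := exists_sup_bound l (mulForm (intForm (isNice_ball 0 c)))
    (mulForm_symm _) hnn LinearMap.id hpd
  have := fun i : Fin 2 => exists_sup_bound l (mulForm (intForm (isNice_ball 0 c)))
    (mulForm_symm _) hnn (MvPolynomial.pderiv i).toLinearMap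
    fun q hq h => by rw [hpd q hq h, map_zero]
  choose K₁ hK₁ h₁ using this
  refine ⟨K₀ + ∑ i, K₁ i, add_nonneg hK₀ (Finset.sum_nonneg fun i _ => hK₁ i),
    fun x₀ h hh q hq x hx => ?_⟩
  have hy : ‖h⁻¹ • (x - x₀)‖ ≤ 1 := by
    rw [norm_smul, norm_inv, Real.norm_of_nonneg hh.le, ← dist_eq_norm, inv_mul_le_one₀ hh]
    exact hx
  have hxy : x₀ + h • h⁻¹ • (x - x₀) = x := by rw [smul_inv_smul₀ hh.ne']; abel
  have hq' := subst_mem_polyDeg x₀ h hq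
  have hn := hnn (subst x₀ h q)
  rw [intForm_ball _ _ hh, map_mul]
  set N := intForm (isNice_ball 0 c) (subst x₀ h q * subst x₀ h q)
  have hle : ∀ i, K₁ i ≤ ∑ i, K₁ i := fun i =>
    Finset.single_le_sum (fun i _ => hK₁ i) (Finset.mem_univ i)
  constructor
  · have := h₀ _ hq' _ hy
    simp only [LinearMap.id_apply, ev_subst, hxy, mulForm_apply] at this
    rw [show (K₀ + ∑ i, K₁ i) / h ^ 2 * (h ^ 2 * N) = (K₀ + ∑ i, K₁ i) * N by field_simp]
    refine this.trans (mul_le_mul_of_nonneg_right ?_ hn)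
    linarith [Finset.sum_nonneg fun i (_ : i ∈ Finset.univ) => hK₁ i]
  · intro i
    have := h₁ i _ hq' _ hy
    simp only [Derivation.coeFn_coe] at this
    rw [← dd, dd_subst, ev_smul, ev_subst, hxy, mulForm_apply] at this
    rw [show (K₀ + ∑ i, K₁ i) / h ^ 4 * (h ^ 2 * N) = (K₀ + ∑ i, K₁ i) * N / h ^ 2 by field_simp,
      le_div_iff₀ (by positivity), mul_comm, ← mul_pow]
    refine this.trans (mul_le_mul_of_nonneg_right ?_ hn)
    linarith [hle i]

/-- Scaling multiplies squared second derivatives by `h ^ 4` and the area by `h⁻²`, hence the factor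
`h ^ 2`. -/
theorem exists_ball_taylor_bound (hc : 0 < c) (l : ℕ) : ∃ K, 0 ≤ K ∧
    ∀ (x₀ : Plane) (h : ℝ), 0 < h → ∀ q ∈ polyDeg l, ∃ q₁ ∈ polyDeg 1,
      ∀ x ∈ Metric.closedBall x₀ h,
        ev (q - q₁) x ^ 2 ≤ K * h ^ 2 * hessForm (intForm (isNice_ball x₀ (h * c))) q q := by
  have hnn : ∀ q, 0 ≤ hessForm (intForm (isNice_ball 0 c)) q q := fun q => by
    rw [hessForm_apply]
    exact Finset.sum_nonneg fun i _ => Finset.sum_nonneg fun j _ => intForm_sq_nonneg _ _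
  obtain ⟨K, hK, hb⟩ := exists_sup_bound l (hessForm (intForm (isNice_ball 0 c)))
    (fun p q => by simp [hessForm_apply, mul_comm]) hnn taylorRem fun q hq h => by
      refine taylorRem_eq_zero fun i j => ?_
      rw [hessForm_apply, Finset.sum_eq_zero_iff_of_nonneg fun i _ =>
        Finset.sum_nonneg fun j _ => intForm_sq_nonneg _ _] at h
      have h1 := h i (Finset.mem_univ i)
      rw [Finset.sum_eq_zero_iff_of_nonneg fun j _ => intForm_sq_nonneg _ _] at h1
      exact eq_zero_of_intForm_sq_eq_zero Metric.isOpen_ball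
        (Metric.nonempty_ball.2 hc) (isNice_ball 0 c) (h1 j (Finset.mem_univ j))
  -- The approximant is the first order Taylor polynomial of `q` at `x₀`, computed after rescaling
  -- and transported back by the inverse substitution.
  refine ⟨K, hK, fun x₀ h hh q hq => ⟨subst (-(h⁻¹ • x₀)) h⁻¹ (subst x₀ h q -
    taylorRem (subst x₀ h q)), subst_mem_polyDeg _ _ (taylorRem_sub_mem _), fun x hx => ?_⟩⟩
  have hy : ‖h⁻¹ • (x - x₀)‖ ≤ 1 := by
    rw [norm_smul, norm_inv, Real.norm_of_nonneg hh.le, ← dist_eq_norm, inv_mul_le_one₀ hh]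
    exact hx
  have hxy : x₀ + h • h⁻¹ • (x - x₀) = x := by rw [smul_inv_smul₀ hh.ne']; abel
  have h1 := hb _ (subst_mem_polyDeg x₀ h hq) _ hy
  have h2 : hessForm (intForm (isNice_ball 0 c)) (subst x₀ h q) (subst x₀ h q)
      = h ^ 2 * hessForm (intForm (isNice_ball x₀ (h * c))) q q := by
    simp only [hessForm_apply, Finset.mul_sum]
    refine Finset.sum_congr rfl fun i _ => Finset.sum_congr rfl fun j _ => ?_
    rw [intForm_ball _ _ hh, dd_subst, dd, Derivation.map_smul, ← dd, dd_subst,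
      map_mul (subst x₀ h)]
    simp only [smul_mul_smul_comm, map_smul, smul_eq_mul]
    ring
  rw [h2, ← mul_assoc] at h1
  refine le_of_eq_of_le ?_ h1
  rw [ev_sub, ev_subst, show -(h⁻¹ • x₀) + h⁻¹ • x = h⁻¹ • (x - x₀) by rw [smul_sub]; abel,
    ev_sub, ev_subst, hxy]
  ring

theorem measureReal_le_of_subset_closedBall {T : Set Plane} {x₀ : Plane} {h : ℝ} (hh : 0 < h)
    (hT : T ⊆ Metric.closedBall x₀ h) :
    (volume : Measure Plane).real T ≤ h ^ 2 * volume.real (Metric.ball (0 : Plane) 1) := by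
  refine (measureReal_mono hT measure_closedBall_lt_top.ne).trans (le_of_eq ?_)
  rw [Measure.real, Measure.addHaar_closedBall _ _ hh.le, ENNReal.toReal_mul,
    ENNReal.toReal_ofReal (by positivity)]
  simp [Measure.real]

theorem intForm_le_of_sup {μ : Measure Plane} (hμ : IsNice μ) {S : Set Plane}
    (hS : ∀ᵐ x ∂μ, x ∈ S) {q : Poly} {b : ℝ} (hq : ∀ x ∈ S, ev q x ^ 2 ≤ b) :
    intForm hμ (q * q) ≤ μ.real Set.univ * b := by
  have := hμ.finite
  rw [intForm_apply]
  refine (integral_mono_ae (hμ.integrable (continuous_ev _)) (integrable_const b)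
    (hS.mono fun x hx => ?_)).trans (by simp)
  simpa [sq] using hq x hx

/-- Inverse inequalities and polynomial approximation on a set `T` that contains a ball of radius
`h * c` and is contained in the concentric ball of radius `h`. -/
theorem exists_chunky_bounds (hc : 0 < c) (l : ℕ) : ∃ K, 0 < K ∧
    ∀ (T : Set Plane) (hT : IsNice ((volume : Measure Plane).restrict T)) (x₀ : Plane) (h : ℝ),
      0 < h → MeasurableSet T → Metric.ball x₀ (h * c) ⊆ T → T ⊆ Metric.closedBall x₀ h →
      ∀ q ∈ polyDeg l,
        (∀ x ∈ Metric.closedBall x₀ h, ev q x ^ 2 ≤ K / h ^ 2 * intForm hT (q * q)) ∧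
        (∀ i, intForm hT (dd i q * dd i q) ≤ K / h ^ 2 * intForm hT (q * q)) ∧
        ∃ q₁ ∈ polyDeg 1, intForm hT ((q - q₁) * (q - q₁)) ≤
          K * h ^ 4 * hessForm (intForm hT) q q := by
  obtain ⟨K₁, hK₁, h₁⟩ := exists_ball_sup_bound hc l
  obtain ⟨K₂, hK₂, h₂⟩ := exists_ball_taylor_bound hc l
  set m := volume.real (Metric.ball (0 : Plane) 1)
  have hm : 0 ≤ m := measureReal_nonneg
  -- The shape of `T` does not matter: sup bounds on the large ball come from integrals over the
  -- small one, and integrating them over `T` costs its area, at most `m * h ^ 2`.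
  refine ⟨K₁ + m * K₁ + m * K₂ + 1, by positivity, fun T hT x₀ h hh hTm hbT hTb q hq => ?_⟩
  have hmono := intForm_sq_mono hbT (isNice_ball _ _) hT
  have hTn := intForm_sq_nonneg hT
  have hbn := intForm_sq_nonneg (isNice_ball x₀ (h * c))
  have hvol := measureReal_le_of_subset_closedBall hh hTb
  have hae : ∀ᵐ x ∂(volume : Measure Plane).restrict T, x ∈ Metric.closedBall x₀ h :=
    (ae_restrict_iff' hTm).2 (.of_forall fun x hx => hTb hx)
  refine ⟨fun x hx => ?_, fun i => ?_, ?_⟩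
  · refine ((h₁ x₀ h hh q hq x hx).1.trans (mul_le_mul_of_nonneg_left (hmono q)
      (by positivity))).trans (mul_le_mul_of_nonneg_right ?_ (hTn q))
    gcongr
    nlinarith [mul_nonneg hm hK₁, mul_nonneg hm hK₂]
  · refine (intForm_le_of_sup hT hae fun x hx => ((h₁ x₀ h hh q hq x hx).2 i).trans
      (mul_le_mul_of_nonneg_left (hmono q) (by positivity))).trans ?_
    rw [measureReal_restrict_apply MeasurableSet.univ, Set.univ_inter]
    refine (mul_le_mul_of_nonneg_right hvol
      (mul_nonneg (by positivity) (hTn q))).trans ?_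
    rw [show h ^ 2 * m * (K₁ / h ^ 4 * intForm hT (q * q))
      = m * K₁ / h ^ 2 * intForm hT (q * q) by field_simp]
    refine mul_le_mul_of_nonneg_right ?_ (hTn q)
    gcongr
    nlinarith [mul_nonneg hm hK₁, mul_nonneg hm hK₂]
  · obtain ⟨q₁, hq₁, hb⟩ := h₂ x₀ h hh q hq
    refine ⟨q₁, hq₁, ?_⟩
    have hH : hessForm (intForm (isNice_ball x₀ (h * c))) q q ≤ hessForm (intForm hT) q q := by
      simp only [hessForm_apply]
      exact Finset.sum_le_sum fun i _ => Finset.sum_le_sum fun j _ => hmono _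
    have hHn : 0 ≤ hessForm (intForm hT) q q := by
      rw [hessForm_apply]
      exact Finset.sum_nonneg fun i _ => Finset.sum_nonneg fun j _ => hTn _
    refine (intForm_le_of_sup hT hae fun x hx => (hb x hx).trans
      (mul_le_mul_of_nonneg_left hH (by positivity))).trans ?_
    rw [measureReal_restrict_apply MeasurableSet.univ, Set.univ_inter]
    refine (mul_le_mul_of_nonneg_right hvol (mul_nonneg (by positivity) hHn)).trans ?_
    rw [show h ^ 2 * m * (K₂ * h ^ 2 * hessForm (intForm hT) q q)
      = m * K₂ * h ^ 4 * hessForm (intForm hT) q q by ring]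
    refine mul_le_mul_of_nonneg_right ?_ hHn
    gcongr
    nlinarith [mul_nonneg hm hK₁, mul_nonneg hm hK₂]

end

/-! ### Material tensors -/

/-- The entries of a matrix, as a vector. -/
def pairVec (τ : Matrix (Fin 2) (Fin 2) ℝ) : Fin 2 × Fin 2 → ℝ := fun p => τ p.1 p.2

theorem frob_eq (σ τ : Matrix (Fin 2) (Fin 2) ℝ) : frob σ τ = pairVec σ ⬝ᵥ pairVec τ := by
  simp [frob, pairVec, dotProduct, Fintype.sum_prod_type]

theorem pairVec_app (A : Tensor4) (τ : Matrix (Fin 2) (Fin 2) ℝ) :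
    pairVec (A.app τ) = A.mulVec (pairVec τ) := rfl

theorem frob_self_nonneg (τ : Matrix (Fin 2) (Fin 2) ℝ) : 0 ≤ frob τ τ :=
  Finset.sum_nonneg fun _ _ => Finset.sum_nonneg fun _ _ => mul_self_nonneg _

theorem app_sq_le (A : Tensor4) (τ : Matrix (Fin 2) (Fin 2) ℝ) (i j : Fin 2) :
    A.app τ i j ^ 2 ≤ (∑ p, ∑ q, A p q ^ 2) * frob τ τ := by
  refine (Finset.sum_mul_sq_le_sq_mul_sq _ _ _).trans ?_
  have : ∑ p : Fin 2 × Fin 2, τ p.1 p.2 ^ 2 = frob τ τ := by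
    simp [frob, Fintype.sum_prod_type, sq]
  rw [this]
  refine mul_le_mul_of_nonneg_right ?_ (frob_self_nonneg τ)
  exact Finset.single_le_sum (f := fun p => ∑ q, A p q ^ 2)
    (fun p _ => Finset.sum_nonneg fun q _ => sq_nonneg _) (Finset.mem_univ (i, j))

/-- The subspace of symmetric matrices. -/
def symMatrix : Submodule ℝ (Matrix (Fin 2) (Fin 2) ℝ) where
  carrier := {τ | τ.IsSymm}
  add_mem' h h' := h.add h'
  zero_mem' := Matrix.isSymm_zero
  smul_mem' c _ h := h.smul c

namespace Tensor4

variable {A : Tensor4}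

theorem IsSymmElliptic.frob_app_comm (hA : A.IsSymmElliptic) (σ τ : Matrix (Fin 2) (Fin 2) ℝ) :
    frob (A.app σ) τ = frob (A.app τ) σ := by
  have : A.transpose = A := by ext p q; exact hA.major q p
  rw [frob_eq, frob_eq, pairVec_app, pairVec_app, dotProduct_comm,
    Matrix.dotProduct_mulVec, ← Matrix.mulVec_transpose, this]

/-- The lower bound holds because each entry is a linear form on symmetric matrices, where the
energy is definite; the squared entries sum to the Frobenius norm. The upper bounds are
Cauchy–Schwarz. -/
theorem IsSymmElliptic.exists_bounds (hA : A.IsSymmElliptic) : ∃ c C, 0 < c ∧ 0 < C ∧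
    ∀ τ : Matrix (Fin 2) (Fin 2) ℝ, τ.IsSymm → c * frob τ τ ≤ frob (A.app τ) τ ∧
      frob (A.app τ) τ ≤ C * frob τ τ ∧ ∀ i j, A.app τ i j ^ 2 ≤ C * frob τ τ := by
  let B : symMatrix →ₗ[ℝ] symMatrix →ₗ[ℝ] ℝ := LinearMap.mk₂ ℝ
    (fun σ τ => frob (A.app σ) τ)
    (fun a b d => by simp [frob, app, Fintype.sum_prod_type]; ring)
    (fun c a b => by simp [frob, app, Fintype.sum_prod_type]; ring)
    (fun a b d => by simp [frob, mul_add]; ring)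
    (fun c a b => by simp [frob, mul_add]; ring)
  have hB : ∀ τ : symMatrix, B τ τ = 0 → τ = 0 := fun τ h => by
    by_contra hne
    exact (hA.elliptic τ τ.2 (fun h => hne (Subtype.ext h))).ne' h
  have hB0 : ∀ τ : symMatrix, 0 ≤ B τ τ := fun τ => by
    by_cases hne : τ = 0
    · simp [hne]
    · exact (hA.elliptic τ τ.2 (fun h => hne (Subtype.ext h))).le
  have key : ∀ p : Fin 2 × Fin 2, ∃ K, 0 ≤ K ∧
      ∀ τ : symMatrix, (τ : Matrix (Fin 2) (Fin 2) ℝ) p.1 p.2 ^ 2 ≤ K * B τ τ := fun p =>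
    exists_sq_le_of_vanishes_on_ker B (fun x y => hA.frob_app_comm _ _) hB0
      ((Matrix.entryLinearMap ℝ ℝ p.1 p.2).comp symMatrix.subtype)
      fun x hx => by simp [hB x hx]
  choose K hK0 hK using key
  have hS : 0 ≤ ∑ p, K p := Finset.sum_nonneg fun p _ => hK0 p
  set N := ∑ p, ∑ q, A p q ^ 2
  have hN : 0 ≤ N := Finset.sum_nonneg fun p _ => Finset.sum_nonneg fun q _ => sq_nonneg _
  refine ⟨(∑ p, K p + 1)⁻¹, 4 * N + 1, by positivity, by positivity, fun τ hτ => ⟨?_, ?_, ?_⟩⟩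
  · rw [inv_mul_le_iff₀ (by positivity)]
    have h1 : frob τ τ = ∑ p : Fin 2 × Fin 2, τ p.1 p.2 ^ 2 := by
      simp [frob, Fintype.sum_prod_type, sq]
    have h2 : frob τ τ ≤ (∑ p, K p) * frob (A.app τ) τ := by
      rw [h1, Finset.sum_mul]
      exact Finset.sum_le_sum fun p _ => hK p ⟨τ, hτ⟩
    have h3 : 0 ≤ frob (A.app τ) τ := hB0 ⟨τ, hτ⟩
    nlinarith
  · have h1 : frob (A.app τ) τ ≤ ∑ i, ∑ j, (A.app τ i j ^ 2 + τ i j * τ i j) :=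
      Finset.sum_le_sum fun i _ => Finset.sum_le_sum fun j _ => by
        nlinarith [sq_nonneg (A.app τ i j - τ i j), sq_nonneg (A.app τ i j + τ i j)]
    have h2 : ∑ i, ∑ j, A.app τ i j ^ 2 ≤ ∑ _i : Fin 2, ∑ _j : Fin 2, N * frob τ τ :=
      Finset.sum_le_sum fun i _ => Finset.sum_le_sum fun j _ => app_sq_le A τ i j
    simp only [Finset.sum_add_distrib] at h1
    simp only [Finset.sum_const, Finset.card_univ, Fintype.card_fin, nsmul_eq_mul,
      Nat.cast_ofNat] at h2
    have h3 : frob τ τ = ∑ i, ∑ j, τ i j * τ i j := rfl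
    linarith
  · intro i j
    refine (app_sq_le A τ i j).trans (mul_le_mul_of_nonneg_right ?_ (frob_self_nonneg τ))
    linarith

theorem IsSymmElliptic.isHermitian (hA : A.IsSymmElliptic) : Matrix.IsHermitian A := by
  ext p q
  simpa using hA.major q p

theorem IsSymmElliptic.app_symm (hA : A.IsSymmElliptic) (τ : Matrix (Fin 2) (Fin 2) ℝ) :
    (A.app τ).IsSymm := by
  ext i j
  simp [app, Matrix.transpose_apply, hA.minor i j]

/-- Ellipticity speaks of symmetric matrices only. By the symmetries of `A`, replacing `τ` by `τ +
τᵀ` multiplies the energy by 4, so `A` is semidefinite on all matrices, as the square root requires.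
-/
theorem IsSymmElliptic.frob_app_nonneg (hA : A.IsSymmElliptic) (τ : Matrix (Fin 2) (Fin 2) ℝ) :
    0 ≤ frob (A.app τ) τ := by
  have h1 : A.app τ.transpose = A.app τ := by
    ext i j
    simp only [app, Fintype.sum_prod_type, Fin.sum_univ_two, Matrix.transpose_apply,
      hA.major (i, j) (1, 0), hA.major (i, j) (0, 1), hA.minor 1 0 (i, j)]
    ring
  have h2 : A.app (τ + τ.transpose) = (2 : ℝ) • A.app τ := by
    rw [two_smul]
    nth_rewrite 2 [← h1]
    ext i j
    simp [app, mul_add, Finset.sum_add_distrib]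
  have h3 : frob (A.app (τ + τ.transpose)) (τ + τ.transpose) = 4 * frob (A.app τ) τ := by
    have hs := fun i j => Matrix.IsSymm.apply (hA.app_symm τ) i j
    rw [h2]
    simp only [frob, Fin.sum_univ_two, Matrix.smul_apply, Matrix.add_apply, smul_eq_mul,
      Matrix.transpose_apply, hs 0 1]
    ring
  have h4 : 0 ≤ frob (A.app (τ + τ.transpose)) (τ + τ.transpose) := by
    by_cases h : τ + τ.transpose = 0
    · rw [h]; simp [frob]
    · exact (hA.elliptic _ (Matrix.isSymm_add_transpose_self τ) h).le
  linarith

theorem IsSymmElliptic.posSemidef (hA : A.IsSymmElliptic) : Matrix.PosSemidef A := by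
  refine Matrix.PosSemidef.of_dotProduct_mulVec_nonneg hA.isHermitian fun x => ?_
  let τ : Matrix (Fin 2) (Fin 2) ℝ := fun i j => x (i, j)
  have : 0 ≤ frob (A.app τ) τ := hA.frob_app_nonneg τ
  rw [frob_eq, pairVec_app, dotProduct_comm] at this
  exact this

/-- This removes the square root from the seminorm, leaving the energy of `v_T`. -/
theorem IsSymmElliptic.frob_sqrt (hA : A.IsSymmElliptic) (τ : Matrix (Fin 2) (Fin 2) ℝ) :
    frob (A.sqrt.app τ) (A.sqrt.app τ) = frob (A.app τ) τ := by
  have h0 : 0 ≤ A := Matrix.nonneg_iff_posSemidef.2 hA.posSemidef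
  have h1 : A.sqrt * A.sqrt = A := CFC.sqrt_mul_sqrt_self A h0
  have h2 : A.sqrt.transpose = A.sqrt := by
    have : Matrix.PosSemidef A.sqrt := Matrix.nonneg_iff_posSemidef.1 (CFC.sqrt_nonneg A)
    simpa using this.isHermitian.eq
  rw [frob_eq, frob_eq, pairVec_app, pairVec_app, Matrix.dotProduct_mulVec,
    ← Matrix.mulVec_transpose, h2, Matrix.mulVec_mulVec, h1]

/-- Positivity is all that is needed of the largest eigenvalue. The supremum must be shown to range
over a bounded set, since an unbounded one would have the default value 0, and to contain a positive
element. -/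
theorem IsSymmElliptic.maxEig_pos (hA : A.IsSymmElliptic) : 0 < A.maxEig := by
  obtain ⟨c, C, hc, hC, hb⟩ := hA.exists_bounds
  have hpos : ∀ τ : Matrix (Fin 2) (Fin 2) ℝ, τ ≠ 0 → 0 < frob τ τ := fun τ hτ => by
    refine (frob_self_nonneg τ).lt_of_ne fun h => hτ ?_
    rw [frob_eq, eq_comm, dotProduct_self_eq_zero] at h
    ext i j
    exact congrFun h (i, j)
  have hfrob : ∀ (e : ℝ) (τ : Matrix (Fin 2) (Fin 2) ℝ), frob (e • τ) τ = e * frob τ τ :=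
    fun e τ => by simp [frob]; ring
  have hbdd : BddAbove {c : ℝ | ∃ τ : Matrix (Fin 2) (Fin 2) ℝ,
      τ.IsSymm ∧ τ ≠ 0 ∧ A.app τ = c • τ} := by
    refine ⟨C, ?_⟩
    rintro e ⟨τ, hs, hne, he⟩
    have := (hb τ hs).2.1
    rw [he, hfrob] at this
    exact le_of_mul_le_mul_right this (hpos τ hne)
  have hA0 : A ≠ 0 := fun h => by
    have := hA.elliptic 1 Matrix.isSymm_one one_ne_zero
    simp [h, app, frob] at this
  obtain ⟨x, e, he, hx, hxe⟩ := hA.isHermitian.exists_eigenvector_of_ne_zero hA0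
  let τ : Matrix (Fin 2) (Fin 2) ℝ := fun i j => x (i, j)
  have hτ : A.app τ = e • τ := by
    ext i j
    exact congrFun hxe (i, j)
  -- An eigenvector for a nonzero eigenvalue lies in the range of `A`, which consists of symmetric
  -- matrices.
  have hτs : τ.IsSymm := by
    have h1 : τ = e⁻¹ • A.app τ := by rw [hτ, inv_smul_smul₀ he]
    rw [h1]
    exact (hA.app_symm τ).smul _
  have hτ0 : τ ≠ 0 := fun h => hx (by ext p; exact congrFun (congrFun h p.1) p.2)
  have h1 := hA.elliptic τ hτs hτ0
  rw [hτ, hfrob] at h1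
  exact (pos_of_mul_pos_left h1 (frob_self_nonneg τ)).trans_le
    (le_csSup hbdd ⟨τ, hτs, hτ0, hτ⟩)

end Tensor4

/-! ### Positive linear forms on polynomials -/

/-- Cauchy–Schwarz for the direct sum of the semidefinite forms, used to sum over all faces at once.
-/
theorem sum_sq_le {ι : Type*} [Fintype ι] (φ : ι → Poly →ₗ[ℝ] ℝ)
    (h : ∀ i p, 0 ≤ φ i (p * p)) (x y : ι → Poly) :
    (∑ i, φ i (x i * y i)) ^ 2 ≤ (∑ i, φ i (x i * x i)) * ∑ i, φ i (y i * y i) := by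
  refine sq_le_mul_of_quadratic_nonneg fun t => ?_
  have := Finset.sum_nonneg fun i (_ : i ∈ Finset.univ) => h i (x i + t • y i)
  refine this.trans_eq ?_
  simp only [Finset.mul_sum, ← Finset.sum_add_distrib]
  refine Finset.sum_congr rfl fun i _ => ?_
  rw [show (x i + t • y i) * (x i + t • y i)
    = x i * x i + (2 * t) • (x i * y i) + t ^ 2 • (y i * y i) by
      simp only [MvPolynomial.smul_eq_C_mul, map_mul, map_pow, map_ofNat]; ring]
  simp

section

variable {φ : Poly →ₗ[ℝ] ℝ}

theorem form_add_sq_le (h : ∀ p, 0 ≤ φ (p * p)) (x y : Poly) :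
    φ ((x + y) * (x + y)) ≤ 2 * φ (x * x) + 2 * φ (y * y) := by
  have := h (x - y)
  rw [show (x - y) * (x - y) = (2 : ℝ) • (x * x) + (2 : ℝ) • (y * y) - (x + y) * (x + y) by
    simp only [MvPolynomial.smul_eq_C_mul, map_ofNat]; ring] at this
  simp at this
  linarith

theorem form_sub_sq_le (h : ∀ p, 0 ≤ φ (p * p)) (x y : Poly) :
    φ ((x - y) * (x - y)) ≤ 2 * φ (x * x) + 2 * φ (y * y) := by
  simpa [sub_eq_add_neg] using form_add_sq_le h x (-y)

/-- Pythagoras: `z` is orthogonal to `u - z`. Every estimate of a projection, or of its complement,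
is an instance. -/
theorem form_sq_le_of_eq (h : ∀ p, 0 ≤ φ (p * p)) {z u : Poly} (hz : φ (z * (u - z)) = 0) :
    φ (z * z) ≤ φ (u * u) := by
  have := h (u - z)
  rw [show (u - z) * (u - z) = u * u - z * z - (2 : ℝ) • (z * (u - z)) by
    simp only [MvPolynomial.smul_eq_C_mul, map_ofNat]; ring] at this
  simp [hz] at this
  exact this

theorem form_smul_sq_le (h : ∀ p, 0 ≤ φ (p * p)) {a : ℝ} (ha : |a| ≤ 1) (x : Poly) :
    φ ((a • x) * (a • x)) ≤ φ (x * x) := by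
  rw [smul_mul_smul_comm, map_smul, smul_eq_mul]
  have : a * a ≤ 1 := by nlinarith [abs_le.1 ha]
  nlinarith [h x]

theorem form_sum_normal_le (h : ∀ p, 0 ≤ φ (p * p)) {n : Fin 2 → ℝ} (hn : ∀ i, |n i| ≤ 1)
    (x : Fin 2 → Poly) :
    φ ((∑ i, n i • x i) * ∑ i, n i • x i) ≤ 2 * ∑ i, φ (x i * x i) := by
  simp only [Fin.sum_univ_two]
  refine (form_add_sq_le h _ _).trans ?_
  linarith [form_smul_sq_le h (hn 0) (x 0), form_smul_sq_le h (hn 1) (x 1)]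

theorem hessForm_nonneg (h : ∀ p, 0 ≤ φ (p * p)) (u : Poly) : 0 ≤ hessForm φ u u := by
  rw [hessForm_apply]
  exact Finset.sum_nonneg fun i _ => Finset.sum_nonneg fun j _ => h _

theorem hessForm_add_le (h : ∀ p, 0 ≤ φ (p * p)) (u v : Poly) :
    hessForm φ (u + v) (u + v) ≤ 2 * hessForm φ u u + 2 * hessForm φ v v := by
  simp only [hessForm_apply, Finset.mul_sum, ← Finset.sum_add_distrib]
  refine Finset.sum_le_sum fun i _ => Finset.sum_le_sum fun j _ => ?_
  simp only [dd, map_add]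
  exact form_add_sq_le h _ _

theorem hessForm_neg (u : Poly) : hessForm φ (-u) (-u) = hessForm φ u u := by simp

end

/-! ### The energy form -/

/-- The integrand `A ∇²u : ∇²w`. -/
def energyPoly (A : Tensor4) (u w : Poly) : Poly :=
  ∑ i, ∑ j, -moment A u i j * dd i (dd j w)

theorem ev_moment (A : Tensor4) (u : Poly) (i j : Fin 2) (x : Plane) :
    ev (moment A u i j) x = -A.app (hess u x) i j := by
  simp [moment, Tensor4.app, hess]

theorem ev_energyPoly (A : Tensor4) (u w : Poly) (x : Plane) :
    ev (energyPoly A u w) x = frob (A.app (hess u x)) (hess w x) := by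
  simp [energyPoly, frob, ev_moment, hess]
  ring

theorem hess_isSymm (u : Poly) (x : Plane) : (hess u x).IsSymm := by
  ext i j
  simp [hess, dd_comm i j]

theorem moment_add (A : Tensor4) (u v : Poly) (i j : Fin 2) :
    moment A (u + v) i j = moment A u i j + moment A v i j := by
  simp [moment, mul_add, Finset.sum_add_distrib]
  ring

theorem moment_smul (A : Tensor4) (c : ℝ) (u : Poly) (i j : Fin 2) :
    moment A (c • u) i j = c • moment A u i j := by
  simp [moment, Finset.smul_sum]

theorem moment_sub (A : Tensor4) (u v : Poly) (i j : Fin 2) :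
    moment A (u - v) i j = moment A u i j - moment A v i j := by
  rw [sub_eq_add_neg, ← neg_one_smul ℝ v, moment_add, moment_smul]
  simp [sub_eq_add_neg]

theorem energyPoly_comm {A : Tensor4} (hA : A.IsSymmElliptic) (u w : Poly) :
    energyPoly A u w = energyPoly A w u :=
  MvPolynomial.funext fun x => by
    have := ev_energyPoly A u w (WithLp.toLp 2 x)
    rw [hA.frob_app_comm, ← ev_energyPoly] at this
    exact this

theorem energyPoly_sub (A : Tensor4) (u v w : Poly) :
    energyPoly A (u - v) w = energyPoly A u w - energyPoly A v w := by
  simp [energyPoly, moment_sub]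
  ring

/-- A crude degree bound, sufficient to keep the moments in the range of the trace and inverse
inequalities. -/
theorem moment_mem {l : ℕ} (A : Tensor4) {u : Poly} (hu : u ∈ polyDeg l) (i j : Fin 2) :
    moment A u i j ∈ polyDeg l := by
  refine Submodule.neg_mem _ (Submodule.sum_mem _ fun p _ => ?_)
  rw [← MvPolynomial.smul_eq_C_mul]
  exact Submodule.smul_mem _ _ (polyDeg_mono (by omega) (dd_mem_polyDeg (dd_mem_polyDeg hu _) _))

/-! ### Abstract form of the local estimates -/

/-- The integration forms `Ψ` on an element and `Φ F` on its faces, the normals `n F` and the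
diameter `h`: divergence formula, discrete trace and inverse inequalities, approximation. -/
structure LocalBounds {𝓕 : Type*} [Fintype 𝓕] (Ψ : Poly →ₗ[ℝ] ℝ) (Φ : 𝓕 → Poly →ₗ[ℝ] ℝ)
    (n : 𝓕 → Fin 2 → ℝ) (h K : ℝ) (l : ℕ) : Prop where
  pos : 0 < h
  nonneg : ∀ p, 0 ≤ Ψ (p * p)
  nonneg_face : ∀ F p, 0 ≤ Φ F (p * p)
  normal_le : ∀ F i, |n F i| ≤ 1
  green : ∀ q i, Ψ (dd i q) = ∑ F, n F i * Φ F q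
  trace : ∀ q ∈ polyDeg l, ∑ F, Φ F (q * q) ≤ K / h * Ψ (q * q)
  inverse : ∀ q ∈ polyDeg l, ∀ i, Ψ (dd i q * dd i q) ≤ K / h ^ 2 * Ψ (q * q)
  poincare : ∀ q ∈ polyDeg l, ∃ q₁ ∈ polyDeg 1,
    Ψ ((q - q₁) * (q - q₁)) ≤ K * h ^ 4 * hessForm Ψ q q

/-- The bounds relating the energy to the Hessian. -/
structure EnergyBounds (A : Tensor4) (Ψ : Poly →ₗ[ℝ] ℝ) (c C : ℝ) : Prop where
  lower : ∀ u, c * hessForm Ψ u u ≤ Ψ (energyPoly A u u)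
  upper : ∀ u, Ψ (energyPoly A u u) ≤ C * hessForm Ψ u u
  moment_le : ∀ u i j, Ψ (moment A u i j * moment A u i j) ≤ C * hessForm Ψ u u

section

variable {𝓕 : Type*} [Fintype 𝓕] {Ψ : Poly →ₗ[ℝ] ℝ} {Φ : 𝓕 → Poly →ₗ[ℝ] ℝ}
  {n : 𝓕 → Fin 2 → ℝ} {h K : ℝ} {l : ℕ} {A : Tensor4}

/-- The right-hand side of the reconstruction, for polynomial face unknowns. -/
def recForm (A : Tensor4) (Ψ : Poly →ₗ[ℝ] ℝ) (Φ : 𝓕 → Poly →ₗ[ℝ] ℝ) (n : 𝓕 → Fin 2 → ℝ)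
    (v : Poly) (g : 𝓕 → Fin 2 → Poly) (t : 𝓕 → Poly) (w : Poly) : ℝ :=
  -Ψ (v * divDivMoment A w) - ∑ F, ∑ i, Φ F (g F i * ∑ j, n F j • moment A w i j)
    + ∑ F, Φ F (t F * ∑ i, n F i • divMoment A w i)

/-- Two integrations by parts: with the exact face data `∇v` and `v`, the right-hand side of the
reconstruction is the energy of `v` against `w`. -/
theorem energy_eq_recForm (hA : A.IsSymmElliptic)
    (hg : ∀ q i, Ψ (dd i q) = ∑ F, n F i * Φ F q) (v w : Poly) :
    Ψ (energyPoly A v w) = recForm A Ψ Φ n v (fun _ i => dd i v) (fun _ => v) w := by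
  have h1 : ∑ i, ∑ j, dd j (dd i v * moment A w i j)
      = -energyPoly A w v + ∑ i, dd i v * divMoment A w i := by
    simp only [energyPoly, divMoment, dd, Derivation.leibniz, smul_eq_mul, Fin.sum_univ_two]
    have := dd_comm 0 1 v
    simp only [dd] at this
    rw [this]
    ring
  have h2 : ∑ i, dd i (v * divMoment A w i)
      = ∑ i, dd i v * divMoment A w i + v * divDivMoment A w := by
    simp only [divDivMoment, dd, Derivation.leibniz, smul_eq_mul, Fin.sum_univ_two]
    ring
  have h3 := congrArg Ψ h1
  have h4 := congrArg Ψ h2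
  simp only [map_sum, map_add, map_neg, hg] at h3 h4
  rw [energyPoly_comm hA, recForm]
  have h5 : ∑ i, ∑ j, ∑ F, n F j * Φ F (dd i v * moment A w i j)
      = ∑ F, ∑ i, Φ F (dd i v * ∑ j, n F j • moment A w i j) := by
    simp only [Finset.mul_sum, mul_smul_comm, map_sum, map_smul, smul_eq_mul]
    simp only [Fin.sum_univ_two, Finset.sum_add_distrib]
  have h6 : ∑ i, ∑ F, n F i * Φ F (v * divMoment A w i)
      = ∑ F, Φ F (v * ∑ i, n F i • divMoment A w i) := by
    simp only [Finset.mul_sum, mul_smul_comm, map_sum, map_smul, smul_eq_mul]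
    exact Finset.sum_comm
  rw [h5] at h3
  rw [h6] at h4
  linarith

/-- Square the inequality, insert the Cauchy–Schwarz bounds and cancel one factor `X`, the case `X =
0` being trivial. -/
theorem le_of_mul_le_sub {c a₁ a₀ X z₁ z₀ s₁ s₀ : ℝ} (hc : 0 < c) (ha₁ : 0 ≤ a₁) (ha₀ : 0 ≤ a₀)
    (hX : 0 ≤ X) (hz₁ : 0 ≤ z₁) (hz₀ : 0 ≤ z₀) (h : c * X ≤ -s₁ + s₀)
    (h₁ : s₁ ^ 2 ≤ a₁ * z₁ * X) (h₀ : s₀ ^ 2 ≤ a₀ * z₀ * X) :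
    X ≤ (2 * a₁ + 2 * a₀) / c ^ 2 * (z₁ + z₀) := by
  have hsq : (c * X) ^ 2 ≤ 2 * s₁ ^ 2 + 2 * s₀ ^ 2 := by
    have h1 : (c * X) ^ 2 ≤ (-s₁ + s₀) ^ 2 := pow_le_pow_left₀ (by positivity) h 2
    nlinarith [sq_nonneg (s₁ + s₀)]
  have u₁ : 0 ≤ a₀ * z₁ * X := by positivity
  have u₀ : 0 ≤ a₁ * z₀ * X := by positivity
  have hfin : c ^ 2 * X * X ≤ (2 * a₁ + 2 * a₀) * (z₁ + z₀) * X := by nlinarith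
  rcases hX.eq_or_lt with h0 | h0
  · rw [← h0]; positivity
  · rw [div_mul_eq_mul_div, le_div_iff₀ (by positivity), mul_comm]
    exact le_of_mul_le_mul_right hfin h0

/-- The Hessian of the difference of the reconstruction and the element unknown is controlled
by the jumps on the faces. -/
theorem hessForm_le_of_reconstruction (hA : A.IsSymmElliptic) (hL : LocalBounds Ψ Φ n h K l)
    (hK : 0 < K) {c C : ℝ} (hc : 0 < c) (hC : 0 < C) (hE : EnergyBounds A Ψ c C) {v p : Poly}
    (hv : v ∈ polyDeg l) (hp : p ∈ polyDeg l) (g : 𝓕 → Fin 2 → Poly) (t : 𝓕 → Poly)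
    (hrec : ∀ w ∈ polyDeg l, Ψ (energyPoly A p w) = recForm A Ψ Φ n v g t w) :
    hessForm Ψ (p - v) (p - v) ≤ (16 * K * C + 32 * K ^ 2 * C) / c ^ 2 *
      ((∑ F, ∑ i, Φ F ((g F i - dd i v) * (g F i - dd i v))) / h +
        (∑ F, Φ F ((t F - v) * (t F - v))) / h ^ 3) := by
  have hh := hL.pos
  set w := p - v
  have hw : w ∈ polyDeg l := sub_mem hp hv
  set X := hessForm Ψ w w
  have hX : 0 ≤ X := hessForm_nonneg hL.nonneg w
  set Y₁ := ∑ F, ∑ i, Φ F ((g F i - dd i v) * (g F i - dd i v))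
  set Y₀ := ∑ F, Φ F ((t F - v) * (t F - v))
  have hY₁ : 0 ≤ Y₁ := Finset.sum_nonneg fun F _ => Finset.sum_nonneg fun i _ => hL.nonneg_face F _
  have hY₀ : 0 ≤ Y₀ := Finset.sum_nonneg fun F _ => hL.nonneg_face F _
  set s₁ := ∑ F, ∑ i, Φ F ((g F i - dd i v) * ∑ j, n F j • moment A w i j) with hs₁
  set s₀ := ∑ F, Φ F ((t F - v) * ∑ i, n F i • divMoment A w i) with hs₀
  -- Subtracting the identity for exact face data from the equation for `p` cancels the volume term;
  -- only jumps remain.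
  have henergy : Ψ (energyPoly A w w) = -s₁ + s₀ := by
    rw [energyPoly_sub, map_sub, hrec w hw, energy_eq_recForm hA hL.green, recForm, recForm]
    simp only [hs₁, hs₀, sub_mul, map_sub, Finset.sum_sub_distrib]
    ring
  have hM := moment_mem A hw
  have hdiv : ∀ i, Ψ (divMoment A w i * divMoment A w i) ≤ 4 * K * C / h ^ 2 * X := by
    intro i
    have h1 : Ψ (divMoment A w i * divMoment A w i) ≤ 2 * ∑ _j : Fin 2, K / h ^ 2 * (C * X) := by
      refine le_trans ?_ (mul_le_mul_of_nonneg_left (Finset.sum_le_sum fun j _ =>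
        (hL.inverse _ (hM i j) j).trans (mul_le_mul_of_nonneg_left (hE.moment_le w i j)
          (by positivity))) zero_le_two)
      simpa [divMoment, Fin.sum_univ_two, mul_add] using
        form_add_sq_le hL.nonneg (dd 0 (moment A w i 0)) (dd 1 (moment A w i 1))
    refine h1.trans (le_of_eq ?_)
    simp only [Fin.sum_univ_two]
    ring
  have hdivm : ∀ i, divMoment A w i ∈ polyDeg l := fun i =>
    Submodule.sum_mem _ fun j _ => polyDeg_mono (by omega) (dd_mem_polyDeg (hM i j) j)
  -- Trace inequality for the moments; 8 is the product of two components `i`, two components `j`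
  -- and the factor 2 of `form_sum_normal_le`.
  have b₁ : s₁ ^ 2 ≤ Y₁ * (8 * K * C / h * X) := by
    have := sum_sq_le (fun x : 𝓕 × Fin 2 => Φ x.1) (fun x => hL.nonneg_face x.1)
      (fun x => g x.1 x.2 - dd x.2 v) (fun x => ∑ j, n x.1 j • moment A w x.2 j)
    simp only [Fintype.sum_prod_type] at this
    refine this.trans (mul_le_mul_of_nonneg_left ?_ hY₁)
    have h1 : ∑ F, ∑ i, Φ F ((∑ j, n F j • moment A w i j) * ∑ j, n F j • moment A w i j)
        ≤ ∑ F, ∑ i, 2 * ∑ j, Φ F (moment A w i j * moment A w i j) :=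
      Finset.sum_le_sum fun F _ => Finset.sum_le_sum fun i _ =>
        form_sum_normal_le (hL.nonneg_face F) (hL.normal_le F) _
    have h2 : ∑ F, ∑ i, 2 * ∑ j, Φ F (moment A w i j * moment A w i j)
        = ∑ i, ∑ j, 2 * ∑ F, Φ F (moment A w i j * moment A w i j) := by
      simp only [Fin.sum_univ_two, Finset.sum_add_distrib, Finset.mul_sum, mul_add]
    have h3 : ∑ i, ∑ j, 2 * ∑ F, Φ F (moment A w i j * moment A w i j)
        ≤ ∑ _i : Fin 2, ∑ _j : Fin 2, 2 * (K / h * (C * X)) :=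
      Finset.sum_le_sum fun i _ => Finset.sum_le_sum fun j _ =>
        mul_le_mul_of_nonneg_left ((hL.trace _ (hM i j)).trans
          (mul_le_mul_of_nonneg_left (hE.moment_le w i j) (by positivity))) zero_le_two
    refine (h1.trans (h2.le.trans h3)).trans (le_of_eq ?_)
    simp only [Fin.sum_univ_two]
    ring
  -- One more derivative falls on the moments, so the inverse inequality `hdiv` precedes the trace
  -- inequality and the power of `h` becomes 3.
  have b₀ : s₀ ^ 2 ≤ Y₀ * (16 * K ^ 2 * C / h ^ 3 * X) := by
    refine (sum_sq_le Φ hL.nonneg_face _ _).trans (mul_le_mul_of_nonneg_left ?_ hY₀)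
    have h1 : ∑ F, Φ F ((∑ i, n F i • divMoment A w i) * ∑ i, n F i • divMoment A w i)
        ≤ ∑ F, 2 * ∑ i, Φ F (divMoment A w i * divMoment A w i) :=
      Finset.sum_le_sum fun F _ => form_sum_normal_le (hL.nonneg_face F) (hL.normal_le F) _
    have h2 : ∑ F, 2 * ∑ i, Φ F (divMoment A w i * divMoment A w i)
        = ∑ i, 2 * ∑ F, Φ F (divMoment A w i * divMoment A w i) := by
      simp only [Fin.sum_univ_two, Finset.sum_add_distrib, Finset.mul_sum, mul_add]
    have h3 : ∑ i, 2 * ∑ F, Φ F (divMoment A w i * divMoment A w i)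
        ≤ ∑ _i : Fin 2, 2 * (K / h * (4 * K * C / h ^ 2 * X)) :=
      Finset.sum_le_sum fun i _ => mul_le_mul_of_nonneg_left ((hL.trace _ (hdivm i)).trans
          (mul_le_mul_of_nonneg_left (hdiv i) (by positivity))) zero_le_two
    refine (h1.trans (h2.le.trans h3)).trans (le_of_eq ?_)
    simp only [Fin.sum_univ_two]
    field_simp
    ring
  have hcX : c * X ≤ -s₁ + s₀ := (hE.lower w).trans_eq henergy
  have e₁ : Y₁ * (8 * K * C / h * X) = 8 * K * C * (Y₁ / h) * X := by ring
  have e₀ : Y₀ * (16 * K ^ 2 * C / h ^ 3 * X) = 16 * K ^ 2 * C * (Y₀ / h ^ 3) * X := by ring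
  refine (le_of_mul_le_sub hc (by positivity : (0 : ℝ) ≤ 8 * K * C)
    (by positivity : (0 : ℝ) ≤ 16 * K ^ 2 * C) hX (div_nonneg hY₁ hh.le) (div_nonneg hY₀ (pow_nonneg hh.le 3)) hcX
    (b₁.trans_eq e₁) (b₀.trans_eq e₀)).trans (le_of_eq ?_)
  ring

end

/-! ### Two-sided comparison of the local norms -/

section

variable {𝓕 : Type*} [Fintype 𝓕] {Ψ : Poly →ₗ[ℝ] ℝ} {Φ : 𝓕 → Poly →ₗ[ℝ] ℝ}
  {n : 𝓕 → Fin 2 → ℝ} {h K : ℝ} {l : ℕ} {A : Tensor4}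

theorem LocalBounds.hessForm_le (hL : LocalBounds Ψ Φ n h K l) (hK : 0 < K) {q : Poly}
    (hq : q ∈ polyDeg l) : hessForm Ψ q q ≤ 4 * K ^ 2 * (Ψ (q * q) / h ^ 4) := by
  have hh := hL.pos
  have h1 : ∀ i j, Ψ (dd i (dd j q) * dd i (dd j q)) ≤ K / h ^ 2 * (K / h ^ 2 * Ψ (q * q)) :=
    fun i j => (hL.inverse _ (polyDeg_mono (by omega) (dd_mem_polyDeg hq j)) i).trans
      (mul_le_mul_of_nonneg_left (hL.inverse q hq j) (by positivity))
  rw [hessForm_apply]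
  refine (Finset.sum_le_sum fun i _ => Finset.sum_le_sum fun j _ => h1 i j).trans (le_of_eq ?_)
  simp only [Fin.sum_univ_two]
  field_simp
  ring

theorem LocalBounds.grad_trace_le (hL : LocalBounds Ψ Φ n h K l) (hK : 0 < K) {q : Poly}
    (hq : q ∈ polyDeg l) : (∑ F, ∑ i, Φ F (dd i q * dd i q)) / h ≤
      2 * K ^ 2 * (Ψ (q * q) / h ^ 4) := by
  have hh := hL.pos
  have h1 : ∀ i, ∑ F, Φ F (dd i q * dd i q) ≤ K / h * (K / h ^ 2 * Ψ (q * q)) := fun i =>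
    (hL.trace _ (polyDeg_mono (by omega) (dd_mem_polyDeg hq i))).trans
      (mul_le_mul_of_nonneg_left (hL.inverse q hq i) (by positivity))
  rw [Finset.sum_comm, div_le_iff₀ hh]
  refine (Finset.sum_le_sum fun i _ => h1 i).trans (le_of_eq ?_)
  simp only [Fin.sum_univ_two]
  field_simp
  ring

theorem LocalBounds.trace_le (hL : LocalBounds Ψ Φ n h K l) {q : Poly}
    (hq : q ∈ polyDeg l) : (∑ F, Φ F (q * q)) / h ^ 3 ≤ K * (Ψ (q * q) / h ^ 4) := by
  have hh := hL.pos
  rw [div_le_iff₀ (by positivity)]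
  refine (hL.trace q hq).trans (le_of_eq ?_)
  field_simp

/-- Two-sided comparison of the quantities that make up `aT` and `seminormSq`: `p` is the
reconstruction, `r`, `rg`, `rt` are the element, gradient and trace residuals. -/
theorem exists_local_equivalence {c C a : ℝ} (hc : 0 < c) (hC : 0 < C) (hK : 0 < K)
    (ha : 0 < a) (k : ℕ) (hk : 1 ≤ k) : ∃ M, 0 < M ∧
    ∀ {𝓕 : Type} [Fintype 𝓕] (Ψ : Poly →ₗ[ℝ] ℝ) (Φ : 𝓕 → Poly →ₗ[ℝ] ℝ) (n : 𝓕 → Fin 2 → ℝ)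
      (h : ℝ) (A : Tensor4), A.IsSymmElliptic → LocalBounds Ψ Φ n h K (k + 2) →
      EnergyBounds A Ψ c C → ∀ v ∈ polyDeg k, ∀ p ∈ polyDeg (k + 2),
      ∀ (g : 𝓕 → Fin 2 → Poly), (∀ F i, g F i ∈ polyDeg k) →
      ∀ (t : 𝓕 → Poly), (∀ F, t F ∈ polyDeg k) →
      (∀ w ∈ polyDeg (k + 2), Ψ (energyPoly A p w) = recForm A Ψ Φ n v g t w) →
      (∀ w ∈ polyDeg 1, Ψ ((p - v) * w) = 0) →
      ∀ r ∈ polyDeg k, (∀ w ∈ polyDeg k, Ψ ((r - (p - v)) * w) = 0) →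
      ∀ (rg : 𝓕 → Fin 2 → Poly), (∀ F i, rg F i ∈ polyDeg k) →
      (∀ F i, ∀ w ∈ polyDeg k, Φ F ((rg F i - (dd i p - g F i)) * w) = 0) →
      ∀ (rt : 𝓕 → Poly), (∀ F, rt F ∈ polyDeg k) →
      (∀ F, ∀ w ∈ polyDeg k, Φ F ((rt F - (p - t F)) * w) = 0) →
      Ψ (energyPoly A v v) + a * ((∑ F, ∑ i, Φ F ((g F i - dd i v) * (g F i - dd i v))) / h +
          (∑ F, Φ F ((t F - v) * (t F - v))) / h ^ 3) ≤
        M * (Ψ (energyPoly A p p) + a * (Ψ (r * r) / h ^ 4 +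
          (∑ F, ∑ i, Φ F (rg F i * rg F i)) / h + (∑ F, Φ F (rt F * rt F)) / h ^ 3)) ∧
      Ψ (energyPoly A p p) + a * (Ψ (r * r) / h ^ 4 +
          (∑ F, ∑ i, Φ F (rg F i * rg F i)) / h + (∑ F, Φ F (rt F * rt F)) / h ^ 3) ≤
        M * (Ψ (energyPoly A v v) +
          a * ((∑ F, ∑ i, Φ F ((g F i - dd i v) * (g F i - dd i v))) / h +
          (∑ F, Φ F ((t F - v) * (t F - v))) / h ^ 3)) := by
  set C₁ := (16 * K * C + 32 * K ^ 2 * C) / c ^ 2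
  have hC₁ : 0 < C₁ := by positivity
  -- `Q` collects the coefficients of the scaled square norm of `p - v` in the lower bound; `R`
  -- below collects those of the jumps in the upper bound.
  set Q := 8 * C * K ^ 2 + a * (4 * K ^ 2 + 2 * K)
  have hQ : 0 < Q := by positivity
  set M₁ := (2 * C + 2 * K * Q) / c + (2 * Q / a + 2)
  set R := 2 * C * C₁ + a * (K * C₁ + 4 * K ^ 2 * (K * C₁) + 2 * K * (K * C₁) + 2)
  have hR : 0 < R := by positivity
  set M₂ := 2 * C / c + R / a
  have hM₁ : 0 < M₁ := by positivity
  have hM₂ : 0 < M₂ := by positivity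
  refine ⟨M₁ + M₂, by positivity, ?_⟩
  intro 𝓕 _ Ψ Φ n h A hA hL hE v hv p hp g hg t ht hrec horth r hr hr' rg hrg hrg' rt hrt hrt'
  have hh := hL.pos
  have hv2 : v ∈ polyDeg (k + 2) := polyDeg_mono (by omega) hv
  have hδ : p - v ∈ polyDeg (k + 2) := sub_mem hp hv2
  have hX := hessForm_le_of_reconstruction hA hL hK hc hC hE hv2 hp g t hrec
  have hXD := hL.hessForm_le hK hδ
  have hd₁ := hL.grad_trace_le hK hδ
  have hd₀ := hL.trace_le hδ
  have nD : 0 ≤ Ψ ((p - v) * (p - v)) / h ^ 4 := div_nonneg (hL.nonneg _) (by positivity)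
  have nE : 0 ≤ Ψ (r * r) / h ^ 4 := div_nonneg (hL.nonneg _) (by positivity)
  -- Orthogonality of `p - v` to affine functions makes its norm minimal among its affine
  -- translates, so Poincaré applies to it directly.
  have hDX : Ψ ((p - v) * (p - v)) / h ^ 4 ≤ K * hessForm Ψ (p - v) (p - v) := by
    obtain ⟨q, hq, hb⟩ := hL.poincare _ hδ
    rw [div_le_iff₀ (by positivity)]
    refine (form_sq_le_of_eq hL.nonneg (u := p - v - q) ?_).trans (hb.trans_eq (by ring))
    rw [show (p - v) * (p - v - q - (p - v)) = -((p - v) * q) by ring, map_neg, horth q hq,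
      neg_zero]
  have hED : Ψ (r * r) / h ^ 4 ≤ Ψ ((p - v) * (p - v)) / h ^ 4 := by
    refine div_le_div_of_nonneg_right (form_sq_le_of_eq hL.nonneg ?_) (by positivity)
    rw [show r * (p - v - r) = -((r - (p - v)) * r) by ring, map_neg, hr' r hr, neg_zero]
  -- Since `v` has degree at most `k`, `p - v - r` is `p` minus its projection. It is orthogonal to
  -- affine polynomials because `k ≥ 1`, hence no larger than `p - q`.
  have hDE : Ψ ((p - v) * (p - v)) / h ^ 4 ≤
      2 * (Ψ (r * r) / h ^ 4) + 2 * K * hessForm Ψ p p := by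
    obtain ⟨q, hq, hb⟩ := hL.poincare _ hp
    have h1 := form_add_sq_le hL.nonneg r (p - v - r)
    rw [add_sub_cancel] at h1
    have h2 : Ψ ((p - v - r) * (p - v - r)) ≤ Ψ ((p - q) * (p - q)) := by
      refine form_sq_le_of_eq hL.nonneg ?_
      rw [show (p - v - r) * (p - q - (p - v - r)) = -((r - (p - v)) * (v + r - q)) by ring,
        map_neg, hr' _ (sub_mem (add_mem hv hr) (polyDeg_mono hk hq)), neg_zero]
    rw [div_le_iff₀ (by positivity)]
    have h3 : (2 * (Ψ (r * r) / h ^ 4) + 2 * K * hessForm Ψ p p) * h ^ 4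
        = 2 * Ψ (r * r) + 2 * (K * h ^ 4 * hessForm Ψ p p) := by field_simp
    linarith
  have hdd : ∀ i, dd i v ∈ polyDeg k := fun i => polyDeg_mono (by omega) (dd_mem_polyDeg hv i)
  -- The terms in `∇v` cancel: `rg` is the projection of `∇(p - v)` minus the gradient jump.
  have he₁ : (∑ F, ∑ i, Φ F (rg F i * rg F i)) / h ≤
      2 * ((∑ F, ∑ i, Φ F (dd i (p - v) * dd i (p - v))) / h) +
      2 * ((∑ F, ∑ i, Φ F ((g F i - dd i v) * (g F i - dd i v))) / h) := by
    rw [← mul_div_assoc, ← mul_div_assoc, ← add_div]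
    refine div_le_div_of_nonneg_right ?_ hh.le
    simp only [Finset.mul_sum, ← Finset.sum_add_distrib]
    refine Finset.sum_le_sum fun F _ => Finset.sum_le_sum fun i _ => ?_
    refine (form_sq_le_of_eq (hL.nonneg_face F) (u := dd i (p - v) - (g F i - dd i v)) ?_).trans
      (form_sub_sq_le (hL.nonneg_face F) _ _)
    rw [show rg F i * (dd i (p - v) - (g F i - dd i v) - rg F i)
      = -((rg F i - (dd i p - g F i)) * rg F i) by simp only [dd, map_sub]; ring, map_neg,
      hrg' F i _ (hrg F i), neg_zero]
  have he₀ : (∑ F, Φ F (rt F * rt F)) / h ^ 3 ≤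
      2 * ((∑ F, Φ F ((p - v) * (p - v))) / h ^ 3) +
      2 * ((∑ F, Φ F ((t F - v) * (t F - v))) / h ^ 3) := by
    rw [← mul_div_assoc, ← mul_div_assoc, ← add_div]
    refine div_le_div_of_nonneg_right ?_ (by positivity)
    simp only [Finset.mul_sum, ← Finset.sum_add_distrib]
    refine Finset.sum_le_sum fun F _ => ?_
    refine (form_sq_le_of_eq (hL.nonneg_face F) (u := p - v - (t F - v)) ?_).trans
      (form_sub_sq_le (hL.nonneg_face F) _ _)
    rw [show rt F * (p - v - (t F - v) - rt F) = -((rt F - (p - t F)) * rt F) by ring, map_neg,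
      hrt' F _ (hrt F), neg_zero]
  -- The same identity read backwards: the jump has degree at most `k`, so it is the projection of
  -- `∇(p - v) - rg`.
  have hy₁ : (∑ F, ∑ i, Φ F ((g F i - dd i v) * (g F i - dd i v))) / h ≤
      2 * ((∑ F, ∑ i, Φ F (dd i (p - v) * dd i (p - v))) / h) +
      2 * ((∑ F, ∑ i, Φ F (rg F i * rg F i)) / h) := by
    rw [← mul_div_assoc, ← mul_div_assoc, ← add_div]
    refine div_le_div_of_nonneg_right ?_ hh.le
    simp only [Finset.mul_sum, ← Finset.sum_add_distrib]
    refine Finset.sum_le_sum fun F _ => Finset.sum_le_sum fun i _ => ?_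
    refine (form_sq_le_of_eq (hL.nonneg_face F) (u := dd i (p - v) - rg F i) ?_).trans
      (form_sub_sq_le (hL.nonneg_face F) _ _)
    rw [show (g F i - dd i v) * (dd i (p - v) - rg F i - (g F i - dd i v))
      = -((rg F i - (dd i p - g F i)) * (g F i - dd i v)) by simp only [dd, map_sub]; ring, map_neg,
      hrg' F i _ (sub_mem (hg F i) (hdd i)), neg_zero]
  have hy₀ : (∑ F, Φ F ((t F - v) * (t F - v))) / h ^ 3 ≤
      2 * ((∑ F, Φ F ((p - v) * (p - v))) / h ^ 3) +
      2 * ((∑ F, Φ F (rt F * rt F)) / h ^ 3) := by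
    rw [← mul_div_assoc, ← mul_div_assoc, ← add_div]
    refine div_le_div_of_nonneg_right ?_ (by positivity)
    simp only [Finset.mul_sum, ← Finset.sum_add_distrib]
    refine Finset.sum_le_sum fun F _ => ?_
    refine (form_sq_le_of_eq (hL.nonneg_face F) (u := p - v - rt F) ?_).trans
      (form_sub_sq_le (hL.nonneg_face F) _ _)
    rw [show (t F - v) * (p - v - rt F - (t F - v)) = -((rt F - (p - t F)) * (t F - v)) by ring,
      map_neg, hrt' F _ (sub_mem (ht F) hv), neg_zero]
  have hHp : hessForm Ψ p p ≤ 2 * hessForm Ψ (p - v) (p - v) + 2 * hessForm Ψ v v := by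
    simpa using hessForm_add_le hL.nonneg (p - v) v
  have hHv : hessForm Ψ v v ≤ 2 * hessForm Ψ (p - v) (p - v) + 2 * hessForm Ψ p p := by
    have := hessForm_add_le hL.nonneg (-(p - v)) p
    rwa [hessForm_neg, neg_sub, sub_add_cancel] at this
  have nX := hessForm_nonneg hL.nonneg (p - v)
  have nHp := hessForm_nonneg hL.nonneg p
  have nHv := hessForm_nonneg hL.nonneg v
  have ny₁ : 0 ≤ (∑ F, ∑ i, Φ F ((g F i - dd i v) * (g F i - dd i v))) / h :=
    div_nonneg (Finset.sum_nonneg fun F _ => Finset.sum_nonneg fun i _ =>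
      hL.nonneg_face F _) hh.le
  have ny₀ : 0 ≤ (∑ F, Φ F ((t F - v) * (t F - v))) / h ^ 3 :=
    div_nonneg (Finset.sum_nonneg fun F _ => hL.nonneg_face F _) (by positivity)
  have ne₁ : 0 ≤ (∑ F, ∑ i, Φ F (rg F i * rg F i)) / h :=
    div_nonneg (Finset.sum_nonneg fun F _ => Finset.sum_nonneg fun i _ =>
      hL.nonneg_face F _) hh.le
  have ne₀ : 0 ≤ (∑ F, Φ F (rt F * rt F)) / h ^ 3 :=
    div_nonneg (Finset.sum_nonneg fun F _ => hL.nonneg_face F _) (by positivity)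
  have lv := hE.lower v
  have uv := hE.upper v
  have lp := hE.lower p
  have up := hE.upper p
  -- From here on only real arithmetic with nonnegative quantities remains.
  generalize Ψ (energyPoly A v v) = av at *
  generalize Ψ (energyPoly A p p) = ap at *
  generalize hessForm Ψ (p - v) (p - v) = X at *
  generalize hessForm Ψ v v = Hv at *
  generalize hessForm Ψ p p = Hp at *
  generalize Ψ (r * r) / h ^ 4 = E₀ at *
  generalize Ψ ((p - v) * (p - v)) / h ^ 4 = D at *
  generalize (∑ F, ∑ i, Φ F ((g F i - dd i v) * (g F i - dd i v))) / h = y₁ at *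
  generalize (∑ F, Φ F ((t F - v) * (t F - v))) / h ^ 3 = y₀ at *
  generalize (∑ F, ∑ i, Φ F (rg F i * rg F i)) / h = e₁ at *
  generalize (∑ F, Φ F (rt F * rt F)) / h ^ 3 = e₀ at *
  generalize (∑ F, ∑ i, Φ F (dd i (p - v) * dd i (p - v))) / h = d₁ at *
  generalize (∑ F, Φ F ((p - v) * (p - v))) / h ^ 3 = d₀ at *
  have nav : 0 ≤ av := le_trans (by positivity) lv
  have nap : 0 ≤ ap := le_trans (by positivity) lp
  have lv' : Hv ≤ av / c := by rwa [le_div_iff₀ hc, mul_comm]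
  have lp' : Hp ≤ ap / c := by rwa [le_div_iff₀ hc, mul_comm]
  constructor
  -- Lower bound: the Hessian of `v` and the jumps are reduced to `D`, the residuals and `Hp`, and
  -- then `D` to `E₀` and `Hp`.
  · have b1 : av ≤ C * (2 * (4 * K ^ 2 * D) + 2 * Hp) :=
      uv.trans (mul_le_mul_of_nonneg_left (by linarith) hC.le)
    have b2 : a * (y₁ + y₀) ≤ a * ((4 * K ^ 2 + 2 * K) * D + 2 * (e₁ + e₀)) :=
      mul_le_mul_of_nonneg_left (by linarith) ha.le
    have b3 : Q * D ≤ Q * (2 * E₀ + 2 * K * Hp) := mul_le_mul_of_nonneg_left hDE hQ.le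
    have b4 : (2 * C + 2 * K * Q) * Hp ≤ (2 * C + 2 * K * Q) * (ap / c) :=
      mul_le_mul_of_nonneg_left lp' (by positivity)
    have b5 : (2 * C + 2 * K * Q) * (ap / c) = (2 * C + 2 * K * Q) / c * ap := by ring
    have b6 : 2 * Q * E₀ = 2 * Q / a * (a * E₀) := by field_simp
    have b7 : av + a * (y₁ + y₀) ≤ (2 * C + 2 * K * Q) / c * ap
        + 2 * Q / a * (a * E₀) + 2 * (a * (e₁ + e₀)) := by
      rw [← b5, ← b6]
      have hQD : Q * D = 8 * C * K ^ 2 * D + a * (4 * K ^ 2 + 2 * K) * D := by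
        simp only [Q]; ring
      linarith
    have m1 : (2 * C + 2 * K * Q) / c ≤ M₁ + M₂ := by
      have : 0 < 2 * Q / a + 2 := by positivity
      simp only [M₁]; linarith
    have m2 : 2 * Q / a + 2 ≤ M₁ + M₂ := by
      have : 0 < (2 * C + 2 * K * Q) / c := by positivity
      simp only [M₁]; linarith
    have m3 : 0 < 2 * Q / a := by positivity
    have c1 := mul_le_mul_of_nonneg_right m1 nap
    have c2 := mul_le_mul_of_nonneg_right m2 (by positivity : 0 ≤ a * (E₀ + e₁ + e₀))
    have c3 : 0 ≤ a * E₀ := by positivity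
    have c4 : 0 ≤ 2 * Q / a * (a * (e₁ + e₀)) := by positivity
    linarith
  -- Upper bound: the jumps bound `X`, which bounds `D`, hence the traces `d₁`, `d₀` and the
  -- residuals.
  · have bX : X ≤ C₁ * (y₁ + y₀) := hX
    have bD : D ≤ K * C₁ * (y₁ + y₀) := by
      have := mul_le_mul_of_nonneg_left bX hK.le
      linarith
    have b1 : ap ≤ C * (2 * (C₁ * (y₁ + y₀)) + 2 * Hv) :=
      up.trans (mul_le_mul_of_nonneg_left (by linarith) hC.le)
    have bd₁ : d₁ ≤ 2 * K ^ 2 * (K * C₁ * (y₁ + y₀)) :=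
      hd₁.trans (mul_le_mul_of_nonneg_left bD (by positivity))
    have bd₀ : d₀ ≤ K * (K * C₁ * (y₁ + y₀)) :=
      hd₀.trans (mul_le_mul_of_nonneg_left bD (by positivity))
    have b2 : a * (E₀ + e₁ + e₀) ≤
        a * ((K * C₁ + 4 * K ^ 2 * (K * C₁) + 2 * K * (K * C₁) + 2) * (y₁ + y₀)) :=
      mul_le_mul_of_nonneg_left (by linarith) ha.le
    have b3 : 2 * C * Hv ≤ 2 * C / c * av :=
      (mul_le_mul_of_nonneg_left lv' (by positivity : 0 ≤ 2 * C)).trans_eq (by ring)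
    have b4 : R * (y₁ + y₀) = R / a * (a * (y₁ + y₀)) := by field_simp
    have b5 : ap + a * (E₀ + e₁ + e₀) ≤ 2 * C / c * av + R / a * (a * (y₁ + y₀)) := by
      rw [← b4]
      simp only [R]
      linarith
    have m1 : 2 * C / c ≤ M₁ + M₂ := by
      have : 0 < R / a := by positivity
      simp only [M₂]; linarith
    have m2 : R / a ≤ M₁ + M₂ := by
      have : 0 < 2 * C / c := by positivity
      simp only [M₂]; linarith
    have c1 := mul_le_mul_of_nonneg_right m1 nav
    have c2 := mul_le_mul_of_nonneg_right m2 (by positivity : 0 ≤ a * (y₁ + y₀))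
    linarith

end

/-! ### Geometry of regular meshes -/

/-- Arc length. -/
abbrev arcLength : Measure Plane := Measure.hausdorffMeasure 1

theorem IsPolygon.isBounded {T : Set Plane} (hT : IsPolygon T) : Bornology.IsBounded T := by
  obtain ⟨S, _, hS⟩ := hT.triangles
  refine Bornology.IsBounded.subset ?_ (subset_closure (s := T))
  rw [hS]
  exact (Bornology.isBounded_biUnion S.finite_toSet).2 fun s _ =>
    (isBounded_convexHull).2 s.finite_toSet.isBounded

theorem IsPolygon.diam_pos {T : Set Plane} (hT : IsPolygon T) : 0 < Metric.diam T := by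
  obtain ⟨x, hx⟩ := hT.isConnected.nonempty
  obtain ⟨ε, hε, hb⟩ := Metric.isOpen_iff.1 hT.isOpen x hx
  have hy : x + (ε / 2) • EuclideanSpace.single 0 (1 : ℝ) ∈ T := hb (by
    simp [dist_eq_norm, norm_smul, abs_of_pos hε]; linarith)
  have := Metric.dist_le_diam_of_mem hT.isBounded hx hy
  refine lt_of_lt_of_le ?_ this
  simp [dist_eq_norm, norm_smul, abs_of_pos hε, hε]

theorem IsOpenSegment.measurableSet {F : Set Plane} (hF : IsOpenSegment F) : MeasurableSet F := by
  obtain ⟨a, b, hab, rfl⟩ := hF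
  have h1 : openSegment ℝ a b = segment ℝ a b \ {a, b} := by
    rw [← insert_endpoints_openSegment]
    ext x
    simp only [Set.mem_sdiff, Set.mem_insert_iff, Set.mem_singleton_iff]
    constructor
    · intro hx
      refine ⟨Or.inr (Or.inr hx), ?_⟩
      rintro (rfl | rfl)
      · exact hab (left_mem_openSegment_iff.1 hx)
      · exact hab (right_mem_openSegment_iff.1 hx)
    · tauto
  rw [h1]
  have h2 : IsCompact (segment ℝ a b) := by
    rw [segment_eq_image_lineMap]
    exact isCompact_Icc.image AffineMap.lineMap_continuous
  exact h2.isClosed.measurableSet.diff (Set.toFinite _).measurableSet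

theorem IsOpenSegment.arcLength_ne_top {F : Set Plane} (hF : IsOpenSegment F) :
    arcLength F ≠ ⊤ := by
  obtain ⟨a, b, hab, rfl⟩ := hF
  refine ((measure_mono (openSegment_subset_segment ℝ a b)).trans_lt ?_).ne
  rw [hausdorffMeasure_segment]
  exact edist_lt_top _ _

/-- The affine basis of the plane formed by the vertices of a triangle. -/
def triangleBasis (s : Finset Plane) (hs : AffineIndependent ℝ ((↑) : s → Plane))
    (hc : s.card = 3) : AffineBasis s ℝ Plane :=
  ⟨(↑), hs, by
    rw [hs.affineSpan_eq_top_iff_card_eq_finrank_add_one]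
    simp [hc]⟩

/-- The interior of a triangle is where all barycentric coordinates are positive; when one vanishes,
the point is a combination of the other two vertices. -/
theorem mem_edge_of_notMem_interior {s : Finset Plane}
    (hs : AffineIndependent ℝ ((↑) : s → Plane)) (hc : s.card = 3) {x : Plane}
    (hx : x ∈ convexHull ℝ (s : Set Plane)) (hx' : x ∉ interior (convexHull ℝ (s : Set Plane))) :
    ∃ a ∈ s, ∃ b ∈ s, x ∈ segment ℝ a b := by
  classical
  have hr : Set.range (triangleBasis s hs hc) = s := Subtype.range_coe
  rw [← hr, (triangleBasis s hs hc).interior_convexHull] at hx'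
  rw [← hr, (triangleBasis s hs hc).convexHull_eq_nonneg_coord] at hx
  simp only [Set.mem_ofPred_eq, not_forall, not_lt] at hx hx'
  obtain ⟨i, hi⟩ := hx'
  have hi0 := le_antisymm hi (hx i)
  have hsum := (triangleBasis s hs hc).sum_coord_apply_eq_one x
  have hcomb := (triangleBasis s hs hc).linear_combination_coord_eq_self x
  rw [← Finset.add_sum_erase _ _ (Finset.mem_univ i), hi0, zero_add] at hsum
  rw [← Finset.add_sum_erase _ _ (Finset.mem_univ i), hi0, zero_smul, zero_add] at hcomb
  have hmem : x ∈ convexHull ℝ ((s.erase i : Finset Plane) : Set Plane) := by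
    rw [← hcomb]
    refine (convex_convexHull ℝ _).sum_mem (fun j _ => hx j) hsum fun j hj =>
      subset_convexHull ℝ _ ?_
    rw [Finset.mem_coe, Finset.mem_erase]
    exact ⟨fun h => (Finset.mem_erase.1 hj).1 (Subtype.ext h), j.2⟩
  have hcard : (s.erase (i : Plane)).card = 2 := by
    rw [Finset.card_erase_of_mem i.2, hc]
  obtain ⟨a, b, _, hab⟩ := Finset.card_eq_two.1 hcard
  rw [hab, Finset.coe_pair, convexHull_pair] at hmem
  refine ⟨a, ?_, b, ?_, hmem⟩
  · exact Finset.mem_of_mem_erase (hab ▸ Finset.mem_insert_self a {b})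
  · exact Finset.mem_of_mem_erase (hab ▸ Finset.mem_insert_of_mem (Finset.mem_singleton_self b))

/-- Two simplices of a complex meet in the hull of their common vertices; if this has interior
points, all three vertices are common. -/
theorem triangle_eq_of_inter {K : Geometry.SimplicialComplex ℝ Plane} {s t : Finset Plane}
    (hs : s ∈ K.faces) (ht : t ∈ K.faces) (hsc : s.card = 3) (htc : t.card = 3)
    {U : Set Plane} (hU : IsOpen U) (hne : U.Nonempty)
    (h : U ⊆ convexHull ℝ (s : Set Plane) ∩ convexHull ℝ (t : Set Plane)) : s = t := by
  classical
  have h1 : (interior (convexHull ℝ ((s ∩ t : Finset Plane) : Set Plane))).Nonempty := by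
    refine hne.mono (interior_maximal (h.trans ?_) hU)
    rw [Finset.coe_inter]
    exact K.inter_subset_convexHull hs ht
  rw [interior_convexHull_nonempty_iff_affineSpan_eq_top] at h1
  have h2 : AffineIndependent ℝ ((↑) : (s ∩ t : Finset Plane) → Plane) :=
    (K.indep hs).mono (by simp : ((s ∩ t : Finset Plane) : Set Plane) ⊆ s)
  have h3 := h2.affineSpan_eq_top_iff_card_eq_finrank_add_one.1 (by
    rw [← h1]; congr 1; exact Subtype.range_coe)
  simp only [Fintype.card_coe, finrank_euclideanSpace, Fintype.card_fin] at h3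
  have h4 : s ∩ t = s := Finset.eq_of_subset_of_card_le Finset.inter_subset_left (by omega)
  have h5 : s ∩ t = t := Finset.eq_of_subset_of_card_le Finset.inter_subset_right (by omega)
  rw [← h4, h5]

/-- Half the radius is given up because the supremum need not be known to be attained. -/
theorem exists_ball_of_le_inradius {S : Set Plane} {d : ℝ} (hd : 0 < d) (h : d ≤ inradius S) :
    ∃ x, Metric.ball x (d / 2) ⊆ S := by
  have hne : {r : ℝ | ∃ x, Metric.closedBall x r ⊆ S}.Nonempty := by
    by_contra hne
    rw [Set.not_nonempty_iff_eq_empty] at hne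
    rw [inradius, hne, Real.sSup_empty] at h
    linarith
  obtain ⟨r, ⟨x, hx⟩, hr⟩ := exists_lt_of_lt_csSup hne (show d / 2 < inradius S by linarith)
  exact ⟨x, (Metric.ball_subset_closedBall.trans (Metric.closedBall_subset_closedBall hr.le)).trans
    hx⟩

section

variable {Ω : Set Plane} {M : Mesh Ω} {ρ : ℝ}

open Classical in
/-- A regular mesh element contains a ball of comparable size, and its perimeter is controlled by
its diameter. -/
theorem Mesh.IsRegular.exists_ball_and_perimeter (hM : M.IsRegular ρ) (hρ : 0 < ρ) {T : Set Plane}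
    (hT : T ∈ M.elements) :
    (∃ x₀, Metric.ball x₀ (Metric.diam T * (ρ ^ 2 / 2)) ⊆ T ∧
      T ⊆ Metric.closedBall x₀ (Metric.diam T)) ∧
    ∑ F ∈ M.facesOf T, arcLength.real F ≤ 36 / ρ ^ 4 * Metric.diam T := by
  obtain ⟨K, hK, hin, hdm⟩ := hM
  have hP := M.isPolygon T hT
  have hh := hP.diam_pos
  set h := Metric.diam T with hdef
  have hfin : {s | s ∈ K.faces ∧ s.card = 3 ∧ convexHull ℝ (s : Set Plane) ⊆ closure T}.Finite :=
    hK.finite.subset fun s hs => hs.1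
  set S : Finset (Finset Plane) := hfin.toFinset with hS
  have hSmem : ∀ s, s ∈ S ↔ s ∈ K.faces ∧ s.card = 3 ∧ convexHull ℝ (s : Set Plane) ⊆ closure T :=
    fun s => by rw [hS, Set.Finite.mem_toFinset]; rfl
  have hcover : closure T = ⋃ s ∈ S, convexHull ℝ (s : Set Plane) := by
    rw [hK.element_eq T hT]
    ext x
    simp only [Set.mem_iUnion, hSmem]
    rfl
  -- The two regularity conditions combine to `ρ ^ 2 * h ≤ r_S`.
  have hball : ∀ s ∈ S, ∃ x, Metric.ball x (h * (ρ ^ 2 / 2)) ⊆ convexHull ℝ (s : Set Plane) := by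
    intro s hs
    obtain ⟨h1, h2, h3⟩ := (hSmem s).1 hs
    obtain ⟨x, hx⟩ := exists_ball_of_le_inradius (d := ρ * (ρ * h)) (by positivity)
      ((mul_le_mul_of_nonneg_left (hdm T hT s h1 h2 h3) hρ.le).trans (hin s h1 h2))
    refine ⟨x, ?_⟩
    rwa [show h * (ρ ^ 2 / 2) = ρ * (ρ * h) / 2 by ring]
  have hr : 0 < h * (ρ ^ 2 / 2) := by positivity
  have hballT : ∀ s ∈ S, ∀ x, Metric.ball x (h * (ρ ^ 2 / 2)) ⊆ convexHull ℝ (s : Set Plane) →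
      Metric.ball x (h * (ρ ^ 2 / 2)) ⊆ T := fun s hs x hx => by
    rw [← hP.interior_closure]
    exact interior_maximal (hx.trans ((hSmem s).1 hs).2.2) Metric.isOpen_ball
  obtain ⟨y, hy⟩ := hP.isConnected.nonempty
  obtain ⟨s₀, hs₀, -⟩ := Set.mem_iUnion₂.1 (hcover.subset (subset_closure hy))
  obtain ⟨x₀, hx₀⟩ := hball s₀ hs₀
  have hx₀T := hballT s₀ hs₀ x₀ hx₀
  have hTb : T ⊆ Metric.closedBall x₀ h := fun z hz =>
    Metric.dist_le_diam_of_mem hP.isBounded hz (hx₀T (Metric.mem_ball_self hr))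
  refine ⟨⟨x₀, hx₀T, hTb⟩, ?_⟩
  -- Area count: the balls in distinct triangles are disjoint and lie in `T`, which is contained in
  -- a disc of radius `h`.
  have hcard : (S.card : ℝ) ≤ 4 / ρ ^ 4 := by
    choose! x hx using hball
    have hdisj : (S : Set (Finset Plane)).PairwiseDisjoint
        fun s => Metric.ball (x s) (h * (ρ ^ 2 / 2)) := by
      intro s hs t ht hst
      rw [Function.onFun, Set.disjoint_iff_inter_eq_empty]
      by_contra hne
      refine hst (triangle_eq_of_inter ((hSmem s).1 hs).1 ((hSmem t).1 ht).1 ((hSmem s).1 hs).2.1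
        ((hSmem t).1 ht).2.1 (Metric.isOpen_ball.inter Metric.isOpen_ball)
        (Set.nonempty_iff_ne_empty.2 hne) (Set.inter_subset_inter (hx s hs) (hx t ht)))
    have h1 : ∑ s ∈ S, (volume : Measure Plane).real (Metric.ball (x s) (h * (ρ ^ 2 / 2)))
        ≤ volume.real T := by
      rw [← measureReal_biUnion_finset hdisj (fun s _ => measurableSet_ball)
        (fun s _ => measure_ball_lt_top.ne)]
      exact measureReal_mono (Set.iUnion₂_subset fun s hs => hballT s hs _ (hx s hs))
        hP.isBounded.measure_lt_top.ne
    have h2 := h1.trans (measureReal_le_of_subset_closedBall hh hTb)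
    have h3 : ∀ z : Plane, (volume : Measure Plane).real (Metric.ball z (h * (ρ ^ 2 / 2)))
        = (h * (ρ ^ 2 / 2)) ^ 2 * volume.real (Metric.ball (0 : Plane) 1) := fun z => by
      rw [Measure.real, Measure.addHaar_ball_of_pos _ _ hr, ENNReal.toReal_mul,
        ENNReal.toReal_ofReal (by positivity)]
      simp [Measure.real]
    have h4 : 0 < (volume : Measure Plane).real (Metric.ball (0 : Plane) 1) :=
      ENNReal.toReal_pos (Metric.measure_ball_pos _ _ one_pos).ne' measure_ball_lt_top.ne
    simp only [h3, Finset.sum_const, nsmul_eq_mul, ← mul_assoc] at h2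
    have h5 := le_of_mul_le_mul_right h2 h4
    rw [le_div_iff₀ (by positivity)]
    refine le_of_mul_le_mul_right ?_ (by positivity : 0 < h ^ 2)
    nlinarith
  -- A boundary point of `T` is not interior to `closure T`, so it lies on an edge of any triangle
  -- containing it.
  have hfront : frontier T ⊆ ⋃ s ∈ S, ⋃ e ∈ s ×ˢ s, segment ℝ e.1 e.2 := by
    intro z hz
    obtain ⟨s, hs, hzs⟩ := Set.mem_iUnion₂.1 (hcover.subset hz.1)
    obtain ⟨h1, h2, h3⟩ := (hSmem s).1 hs
    have hzi : z ∉ interior (convexHull ℝ (s : Set Plane)) := fun hzi => hz.2 (by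
      rw [hP.isOpen.interior_eq, ← hP.interior_closure]
      exact interior_mono h3 hzi)
    obtain ⟨a, ha, b, hb, hab⟩ := mem_edge_of_notMem_interior (K.indep h1) h2 hzs hzi
    exact Set.mem_iUnion₂.2 ⟨s, hs, Set.mem_iUnion₂.2 ⟨(a, b), Finset.mk_mem_product ha hb, hab⟩⟩
  have hseg : ∀ s ∈ S, ∀ e ∈ s ×ˢ s, arcLength (segment ℝ e.1 e.2) ≤ ENNReal.ofReal h := by
    intro s hs e he
    rw [hausdorffMeasure_segment, edist_dist]
    refine ENNReal.ofReal_le_ofReal ?_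
    have h3 := ((hSmem s).1 hs).2.2
    have he' := Finset.mem_product.1 he
    rw [hdef, ← Metric.diam_closure]
    exact Metric.dist_le_diam_of_mem hP.isBounded.closure
      (h3 (subset_convexHull ℝ _ he'.1)) (h3 (subset_convexHull ℝ _ he'.2))
  have hlen : arcLength (⋃ F ∈ M.facesOf T, F) ≤ ENNReal.ofReal (36 / ρ ^ 4 * h) := by
    have h1 : (⋃ F ∈ M.facesOf T, F) ⊆ frontier T :=
      Set.iUnion₂_subset fun F hF => (Finset.mem_filter.1 hF).2
    refine (measure_mono (h1.trans hfront)).trans ((measure_biUnion_finset_le _ _).trans ?_)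
    -- The 9 ordered pairs of vertices overcount the edges; with at most `4 / ρ ^ 4` triangles this
    -- gives the constant 36.
    have h2 : ∀ s ∈ S, arcLength (⋃ e ∈ s ×ˢ s, segment ℝ e.1 e.2) ≤ 9 * ENNReal.ofReal h := by
      intro s hs
      refine ((measure_biUnion_finset_le _ _).trans (Finset.sum_le_sum (hseg s hs))).trans_eq ?_
      rw [Finset.sum_const, Finset.card_product, ((hSmem s).1 hs).2.1, nsmul_eq_mul]
      norm_num
    refine (Finset.sum_le_sum h2).trans ?_
    have h4 : ∑ _s ∈ S, 9 * ENNReal.ofReal h = ENNReal.ofReal (S.card * (9 * h)) := by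
      rw [Finset.sum_const, nsmul_eq_mul, ENNReal.ofReal_mul (Nat.cast_nonneg _),
        ENNReal.ofReal_natCast, ENNReal.ofReal_mul (Nat.ofNat_nonneg 9), ENNReal.ofReal_ofNat]
    rw [h4]
    refine ENNReal.ofReal_le_ofReal ?_
    have := mul_le_mul_of_nonneg_right hcard (by positivity : 0 ≤ 9 * h)
    refine this.trans_eq (by ring)
  have hmemF : ∀ F ∈ M.facesOf T, F ∈ M.faces := fun F hF => (Finset.mem_filter.1 hF).1
  rw [← measureReal_biUnion_finset
    (fun F hF F' hF' hne => M.faces_disjoint F (hmemF F hF) F' (hmemF F' hF') hne)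
    (fun F hF => (M.isOpenSegment F (hmemF F hF)).measurableSet)
    (fun F hF => (M.isOpenSegment F (hmemF F hF)).arcLength_ne_top)]
  exact ENNReal.toReal_le_of_le_ofReal (by positivity) hlen

end

/-! ### Generic boundary points -/

theorem IsOpenSegment.exists_closure_subset {F : Set Plane} (hF : IsOpenSegment F) :
    ∃ E : Set Plane, E.Finite ∧ closure F ⊆ F ∪ E := by
  obtain ⟨a, b, hab, rfl⟩ := hF
  refine ⟨{a, b}, Set.toFinite _, ?_⟩
  rw [closure_openSegment, ← insert_endpoints_openSegment]
  rintro x (rfl | rfl | hx)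
  · simp
  · simp
  · exact Or.inl hx

theorem exists_pos_add_smul_mem {U : Set Plane} (hU : IsOpen U) {y : Plane} (hy : y ∈ U)
    (n : Plane) : ∃ ε : ℝ, 0 < ε ∧ y + ε • n ∈ U := by
  have h1 : Filter.Tendsto (fun ε : ℝ => y + ε • n) (nhdsWithin 0 (Set.Ioi 0)) (nhds y) := by
    refine Filter.Tendsto.mono_left ?_ nhdsWithin_le_nhds
    have : Continuous fun ε : ℝ => y + ε • n := by fun_prop
    simpa using this.tendsto 0
  obtain ⟨ε, hε, hε0⟩ := ((h1.eventually (hU.mem_nhds hy)).and self_mem_nhdsWithin).exists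
  exact ⟨ε, hε0, hε⟩

/-- The half disc opposite to `T₁` is convex, hence connected. It meets `T` and avoids its boundary,
so it lies in `T`. -/
theorem halfDisc_subset {T₁ T : Set Plane} (hT : IsOpen T) (hd : Disjoint T T₁) {x n : Plane}
    {r : ℝ} (hr : 0 < r) (hn : ‖n‖ = 1)
    (h₁ : ∀ y ∈ Metric.ball x r, (y ∈ T₁ ↔ inner ℝ n (y - x) < 0)) (hx : x ∈ closure T)
    (hfr : ∀ y ∈ Metric.ball x r, y ∈ frontier T → inner ℝ n (y - x) = 0) :
    Metric.ball x r ∩ {y | 0 < inner ℝ n (y - x)} ⊆ T := by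
  have hnn : inner ℝ n n = 1 := by rw [real_inner_self_eq_norm_sq, hn]; norm_num
  have hconv : Convex ℝ (Metric.ball x r ∩ {y | 0 < inner ℝ n (y - x)}) := by
    refine (convex_ball x r).inter ?_
    have : {y | 0 < inner ℝ n (y - x)} = {y : Plane | inner ℝ n x < innerₛₗ ℝ n y} := by
      ext y
      simp [inner_sub_right]
    rw [this]
    exact convex_halfSpace_gt (LinearMap.isLinear _) _
  -- A point of `T` near `x` lies on the side `≥ 0`, being outside `T₁`; a small push along `n`
  -- makes the inequality strict.
  have hne : ((Metric.ball x r ∩ {y | 0 < inner ℝ n (y - x)}) ∩ T).Nonempty := by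
    obtain ⟨y, hyb, hyT⟩ := mem_closure_iff.1 hx _ Metric.isOpen_ball (Metric.mem_ball_self hr)
    obtain ⟨ε, hε, hy⟩ := exists_pos_add_smul_mem (Metric.isOpen_ball.inter hT) ⟨hyb, hyT⟩ n
    refine ⟨_, ⟨hy.1, ?_⟩, hy.2⟩
    have h2 : ¬inner ℝ n (y - x) < 0 := fun h => Set.disjoint_left.1 hd hyT ((h₁ y hyb).2 h)
    have h3 : inner ℝ n (y + ε • n - x) = inner ℝ n (y - x) + ε := by
      rw [add_sub_right_comm, inner_add_right, inner_smul_right, hnn, mul_one]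
    rw [Set.mem_ofPred_eq, h3]
    linarith
  by_contra hsub
  obtain ⟨y, hy, hyT⟩ := Set.not_subset.1 hsub
  have hnf : ∀ z ∈ Metric.ball x r ∩ {y | 0 < inner ℝ n (y - x)}, z ∈ closure T → z ∈ T := by
    intro z hz hzc
    by_contra hzT
    exact hz.2.ne' (hfr z hz.1 ⟨hzc, hT.interior_eq.symm ▸ hzT⟩)
  obtain ⟨z, -, hzT, hzc⟩ := hconv.isPreconnected T (closure T)ᶜ hT isClosed_closure.isOpen_compl
    (fun z hz => or_iff_not_imp_right.2 fun hzc => hnf z hz (not_not.1 hzc)) hne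
    ⟨y, hy, fun hyc => hyT (hnf y hy hyc)⟩
  exact hzc (subset_closure hzT)

section

variable {Ω : Set Plane} {M : Mesh Ω}

theorem Mesh.mem_facesOf {T F : Set Plane} : F ∈ M.facesOf T ↔ F ∈ M.faces ∧ F ⊆ frontier T := by
  classical exact Finset.mem_filter

theorem Mesh.isOutwardNormal {T F : Set Plane} (hT : T ∈ M.elements) (hF : F ∈ M.facesOf T) :
    IsOutwardNormal T F (outwardNormal T F) :=
  Classical.epsilon_spec (M.exists_normal T hT F (mem_facesOf.1 hF).1 (mem_facesOf.1 hF).2)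

/-- Finitely many points excepted, boundary points of an element lie on one of its faces, and
the element is a half disc near them. -/
theorem Mesh.exists_exceptional (hΩ : IsPolygon Ω) {T : Set Plane} (hT : T ∈ M.elements) :
    ∃ Z : Set Plane, Z.Finite ∧ (∀ x ∈ frontier T, x ∉ Z → ∃ F ∈ M.facesOf T, x ∈ F) ∧
      ∀ F ∈ M.facesOf T, ∀ x ∈ F, x ∉ Z → ∃ r > 0, ∀ y ∈ Metric.ball x r,
        (y ∈ T ↔ inner ℝ (outwardNormal T F) (y - x) < 0) := by
  have hE : ∀ F ∈ M.faces, ∃ E : Set Plane, E.Finite ∧ closure F ⊆ F ∪ E := fun F hF =>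
    (M.isOpenSegment F hF).exists_closure_subset
  choose! E hEf hE using hE
  have hV : ∀ T' ∈ M.elements, ∀ F ∈ M.facesOf T', ∃ V : Set Plane, V.Finite ∧
      ∀ x ∈ F \ V, ∃ r > 0, ∀ y ∈ Metric.ball x r,
        (y ∈ T' ↔ inner ℝ (outwardNormal T' F) (y - x) < 0) := fun T' hT' F hF =>
    (M.isOutwardNormal hT' hF).outward
  choose! V hVf hV using hV
  -- Exceptional are the endpoints of all faces and the points excluded in the definition of the
  -- normals, for all elements.
  refine ⟨(⋃ F ∈ M.faces, E F) ∪ ⋃ T' ∈ M.elements, ⋃ F ∈ M.facesOf T', V T' F, ?_, ?_, ?_⟩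
  · refine (M.faces.finite_toSet.biUnion fun F hF => hEf F hF).union
      (M.elements.finite_toSet.biUnion fun T' hT' =>
        (M.facesOf T').finite_toSet.biUnion fun F hF => hVf T' hT' F hF)
  · intro x hx hxZ
    simp only [Set.mem_union, Set.mem_iUnion, not_or, not_exists] at hxZ
    obtain ⟨hxE, hxV⟩ := hxZ
    have hcl : ∀ F ∈ M.faces, x ∈ closure F → x ∈ F := fun F hF h =>
      (hE F hF h).resolve_right (hxE F hF)
    obtain ⟨F, hF, hxF⟩ := Set.mem_iUnion₂.1 (M.skeleton.subset (Set.mem_iUnion₂.2 ⟨T, hT, hx⟩))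
    replace hxF := hcl F hF hxF
    refine ⟨F, mem_facesOf.2 ⟨hF, ?_⟩, hxF⟩
    by_contra hFT
    -- The radius keeps away from all other faces, so within the disc every element boundary lies on
    -- the line of `F`. Any other element touching `x` then fills the half disc opposite to `T₁`.
    have key : ∀ T₁ ∈ M.elements, F ⊆ frontier T₁ → ∃ r > 0, ∃ n : Plane, ‖n‖ = 1 ∧
        (∀ y ∈ Metric.ball x r, (y ∈ T₁ ↔ inner ℝ n (y - x) < 0)) ∧
        ∀ T' ∈ M.elements, T' ≠ T₁ → x ∈ closure T' →
          Metric.ball x r ∩ {y | 0 < inner ℝ n (y - x)} ⊆ T' := by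
      intro T₁ hT₁ hFT₁
      have hF₁ : F ∈ M.facesOf T₁ := mem_facesOf.2 ⟨hF, hFT₁⟩
      have hN := M.isOutwardNormal hT₁ hF₁
      obtain ⟨r₀, hr₀, h₀⟩ := hV T₁ hT₁ F hF₁ x ⟨hxF, hxV T₁ hT₁ F hF₁⟩
      have hC : IsClosed (⋃ F' ∈ {F' | F' ∈ M.faces ∧ F' ≠ F}, closure F') :=
        (M.faces.finite_toSet.subset fun F' h => h.1).isClosed_biUnion fun _ _ => isClosed_closure
      have hxC : x ∉ ⋃ F' ∈ {F' | F' ∈ M.faces ∧ F' ≠ F}, closure F' := by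
        intro h
        obtain ⟨F', ⟨hF', hne⟩, hx'⟩ := Set.mem_iUnion₂.1 h
        exact Set.disjoint_left.1 (M.faces_disjoint F' hF' F hF hne) (hcl F' hF' hx') hxF
      obtain ⟨r₁, hr₁, h₁⟩ := Metric.isOpen_iff.1 hC.isOpen_compl x hxC
      have hrm : 0 < min r₀ r₁ := lt_min hr₀ hr₁
      have hball : ∀ y ∈ Metric.ball x (min r₀ r₁), y ∈ T₁ ↔
          inner ℝ (outwardNormal T₁ F) (y - x) < 0 := fun y hy =>
        h₀ y (Metric.ball_subset_ball (min_le_left _ _) hy)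
      refine ⟨min r₀ r₁, hrm, outwardNormal T₁ F, hN.norm_eq_one, hball, fun T' hT' hne hxT' => ?_⟩
      refine halfDisc_subset (M.isPolygon T' hT').isOpen (M.elements_disjoint T' hT' T₁ hT₁ hne)
        hrm hN.norm_eq_one hball hxT' fun y hy hyf => ?_
      obtain ⟨F', hF', hyF'⟩ := Set.mem_iUnion₂.1
        (M.skeleton.subset (Set.mem_iUnion₂.2 ⟨T', hT', hyf⟩))
      have hFF : F' = F := by
        by_contra hne
        exact h₁ (Metric.ball_subset_ball (min_le_right _ _) hy)
          (Set.mem_iUnion₂.2 ⟨F', ⟨hF', hne⟩, hyF'⟩)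
      subst hFF
      have hcl' : IsClosed {y : Plane | inner ℝ (outwardNormal T₁ F') (y - x) = 0} :=
        isClosed_eq (by fun_prop) continuous_const
      exact closure_minimal (fun y hy => hN.orthogonal x hxF y hy) hcl' hyF'
    have hup : ∀ (r : ℝ) (n y : Plane), ‖n‖ = 1 → y ∈ Metric.ball x r →
        0 ≤ inner ℝ n (y - x) →
        y ∈ closure (Metric.ball x r ∩ {y | 0 < inner ℝ n (y - x)}) := by
      intro r n y hn hy hy0
      rw [mem_closure_iff]
      intro U hU hyU
      obtain ⟨ε, hε, hz⟩ := exists_pos_add_smul_mem (hU.inter Metric.isOpen_ball) ⟨hyU, hy⟩ n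
      refine ⟨_, hz.1, hz.2, ?_⟩
      rw [Set.mem_ofPred_eq, add_sub_right_comm, inner_add_right, inner_smul_right,
        real_inner_self_eq_norm_sq, hn]
      linarith
    -- If `F` did not lie on the boundary of `T`, then either `T` and `T₂` would fill the same half
    -- disc, or `T` and `T₁` would surround a point of the boundary of `Ω`.
    rcases M.interface_or_boundary F hF with ⟨T₁, hT₁, T₂, hT₂, hne, hFs⟩ | ⟨T₁, hT₁, hFs⟩
    · obtain ⟨r, hr, n, hn, -, h⟩ := key T₁ hT₁ (hFs.trans Set.inter_subset_left)
      have h1 := h T hT (fun h => hFT (h ▸ hFs.trans Set.inter_subset_left)) hx.1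
      have h2 := h T₂ hT₂ hne.symm (hFs hxF).2.1
      obtain ⟨y, -, hy⟩ := mem_closure_iff.1 (hup r n x hn (Metric.mem_ball_self hr) (by simp))
        Set.univ isOpen_univ trivial
      exact Set.disjoint_left.1 (M.elements_disjoint T hT T₂ hT₂
        (fun h => hFT (h ▸ hFs.trans Set.inter_subset_right))) (h1 hy) (h2 hy)
    · obtain ⟨r, hr, n, hn, hb, h⟩ := key T₁ hT₁ (hFs.trans Set.inter_subset_left)
      have h1 := h T hT (fun h => hFT (h ▸ hFs.trans Set.inter_subset_left)) hx.1
      have hsub : ∀ T' ∈ M.elements, closure T' ⊆ closure Ω := fun T' hT' =>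
        (Set.subset_iUnion₂ (s := fun T' (_ : T' ∈ M.elements) => closure T') T' hT').trans
          M.cover.superset
      have hballΩ : Metric.ball x r ⊆ closure Ω := by
        intro y hy
        rcases lt_or_ge (inner ℝ n (y - x)) 0 with h0 | h0
        · exact hsub T₁ hT₁ (subset_closure ((hb y hy).2 h0))
        · exact hsub T hT (closure_mono h1 (hup r n y hn hy h0))
      refine (hFs hxF).2.2 ?_
      rw [hΩ.isOpen.interior_eq, ← hΩ.interior_closure]
      exact interior_maximal hballΩ Metric.isOpen_ball (Metric.mem_ball_self hr)
  · intro F hF x hx hxZ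
    refine hV T hT F hF x ⟨hx, fun h => hxZ (Or.inr ?_)⟩
    exact Set.mem_iUnion₂.2 ⟨T, hT, Set.mem_iUnion₂.2 ⟨F, hF, h⟩⟩

end

/-! ### The fundamental theorem of calculus on a slice -/

theorem eventually_sign_const {n z t₀ : ℝ} (hn : n ≠ 0) (h : z ≠ t₀) :
    ∀ᶠ t in nhds t₀, (n * (t - z) < 0 ↔ n * (t₀ - z) < 0) := by
  have hc : Continuous fun t => n * (t - z) := by fun_prop
  rcases lt_or_gt_of_ne (mul_ne_zero hn (sub_ne_zero.2 h.symm)) with h0 | h0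
  · filter_upwards [hc.tendsto t₀ |>.eventually (eventually_lt_nhds h0)] with t ht
    exact iff_of_true ht h0
  · filter_upwards [hc.tendsto t₀ |>.eventually (eventually_gt_nhds h0)] with t ht
    exact iff_of_false (not_lt.2 (le_of_lt ht)) (not_lt.2 h0.le)

/-- The contribution of a boundary point `z` with normal component `n` to an indicator function. -/
def stepFn (n z t : ℝ) : ℝ := (if n * (t - z) < 0 then 1 else 0) - if n < 0 then 1 else 0

theorem stepFn_of_lt {n z t : ℝ} (hn : n ≠ 0) (h : t < z) : stepFn n z t = Real.sign n := by
  rcases lt_or_gt_of_ne hn with h0 | h0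
  · rw [stepFn, if_neg (not_lt.2 (mul_nonneg_of_nonpos_of_nonpos h0.le (by linarith))), if_pos h0,
      Real.sign_of_neg h0]
    norm_num
  · rw [stepFn, if_pos (mul_neg_of_pos_of_neg h0 (by linarith)), if_neg (not_lt.2 h0.le),
      Real.sign_of_pos h0]
    norm_num

theorem stepFn_of_gt {n z t : ℝ} (h : z < t) : stepFn n z t = 0 := by
  rcases lt_or_ge n 0 with h0 | h0
  · rw [stepFn, if_pos (mul_neg_of_neg_of_pos h0 (by linarith)), if_pos h0, sub_self]
  · rw [stepFn, if_neg (not_lt.2 (mul_nonneg h0 (by linarith))), if_neg (not_lt.2 h0), sub_self]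

/-- The difference of the two sides is locally constant: at `z i` the jumps of the indicator and of
the `i`-th step cancel, and elsewhere neither jumps. It vanishes at `R`, to the right of everything.
-/
theorem indicator_eq_sum_stepFn {ι : Type*} (S : Finset ι) (U : Set ℝ) {R : ℝ}
    (hU : U ⊆ Set.Ioo (-R) R) (z n : ι → ℝ) (hinj : Set.InjOn z S) (hn : ∀ i ∈ S, n i ≠ 0)
    (hloc : ∀ t, (∀ i ∈ S, z i ≠ t) → t ∉ frontier U)
    (hz : ∀ i ∈ S, ∃ ε > 0, ∀ t, |t - z i| < ε → (t ∈ U ↔ n i * (t - z i) < 0))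
    (hzR : ∀ i ∈ S, z i ∈ Set.Ioo (-R) R) (t : ℝ) :
    U.indicator 1 t = ∑ i ∈ S, stepFn (n i) (z i) t := by
  classical
  have hstep : ∀ i ∈ S, ∀ t₀, z i ≠ t₀ →
      ∀ᶠ t in nhds t₀, stepFn (n i) (z i) t = stepFn (n i) (z i) t₀ := by
    intro i hi t₀ h
    filter_upwards [eventually_sign_const (hn i hi) h] with t ht
    simp only [stepFn, ht]
  have hLC : IsLocallyConstant fun t => U.indicator (1 : ℝ → ℝ) t -
      ∑ i ∈ S, stepFn (n i) (z i) t := by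
    rw [IsLocallyConstant.iff_eventually_eq]
    intro t₀
    by_cases h : ∀ i ∈ S, z i ≠ t₀
    · have h1 : ∀ᶠ t in nhds t₀, (t ∈ U ↔ t₀ ∈ U) := by
        by_cases ht : t₀ ∈ U
        · have : t₀ ∈ interior U := by
            by_contra hni
            exact hloc t₀ h ⟨subset_closure ht, hni⟩
          filter_upwards [mem_interior_iff_mem_nhds.1 this] with t ht'
          exact iff_of_true ht' ht
        · have : t₀ ∉ closure U := fun hc =>
            hloc t₀ h ⟨hc, fun hi => ht (interior_subset hi)⟩
          filter_upwards [isClosed_closure.isOpen_compl.mem_nhds this] with t ht'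
          exact iff_of_false (fun h => ht' (subset_closure h)) ht
      filter_upwards [h1, (Filter.eventually_all_finset S).2 fun i hi => hstep i hi t₀ (h i hi)]
        with t ht ht'
      rw [Finset.sum_congr rfl ht']
      simp only [Set.indicator_apply, ht, Pi.one_apply]
    · push Not at h
      obtain ⟨i, hi, rfl⟩ := h
      obtain ⟨ε, hε, hi'⟩ := hz i hi
      have h1 : ∀ᶠ t in nhds (z i), |t - z i| < ε := Metric.ball_mem_nhds (z i) hε
      filter_upwards [h1, (Filter.eventually_all_finset (S.erase i)).2 fun j hj =>
        hstep j (Finset.mem_of_mem_erase hj) (z i) fun h =>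
          Finset.ne_of_mem_erase hj (hinj (Finset.mem_of_mem_erase hj) hi h)] with t ht ht'
      rw [← Finset.add_sum_erase _ _ hi, ← Finset.add_sum_erase _ _ hi,
        Finset.sum_congr rfl ht']
      have h2 : ∀ t, |t - z i| < ε → U.indicator (1 : ℝ → ℝ) t - stepFn (n i) (z i) t
          = if n i < 0 then 1 else 0 := by
        intro t ht
        simp only [stepFn, Set.indicator_apply, hi' t ht, Pi.one_apply, sub_sub_cancel]
      linarith [h2 t ht, h2 (z i) (by simpa using hε)]
  have h0 := hLC.apply_eq_of_preconnectedSpace t R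
  have hR : R ∉ U := fun h => (lt_irrefl R (hU h).2)
  simp only [Set.indicator_of_notMem hR] at h0
  rw [Finset.sum_congr rfl fun i hi => stepFn_of_gt (hzR i hi).2, Finset.sum_const_zero] at h0
  linarith

theorem integral_stepFn_mul {n z R : ℝ} (hn : n ≠ 0) (hz : z ∈ Set.Ioo (-R) R) {f f' : ℝ → ℝ}
    (hf : ∀ t, HasDerivAt f (f' t) t) (hf' : Continuous f') :
    IntegrableOn (fun t => stepFn n z t * f' t) (Set.Ioo (-R) R) ∧
    ∫ t in Set.Ioo (-R) R, stepFn n z t * f' t = Real.sign n * (f z - f (-R)) := by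
  have hae : (fun t => stepFn n z t * f' t) =ᵐ[volume.restrict (Set.Ioo (-R) R)]
      (Set.Iio z).indicator fun t => Real.sign n * f' t := by
    refine ae_restrict_of_ae ?_
    filter_upwards [Measure.ae_ne volume z] with t ht
    rcases lt_or_gt_of_ne ht with h | h
    · rw [Set.indicator_of_mem (Set.mem_Iio.2 h), stepFn_of_lt hn h]
    · rw [Set.indicator_of_notMem (s := Set.Iio z) (fun h' : t < z => lt_asymm h h'), stepFn_of_gt h, zero_mul]
  have hint : IntegrableOn (fun t => Real.sign n * f' t) (Set.Ioo (-R) R) :=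
    ((continuous_const.mul hf').integrableOn_Icc).mono_set Set.Ioo_subset_Icc_self
  refine ⟨(hint.indicator measurableSet_Iio).congr hae.symm, ?_⟩
  rw [integral_congr_ae hae, setIntegral_indicator measurableSet_Iio, integral_const_mul]
  have : Set.Ioo (-R) R ∩ Set.Iio z = Set.Ioo (-R) z := by
    ext t
    simp only [Set.mem_inter_iff, Set.mem_Ioo, Set.mem_Iio]
    exact ⟨fun h => ⟨h.1.1, h.2⟩, fun h => ⟨⟨h.1, h.2.trans hz.2⟩, h.2⟩⟩
  rw [this, ← integral_Ioc_eq_integral_Ioo, ← intervalIntegral.integral_of_le hz.1.le,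
    intervalIntegral.integral_eq_sub_of_hasDerivAt (fun t _ => hf t)
      (hf'.intervalIntegrable _ _)]

theorem setIntegral_deriv_eq_sum {ι : Type*} (S : Finset ι) {U : Set ℝ} (hUo : IsOpen U) {R : ℝ}
    (hU : U ⊆ Set.Ioo (-R) R) (z n : ι → ℝ) (hinj : Set.InjOn z S) (hn : ∀ i ∈ S, n i ≠ 0)
    (hloc : ∀ t, (∀ i ∈ S, z i ≠ t) → t ∉ frontier U)
    (hz : ∀ i ∈ S, ∃ ε > 0, ∀ t, |t - z i| < ε → (t ∈ U ↔ n i * (t - z i) < 0))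
    (hzR : ∀ i ∈ S, z i ∈ Set.Ioo (-R) R) {f f' : ℝ → ℝ}
    (hf : ∀ t, HasDerivAt f (f' t) t) (hf' : Continuous f') :
    ∫ t in U, f' t = ∑ i ∈ S, Real.sign (n i) * f (z i) := by
  have hind := indicator_eq_sum_stepFn S U hU z n hinj hn hloc hz hzR
  have h1 : ∫ t in U, f' t = ∫ t in Set.Ioo (-R) R, ∑ i ∈ S, stepFn (n i) (z i) t * f' t := by
    have h2 : ∀ t, U.indicator f' t = ∑ i ∈ S, stepFn (n i) (z i) t * f' t := fun t => by
      rw [← Finset.sum_mul, ← hind]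
      by_cases h : t ∈ U <;> simp [h]
    rw [← integral_congr_ae (.of_forall h2), setIntegral_indicator hUo.measurableSet,
      Set.inter_eq_right.2 hU]
  rw [h1, integral_finsetSum _ fun i hi => (integral_stepFn_mul (hn i hi) (hzR i hi) hf hf').1,
    Finset.sum_congr rfl fun i hi => (integral_stepFn_mul (hn i hi) (hzR i hi) hf hf').2]
  -- Evaluating the decomposition at `-R`, left of all crossings, shows that the signs sum to zero,
  -- which removes the terms `f (-R)`.
  have h3 : ∑ i ∈ S, Real.sign (n i) = 0 := by
    rw [← Finset.sum_congr rfl fun i hi => stepFn_of_lt (hn i hi) (hzR i hi).1, ← hind]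
    exact Set.indicator_of_notMem (fun h => lt_irrefl _ (hU h).1) _
  simp only [mul_sub, Finset.sum_sub_distrib, ← Finset.sum_mul, h3, zero_mul, sub_zero]

/-! ### The divergence formula on mesh elements -/

/-- The point with `i`-th coordinate `p.1` and other coordinate `p.2`. -/
def slicePt (i : Fin 2) (p : ℝ × ℝ) : Plane := WithLp.toLp 2 fun j => if j = i then p.1 else p.2

@[simp] theorem slicePt_same (i : Fin 2) (p : ℝ × ℝ) : slicePt i p i = p.1 := by simp [slicePt]

theorem slicePt_of_ne {i j : Fin 2} (h : j ≠ i) (p : ℝ × ℝ) : slicePt i p j = p.2 := by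
  simp [slicePt, h]

theorem continuous_slicePt (i : Fin 2) : Continuous (slicePt i) := by
  refine (PiLp.continuous_toLp 2 _).comp (continuous_pi fun j => ?_)
  split_ifs <;> fun_prop

theorem eq_of_coord_eq {i j : Fin 2} (hij : j ≠ i) {x y : Plane} (hi : x i = y i)
    (hj : x j = y j) : x = y := by
  ext l
  have : l = i ∨ l = j := by omega
  rcases this with rfl | rfl <;> assumption

theorem integral_slicePt (i : Fin 2) (f : Plane → ℝ) : ∫ p, f (slicePt i p) = ∫ x, f x := by
  have h0 : ∀ g : Plane → ℝ, ∫ p : ℝ × ℝ, g (slicePt 0 p) = ∫ x, g x := by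
    intro g
    have h1 := ((PiLp.volume_preserving_toLp (Fin 2)).integral_comp
      (MeasurableEquiv.toLp 2 (Fin 2 → ℝ)).measurableEmbedding g)
    have h2 := (volume_preserving_finTwoArrow ℝ).symm.integral_comp'
      (fun y : Fin 2 → ℝ => g (WithLp.toLp 2 y))
    rw [← h1, ← h2]
    refine integral_congr_ae (.of_forall fun p => ?_)
    dsimp only
    congr 1
    ext j
    fin_cases j <;> simp [slicePt, MeasurableEquiv.finTwoArrow]
  have : i = 0 ∨ i = 1 := by omega
  rcases this with rfl | rfl
  · exact h0 f
  · rw [← h0 f]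
    have h3 := (Measure.measurePreserving_swap (μ := (volume : Measure ℝ))
      (ν := (volume : Measure ℝ))).integral_comp
      (MeasurableEquiv.prodComm (α := ℝ) (β := ℝ)).measurableEmbedding
      (fun p => f (slicePt 0 p))
    refine Eq.trans ?_ h3
    refine integral_congr_ae (.of_forall fun p => ?_)
    dsimp only
    congr 1
    ext j
    fin_cases j <;> simp [slicePt]

theorem integrable_slicePt (i : Fin 2) {f : Plane → ℝ} (hf : Continuous f) {T : Set Plane}
    (hT : Bornology.IsBounded T) (hTm : MeasurableSet T) :
    Integrable (fun p : ℝ × ℝ => T.indicator f (slicePt i p)) := by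
  obtain ⟨R, hR⟩ := hT.exists_norm_le
  have hm : MeasurableSet (slicePt i ⁻¹' T) := (continuous_slicePt i).measurable hTm
  have h1 : (fun p : ℝ × ℝ => T.indicator f (slicePt i p))
      = (slicePt i ⁻¹' T).indicator fun p => f (slicePt i p) := rfl
  rw [h1, integrable_indicator_iff hm]
  have hsub : slicePt i ⁻¹' T ⊆ Metric.closedBall (0 : ℝ × ℝ) R := by
    intro p hp
    have h2 : ∀ j, |slicePt i p j| ≤ R := fun j =>
      (PiLp.norm_apply_le (slicePt i p) j).trans (hR _ hp)
    obtain ⟨j, hj⟩ : ∃ j, j ≠ i := exists_ne i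
    have h3 := h2 i
    have h4 := h2 j
    rw [slicePt_same] at h3
    rw [slicePt_of_ne hj] at h4
    simpa [Prod.norm_def] using ⟨h3, h4⟩
  exact ((hf.comp (continuous_slicePt i)).continuousOn.integrableOn_compact
    (isCompact_closedBall 0 R)).mono_set hsub

theorem setIntegral_eq_integral_slices (i : Fin 2) {f : Plane → ℝ} (hf : Continuous f)
    {T : Set Plane} (hT : Bornology.IsBounded T) (hTm : MeasurableSet T) :
    ∫ x in T, f x = ∫ s, ∫ t in {t | slicePt i (t, s) ∈ T}, f (slicePt i (t, s)) := by
  rw [← integral_indicator hTm, ← integral_slicePt i, Measure.volume_eq_prod,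
    integral_prod_symm _ (integrable_slicePt i hf hT hTm)]
  refine integral_congr_ae (.of_forall fun s => ?_)
  have hm : MeasurableSet {t | slicePt i (t, s) ∈ T} :=
    ((continuous_slicePt i).comp (Continuous.prodMk_left s)).measurable hTm
  dsimp only
  rw [← integral_indicator hm]
  rfl

/-- Integration over an open segment that is a graph over the `j`-th coordinate. -/
theorem setIntegral_openSegment {a b : Plane} {j : Fin 2} (hab : a j < b j) (f : Plane → ℝ) :
    ∫ x in openSegment ℝ a b, f x ∂arcLength = ‖b - a‖ / (b j - a j) *
      ∫ s in Set.Ioo (a j) (b j), f (a + ((s - a j) / (b j - a j)) • (b - a)) := by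
  have hβ : 0 < b j - a j := sub_pos.2 hab
  have hne : b - a ≠ 0 := fun h => by
    have := congrArg (fun x : Plane => x j) h
    simp at this
    linarith
  have hL : 0 < ‖b - a‖ := norm_pos_iff.2 hne
  set L := ‖b - a‖ with hLdef
  -- Parametrization by arc length: an isometry carries Lebesgue measure to the one-dimensional
  -- Hausdorff measure on its range.
  let γ : ℝ → Plane := fun τ => a + (τ / L) • (b - a)
  have hγ : Isometry γ := Isometry.of_dist_eq fun σ τ => by
    simp only [γ, dist_eq_norm]
    rw [add_sub_add_left_eq_sub, ← sub_smul, ← sub_div, norm_smul, norm_div, Real.norm_of_nonneg hL.le, div_mul_cancel₀ _ hL.ne']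
  have himage : openSegment ℝ a b = γ '' Set.Ioo 0 L := by
    rw [openSegment_eq_image]
    ext x
    constructor
    · rintro ⟨θ, hθ, rfl⟩
      refine ⟨θ * L, ⟨by have := hθ.1; positivity, by nlinarith [hθ.2]⟩, ?_⟩
      simp only [γ, mul_div_cancel_right₀ _ hL.ne']
      module
    · rintro ⟨τ, hτ, rfl⟩
      refine ⟨τ / L, ⟨div_pos hτ.1 hL, (div_lt_one hL).2 hτ.2⟩, ?_⟩
      simp only [γ]
      module
  have hmap : Measure.map γ volume = arcLength.restrict (Set.range γ) := by
    rw [← hausdorffMeasure_real]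
    exact hγ.map_hausdorffMeasure (Or.inl zero_le_one)
  have hemb : MeasurableEmbedding γ := hγ.isClosedEmbedding.measurableEmbedding
  have hms : MeasurableSet (openSegment ℝ a b) :=
    himage ▸ hemb.measurableSet_image.2 measurableSet_Ioo
  have hres : arcLength.restrict (openSegment ℝ a b)
      = (Measure.map γ volume).restrict (openSegment ℝ a b) := by
    rw [hmap, Measure.restrict_restrict hms, Set.inter_eq_left.2]
    rw [himage]
    exact Set.image_subset_range _ _
  rw [hres, hemb.setIntegral_map]
  rw [himage, Set.preimage_image_eq _ hγ.injective, ← integral_Ioc_eq_integral_Ioo,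
    ← integral_Ioc_eq_integral_Ioo, ← intervalIntegral.integral_of_le hL.le,
    ← intervalIntegral.integral_of_le hab.le]
  have hc : L / (b j - a j) ≠ 0 := by positivity
  have h1 := intervalIntegral.integral_comp_mul_add (a := a j) (b := b j)
    (fun τ => f (γ τ)) hc (-(L / (b j - a j) * a j))
  have e1 : L / (b j - a j) * a j + -(L / (b j - a j) * a j) = 0 := by ring
  have e2 : L / (b j - a j) * b j + -(L / (b j - a j) * a j) = L := by
    field_simp
    ring
  rw [e1, e2, smul_eq_mul] at h1
  have h2 : ∫ s in a j..b j, f (a + ((s - a j) / (b j - a j)) • (b - a))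
      = ∫ s in a j..b j, f (γ (L / (b j - a j) * s + -(L / (b j - a j) * a j))) := by
    refine intervalIntegral.integral_congr fun s _ => ?_
    simp only [γ]
    congr 3
    field_simp
    ring
  rw [h2, h1, mul_inv_cancel_left₀ hc]

/-- A segment as a (possibly empty) graph over the `j`-th coordinate, oriented by a unit normal. -/
theorem IsOpenSegment.exists_graph {F : Set Plane} (hF : IsOpenSegment F) {n : Plane}
    (hn : ‖n‖ = 1) (ho : ∀ x ∈ F, ∀ y ∈ F, inner ℝ n (y - x) = 0) {i j : Fin 2} (hij : j ≠ i) :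
    ∃ (α β : ℝ) (X : ℝ → Plane), Continuous X ∧
      (∀ s ∈ Set.Ioo α β, X s ∈ F ∧ X s j = s ∧ n i ≠ 0) ∧
      (∀ x ∈ F, x j ≠ α → x j ∈ Set.Ioo α β ∧ X (x j) = x) ∧
      ∀ f : Plane → ℝ, n i * ∫ x in F, f x ∂arcLength =
        ∫ s in Set.Ioo α β, Real.sign (n i) * f (X s) := by
  obtain ⟨a, b, hab, rfl, hle⟩ : ∃ a b : Plane, a ≠ b ∧ F = openSegment ℝ a b ∧ a j ≤ b j := by
    obtain ⟨a, b, hab, rfl⟩ := hF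
    rcases le_total (a j) (b j) with h | h
    · exact ⟨a, b, hab, rfl, h⟩
    · exact ⟨b, a, hab.symm, openSegment_symm ℝ a b, h⟩
  have hmem : ∀ θ : ℝ, 0 < θ → θ < 1 → a + θ • (b - a) ∈ openSegment ℝ a b := fun θ h0 h1 => by
    rw [openSegment_eq_image]
    exact ⟨θ, ⟨h0, h1⟩, by module⟩
  have horth : n i * (b i - a i) + n j * (b j - a j) = 0 := by
    have h1 := ho _ (hmem (1 / 3) (by norm_num) (by norm_num)) _
      (hmem (2 / 3) (by norm_num) (by norm_num))
    rw [show a + (2 / 3 : ℝ) • (b - a) - (a + (1 / 3 : ℝ) • (b - a)) = (1 / 3 : ℝ) • (b - a) by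
      module, inner_smul_right] at h1
    have h2 : inner ℝ n (b - a) = 0 := by linarith
    rw [PiLp.inner_apply] at h2
    have : (i = 0 ∧ j = 1) ∨ (i = 1 ∧ j = 0) := by omega
    rcases this with ⟨rfl, rfl⟩ | ⟨rfl, rfl⟩ <;> simp [Fin.sum_univ_two] at h2 <;> linarith
  have hnorm : ∀ x : Plane, ‖x‖ ^ 2 = x i ^ 2 + x j ^ 2 := fun x => by
    rw [EuclideanSpace.norm_sq_eq]
    have : (i = 0 ∧ j = 1) ∨ (i = 1 ∧ j = 0) := by omega
    rcases this with ⟨rfl, rfl⟩ | ⟨rfl, rfl⟩ <;> simp [Fin.sum_univ_two, add_comm]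
  have hn2 := hnorm n
  rw [hn] at hn2
  -- If `a j = b j`, the segment is parallel to the `i`-axis, the interval is empty and `n i = 0`.
  -- All its points have `j`-th coordinate `a j`, which is why that value is excluded.
  refine ⟨a j, b j, fun s => a + ((s - a j) / (b j - a j)) • (b - a), by fun_prop, ?_, ?_, ?_⟩
  · intro s hs
    have hβ : 0 < b j - a j := by linarith [hs.1, hs.2]
    refine ⟨hmem _ (div_pos (by linarith [hs.1]) hβ) ((div_lt_one hβ).2 (by linarith [hs.2])),
      ?_, ?_⟩
    · simp [div_mul_cancel₀ _ hβ.ne']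
    · intro h0
      rw [h0, zero_mul, zero_add] at horth
      rcases mul_eq_zero.1 horth with h1 | h1
      · rw [h0, h1] at hn2; norm_num at hn2
      · exact hβ.ne' h1
  · intro x hx hxa
    rw [openSegment_eq_image] at hx
    obtain ⟨θ, hθ, rfl⟩ := hx
    have e : ((1 - θ) • a + θ • b : Plane) j = a j + θ * (b j - a j) := by
      simp
      ring
    rw [e] at hxa ⊢
    have hβ : 0 < b j - a j := by
      refine (sub_nonneg.2 hle).lt_of_ne fun h => hxa ?_
      rw [← h]; ring
    refine ⟨⟨by nlinarith [hθ.1], by nlinarith [hθ.2]⟩, ?_⟩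
    beta_reduce
    rw [add_sub_cancel_left, mul_div_cancel_right₀ _ hβ.ne']
    module
  · intro f
    rcases hle.eq_or_lt with h | h
    · rw [h, Set.Ioo_self, Measure.restrict_empty, integral_zero_measure]
      have h0 : n i = 0 := by
        rw [h, sub_self, mul_zero, add_zero] at horth
        refine (mul_eq_zero.1 horth).resolve_right fun h1 => hab ?_
        exact eq_of_coord_eq hij (by linarith) h
      rw [h0, zero_mul]
    · have hβ : 0 < b j - a j := sub_pos.2 h
      rw [setIntegral_openSegment h f, integral_const_mul, ← mul_assoc]
      congr 1
      have hba := hnorm (b - a)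
      simp only [PiLp.sub_apply] at hba
      -- Orthogonality and `‖n‖ = 1` give `|n i| * ‖b - a‖ = b j - a j`: the normal component is the
      -- Jacobian of the projection.
      have h2 : (n i * ‖b - a‖) ^ 2 = (b j - a j) ^ 2 := by
        rw [mul_pow, hba]
        have h3 : (n i * (b i - a i)) ^ 2 = (n j * (b j - a j)) ^ 2 := by
          rw [eq_neg_of_add_eq_zero_left horth]; ring
        nlinarith
      have hL := norm_nonneg (b - a)
      rw [← mul_div_assoc, div_eq_iff hβ.ne']
      rcases lt_trichotomy (n i) 0 with h0 | h0 | h0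
      · rw [Real.sign_of_neg h0]
        have := abs_eq_abs.2 (sq_eq_sq_iff_eq_or_eq_neg.1 h2)
        rw [abs_of_nonpos (mul_nonpos_of_nonpos_of_nonneg h0.le hL), abs_of_pos hβ] at this
        linarith
      · rw [h0, zero_mul] at h2
        nlinarith
      · rw [Real.sign_of_pos h0]
        have := abs_eq_abs.2 (sq_eq_sq_iff_eq_or_eq_neg.1 h2)
        rw [abs_of_nonneg (mul_nonneg h0.le hL), abs_of_pos hβ] at this
        linarith

section

variable {Ω : Set Plane} {M : Mesh Ω}

/-- The divergence formula for polynomials. -/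
theorem Mesh.divergence_formula (hΩ : IsPolygon Ω) {T : Set Plane} (hT : T ∈ M.elements)
    (q : Poly) (i : Fin 2) :
    ∫ x in T, ev (dd i q) x =
      ∑ F ∈ M.facesOf T, outwardNormal T F i * ∫ x in F, ev q x ∂arcLength := by
  classical
  have hP := M.isPolygon T hT
  obtain ⟨j, hij⟩ : ∃ j, j ≠ i := exists_ne i
  obtain ⟨Z, hZf, hZ, hloc⟩ := M.exists_exceptional hΩ hT
  have hN := fun F (hF : F ∈ M.facesOf T) => M.isOutwardNormal hT hF
  have hg := fun F (hF : F ∈ M.facesOf T) => (M.isOpenSegment F (mem_facesOf.1 hF).1).exists_graph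
    (hN F hF).norm_eq_one (hN F hF).orthogonal hij
  choose! α β X hXc hX hXF hint using hg
  obtain ⟨R, hR⟩ := hP.isBounded.exists_norm_le
  have hcR : ∀ x ∈ closure T, ‖x‖ < R + 1 := fun x hx => by
    have : closure T ⊆ Metric.closedBall 0 R :=
      closure_minimal (fun y hy => by simpa using hR y hy) Metric.isClosed_closedBall
    have := this hx
    rw [mem_closedBall_zero_iff] at this
    linarith
  have hcoord : ∀ (x : Plane) (l : Fin 2), ‖x‖ < R + 1 → x l ∈ Set.Ioo (-(R + 1)) (R + 1) :=
    fun x l hx => abs_lt.1 ((PiLp.norm_apply_le x l).trans_lt hx)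
  -- Bad lines pass through an exceptional point or have the ordinate of a starting point `α F`,
  -- which covers all faces parallel to the slices. They are finitely many, hence negligible.
  let bad : Set ℝ := (fun x : Plane => x j) '' Z ∪ α '' (M.facesOf T)
  have hbad : bad.Finite := (hZf.image _).union ((M.facesOf T).finite_toSet.image _)
  rw [setIntegral_eq_integral_slices i (continuous_ev _) hP.isBounded hP.isOpen.measurableSet]
  have hslice : ∀ s ∉ bad,
      ∫ t in {t | slicePt i (t, s) ∈ T}, ev (dd i q) (slicePt i (t, s)) =
        ∑ F ∈ M.facesOf T, (Set.Ioo (α F) (β F)).indicator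
          (fun s => Real.sign (outwardNormal T F i) * ev q (X F s)) s := by
    intro s hs
    have hsZ : ∀ x ∈ Z, x j ≠ s := fun x hx h => hs (Or.inl ⟨x, hx, h⟩)
    have hsα : ∀ F ∈ M.facesOf T, α F ≠ s := fun F hF h => hs (Or.inr ⟨F, hF, h⟩)
    have hc : Continuous fun t => slicePt i (t, s) :=
      (continuous_slicePt i).comp (Continuous.prodMk_left s)
    set S := (M.facesOf T).filter fun F => s ∈ Set.Ioo (α F) (β F) with hS
    have hXs : ∀ F ∈ S, F ∈ M.facesOf T ∧ X F s ∈ F ∧ X F s j = s ∧ outwardNormal T F i ≠ 0 :=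
      fun F hF => ⟨(Finset.mem_filter.1 hF).1, hX F (Finset.mem_filter.1 hF).1 s
        (Finset.mem_filter.1 hF).2⟩
    have hpt : ∀ F ∈ S, slicePt i (X F s i, s) = X F s := fun F hF =>
      eq_of_coord_eq hij (by simp) (by rw [slicePt_of_ne hij, (hXs F hF).2.2.1])
    have hdiff : ∀ t t', slicePt i (t, s) - slicePt i (t', s)
        = (t - t') • EuclideanSpace.single i (1 : ℝ) := fun t t' =>
      eq_of_coord_eq hij (by simp) (by simp [slicePt_of_ne hij, hij])
    -- On a good line the crossings are the graph points of the faces above `s`, and along it the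
    -- half disc condition reads `n i * (t - z) < 0`.
    have := setIntegral_deriv_eq_sum S (U := {t | slicePt i (t, s) ∈ T}) (hP.isOpen.preimage hc)
      (R := R + 1) (fun t ht => by
        have := hcoord _ i (hcR _ (subset_closure ht))
        rwa [slicePt_same] at this)
      (fun F => X F s i) (fun F => outwardNormal T F i) ?_ (fun F hF => (hXs F hF).2.2.2) ?_ ?_
      (fun F hF => hcoord _ i (hcR _ ((mem_facesOf.1 (hXs F hF).1).2 (hXs F hF).2.1).1))
      (f := fun t => ev q (slicePt i (t, s))) (f' := fun t => ev (dd i q) (slicePt i (t, s)))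
      (fun t => ev_hasDerivAt q i _ t (by simpa using hasDerivAt_id' t)
        fun l hl => by simpa [slicePt_of_ne hl] using hasDerivAt_const t s)
      ((continuous_ev _).comp hc)
    · rw [this, hS, Finset.sum_filter]
      refine Finset.sum_congr rfl fun F hF => ?_
      rw [Set.indicator_apply]
      split_ifs with h
      · rw [hpt F (Finset.mem_filter.2 ⟨hF, h⟩)]
      · rfl
    -- Distinct faces are disjoint, so they cross the line at distinct points.
    · intro F hF F' hF' h
      by_contra hne
      have heq : X F s = X F' s :=
        eq_of_coord_eq hij h ((hXs F hF).2.2.1.trans (hXs F' hF').2.2.1.symm)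
      exact Set.disjoint_left.1 (M.faces_disjoint F (mem_facesOf.1 (hXs F hF).1).1 F'
        (mem_facesOf.1 (hXs F' hF').1).1 hne) (hXs F hF).2.1 (heq ▸ (hXs F' hF').2.1)
    · intro t ht hfr
      have hfr' : slicePt i (t, s) ∈ frontier T := hc.frontier_preimage_subset T hfr
      obtain ⟨F, hF, hxF⟩ := hZ _ hfr' fun h => hsZ _ h (slicePt_of_ne hij _)
      have h1 := hXF F hF _ hxF (by rw [slicePt_of_ne hij]; exact (hsα F hF).symm)
      rw [slicePt_of_ne hij] at h1
      refine ht F (Finset.mem_filter.2 ⟨hF, h1.1⟩) ?_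
      rw [h1.2, slicePt_same]
    · intro F hF
      obtain ⟨hFT, hXmem, hXj, -⟩ := hXs F hF
      obtain ⟨r, hr, hb⟩ := hloc F hFT _ hXmem fun h => hsZ _ h hXj
      refine ⟨r, hr, fun t ht => ?_⟩
      have hd := hdiff t (X F s i)
      rw [hpt F hF] at hd
      have := hb (slicePt i (t, s)) (by
        rw [Metric.mem_ball, dist_eq_norm, hd, norm_smul]
        simpa using ht)
      rw [hd, inner_smul_right, EuclideanSpace.inner_single_right] at this
      refine this.trans ?_
      simp [mul_comm]
  rw [integral_congr_ae (g := fun s => ∑ F ∈ M.facesOf T, (Set.Ioo (α F) (β F)).indicator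
    (fun s => Real.sign (outwardNormal T F i) * ev q (X F s)) s)]
  · rw [integral_finsetSum]
    · refine Finset.sum_congr rfl fun F hF => ?_
      rw [integral_indicator measurableSet_Ioo, hint F hF]
    · intro F hF
      rw [integrable_indicator_iff measurableSet_Ioo]
      have := (continuous_ev q).comp (hXc F hF)
      exact ((continuous_const.mul this).integrableOn_Icc).mono_set Set.Ioo_subset_Icc_self
  · have : ∀ᵐ s : ℝ, s ∉ bad := measure_eq_zero_iff_ae_notMem.1 (hbad.measure_zero volume)
    exact this.mono hslice

end

/-! ### Bounds on mesh elements -/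

theorem IsPolygon.isNice {T : Set Plane} (hT : IsPolygon T) :
    IsNice ((volume : Measure Plane).restrict T) :=
  isNice_restrict hT.isBounded hT.isBounded.measure_lt_top.ne hT.isOpen.measurableSet

theorem IsOpenSegment.isNice {F : Set Plane} (hF : IsOpenSegment F) :
    IsNice (arcLength.restrict F) := by
  refine isNice_restrict ?_ hF.arcLength_ne_top hF.measurableSet
  obtain ⟨a, b, -, rfl⟩ := hF
  refine Bornology.IsBounded.subset ?_ (openSegment_subset_segment ℝ a b)
  rw [← convexHull_pair]
  exact isBounded_convexHull.2 (Set.toFinite _).isBounded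

theorem exists_localBounds {ρ : ℝ} (hρ : 0 < ρ) (l : ℕ) : ∃ K, 0 < K ∧
    ∀ (Ω : Set Plane), IsPolygon Ω → ∀ M : Mesh Ω, M.IsRegular ρ → ∀ T ∈ M.elements,
      ∀ (hT : IsNice ((volume : Measure Plane).restrict T))
        (hF : ∀ F : M.facesOf T, IsNice (arcLength.restrict F.1)),
        LocalBounds (intForm hT) (fun F => intForm (hF F))
          (fun F i => outwardNormal T F.1 i) (Metric.diam T) K l := by
  obtain ⟨K, hK, hb⟩ := exists_chunky_bounds (show 0 < ρ ^ 2 / 2 by positivity) l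
  have hKK : K ≤ K + 36 / ρ ^ 4 * K := by
    have : 0 < 36 / ρ ^ 4 * K := by positivity
    linarith
  refine ⟨K + 36 / ρ ^ 4 * K, by positivity, fun Ω hΩ M hM T hT hΨ hΦ => ?_⟩
  have hP := M.isPolygon T hT
  have hh := hP.diam_pos
  obtain ⟨⟨x₀, hx₁, hx₂⟩, hper⟩ := hM.exists_ball_and_perimeter hρ hT
  have hb := hb T hΨ x₀ _ hh hP.isOpen.measurableSet hx₁ hx₂
  refine ⟨hh, intForm_sq_nonneg hΨ, fun F => intForm_sq_nonneg (hΦ F), fun F i => ?_,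
    fun q i => ?_, fun q hq => ?_, fun q hq i => ?_, fun q hq => ?_⟩
  · have := PiLp.norm_apply_le (outwardNormal T F.1) i
    rwa [(M.isOutwardNormal hT F.2).norm_eq_one] at this
  · exact (M.divergence_formula hΩ hT q i).trans (Finset.sum_coe_sort (M.facesOf T)
      fun F => outwardNormal T F i * ∫ x in F, ev q x ∂arcLength).symm
  -- The trace inequality is the sup bound times the perimeter bound, so short faces need no
  -- separate treatment.
  · have hsup := (hb q hq).1
    have h1 : ∀ F : M.facesOf T, intForm (hΦ F) (q * q) ≤
        arcLength.real F.1 * (K / Metric.diam T ^ 2 * intForm hΨ (q * q)) := by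
      intro F
      have hFm := (M.isOpenSegment F (Mesh.mem_facesOf.1 F.2).1).measurableSet
      have hsub : F.1 ⊆ Metric.closedBall x₀ (Metric.diam T) :=
        (Mesh.mem_facesOf.1 F.2).2.trans (frontier_subset_closure.trans
          (closure_minimal hx₂ Metric.isClosed_closedBall))
      have := intForm_le_of_sup (hΦ F)
        ((ae_restrict_iff' hFm).2 (.of_forall fun x hx => hsub hx)) hsup
      rwa [measureReal_restrict_apply MeasurableSet.univ, Set.univ_inter] at this
    refine (Finset.sum_le_sum fun F _ => h1 F).trans ?_
    rw [← Finset.sum_mul, Finset.sum_coe_sort (M.facesOf T) fun F => arcLength.real F]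
    have hn := intForm_sq_nonneg hΨ q
    refine (mul_le_mul_of_nonneg_right hper (mul_nonneg (by positivity) hn)).trans ?_
    rw [show 36 / ρ ^ 4 * Metric.diam T * (K / Metric.diam T ^ 2 * intForm hΨ (q * q))
      = 36 / ρ ^ 4 * K / Metric.diam T * intForm hΨ (q * q) by field_simp]
    refine mul_le_mul_of_nonneg_right ?_ hn
    gcongr
    linarith
  · refine ((hb q hq).2.1 i).trans (mul_le_mul_of_nonneg_right ?_ (intForm_sq_nonneg hΨ q))
    gcongr
  · obtain ⟨q₁, hq₁, h⟩ := (hb q hq).2.2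
    refine ⟨q₁, hq₁, h.trans (mul_le_mul_of_nonneg_right ?_
      (hessForm_nonneg (intForm_sq_nonneg hΨ) q))⟩
    gcongr

theorem Tensor4.IsSymmElliptic.exists_energyBounds {A : Tensor4} (hA : A.IsSymmElliptic) :
    ∃ c C, 0 < c ∧ 0 < C ∧ ∀ (μ : Measure Plane) (hμ : IsNice μ),
      EnergyBounds A (intForm hμ) c C := by
  obtain ⟨c, C, hc, hC, hb⟩ := hA.exists_bounds
  have hev : ∀ u x, ev (∑ i, ∑ j, dd i (dd j u) * dd i (dd j u)) x
      = frob (hess u x) (hess u x) := fun u x => by simp [frob, hess]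
  have hform : ∀ (μ : Measure Plane) (hμ : IsNice μ) (a : ℝ) (u : Poly),
      a * hessForm (intForm hμ) u u
        = intForm hμ (a • ∑ i, ∑ j, dd i (dd j u) * dd i (dd j u)) := fun μ hμ a u => by
    simp only [hessForm_apply, map_smul, map_sum, smul_eq_mul]
  refine ⟨c, C, hc, hC, fun μ hμ => ⟨fun u => ?_, fun u => ?_, fun u i j => ?_⟩⟩
  · rw [hform]
    refine intForm_mono hμ fun x => ?_
    rw [ev_smul, hev, ev_energyPoly]
    exact (hb _ (hess_isSymm u x)).1
  · rw [hform]
    refine intForm_mono hμ fun x => ?_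
    rw [ev_smul, hev, ev_energyPoly]
    exact (hb _ (hess_isSymm u x)).2.1
  · rw [hform]
    refine intForm_mono hμ fun x => ?_
    rw [ev_smul, hev, ev_mul, ev_moment, neg_mul_neg, ← sq]
    exact (hb _ (hess_isSymm u x)).2.2 i j

/-! ### Projections -/

/-- The form need not be definite, as on a face, where nonzero polynomials may vanish on the whole
line. The right-hand side vanishes on its kernel by Cauchy–Schwarz, and that suffices for existence.
-/
theorem exists_projection {φ : Poly →ₗ[ℝ] ℝ} (hφ : ∀ p, 0 ≤ φ (p * p)) (l : ℕ) (f : Poly) :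
    ∃ q ∈ polyDeg l, ∀ w ∈ polyDeg l, φ ((q - f) * w) = 0 := by
  obtain ⟨q, hq⟩ := exists_eq_of_vanishes_on_ker
    ((mulForm φ).compl₁₂ (polyDeg l).subtype (polyDeg l).subtype)
    (fun x y => mulForm_symm φ _ _) (mulForm φ f ∘ₗ (polyDeg l).subtype) fun x hx => by
      have h1 : φ (x.1 * x.1) = 0 := hx x
      have h2 := bilin_sq_le (mulForm φ) (mulForm_symm φ) hφ f x
      simp only [mulForm_apply, h1, mul_zero] at h2
      exact pow_eq_zero_iff two_ne_zero |>.1 (le_antisymm h2 (sq_nonneg _))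
  refine ⟨q, q.2, fun w hw => ?_⟩
  have : φ (q.1 * w) = φ (f * w) := hq ⟨w, hw⟩
  rw [sub_mul, map_sub, this, sub_self]

theorem innerElem_eq {T : Set Plane} (hT : IsNice ((volume : Measure Plane).restrict T))
    (p q : Poly) : innerElem T (ev p) (ev q) = intForm hT (p * q) := by
  simp only [innerElem, intForm_apply, ev_mul]

theorem innerFace_eq {F : Set Plane} (hm : MeasurableSet F) (hF : IsNice (arcLength.restrict F))
    (p q : Poly) : innerFace F (restrictTo F p) (restrictTo F q) = intForm hF (p * q) := by
  rw [innerFace, intForm_apply, ← integral_subtype_comap hm fun x => ev (p * q) x]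
  simp only [ev_mul]
  rfl

theorem projElem_spec {T : Set Plane} (hT : IsNice ((volume : Measure Plane).restrict T)) (l : ℕ)
    {f : Plane → ℝ} {p : Poly} (hf : f = ev p) :
    ∀ w ∈ polyDeg l, intForm hT ((projElem l T f - p) * w) = 0 := by
  subst hf
  have key : ∀ q w : PolyElem l, innerElem T (fun x => ev q x - ev p x) (ev w)
      = intForm hT ((q - p) * w) := fun q w => by
    rw [← innerElem_eq hT]
    congr 1
    ext x
    rw [ev_sub]
  obtain ⟨q, hq, hqw⟩ := exists_projection (intForm_sq_nonneg hT) l p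
  have := Classical.epsilon_spec (p := fun q : PolyElem l => ∀ w : PolyElem l,
    innerElem T (fun x => ev q x - ev p x) (ev w) = 0)
    ⟨⟨q, hq⟩, fun w => (key _ w).trans (hqw w w.2)⟩
  exact fun w hw => (key _ ⟨w, hw⟩).symm.trans (this ⟨w, hw⟩)

/-- Functions on a face are handled through polynomial representatives. These are not unique, but
the face products do not depend on the choice. -/
theorem projFace_spec {F : Set Plane} (hm : MeasurableSet F)
    (hF : IsNice (arcLength.restrict F)) (l : ℕ) {f : F → ℝ} {p : Poly}
    (hf : f = restrictTo F p) : ∃ r ∈ polyDeg l, (projFace l F f : F → ℝ) = restrictTo F r ∧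
      ∀ w ∈ polyDeg l, intForm hF ((r - p) * w) = 0 := by
  subst hf
  obtain ⟨q, hq, hqw⟩ := exists_projection (intForm_sq_nonneg hF) l p
  have key : ∀ q w : Poly, innerFace F (fun x => restrictTo F q x - restrictTo F p x)
      (restrictTo F w) = intForm hF ((q - p) * w) := fun q w => by
    rw [← innerFace_eq hm hF, map_sub]
    rfl
  have := Classical.epsilon_spec (p := fun q : polyFace l F => ∀ w : polyFace l F,
    innerFace F (fun x => (q : F → ℝ) x - restrictTo F p x) w = 0)
    ⟨⟨restrictTo F q, Submodule.mem_map_of_mem hq⟩, fun w => by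
      obtain ⟨w', hw', hw⟩ := w.2
      rw [← hw]
      exact (key q w').trans (hqw w' hw')⟩
  obtain ⟨r, hr, hr'⟩ := (projFace l F (restrictTo F p)).2
  refine ⟨r, hr, hr'.symm, fun w hw => ?_⟩
  have h1 := this ⟨restrictTo F w, Submodule.mem_map_of_mem hw⟩
  rw [← key, hr']
  exact h1

/-! ### The reconstruction -/

theorem dd_dd_eq_zero {q : Poly} (hq : q ∈ polyDeg 1) (i j : Fin 2) : dd i (dd j q) = 0 := by
  have h := mem_polyDeg.1 (dd_mem_polyDeg hq j)
  rw [MvPolynomial.totalDegree_eq_zero_iff_eq_C.1 (Nat.le_zero.1 h)]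
  exact MvPolynomial.pderiv_C

theorem moment_eq_zero (A : Tensor4) {w : Poly} (hw : ∀ i j, dd i (dd j w) = 0) (i j : Fin 2) :
    moment A w i j = 0 := by
  simp [moment, hw]

theorem energyPoly_eq_zero (A : Tensor4) {u : Poly} (hu : ∀ i j, dd i (dd j u) = 0) (w : Poly) :
    energyPoly A u w = 0 := by
  simp [energyPoly, moment_eq_zero A hu]

theorem eq_zero_of_hessForm_eq_zero {T : Set Plane} (hTo : IsOpen T) (hne : T.Nonempty)
    (hT : IsNice ((volume : Measure Plane).restrict T)) {w : Poly}
    (h : hessForm (intForm hT) w w = 0) (i j : Fin 2) : dd i (dd j w) = 0 := by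
  rw [hessForm_apply, Finset.sum_eq_zero_iff_of_nonneg fun i _ =>
    Finset.sum_nonneg fun j _ => intForm_sq_nonneg _ _] at h
  have h1 := h i (Finset.mem_univ i)
  rw [Finset.sum_eq_zero_iff_of_nonneg fun j _ => intForm_sq_nonneg _ _] at h1
  exact eq_zero_of_intForm_sq_eq_zero hTo hne hT (h1 j (Finset.mem_univ j))

theorem energyPoly_add_left (A : Tensor4) (u v w : Poly) :
    energyPoly A (u + v) w = energyPoly A u w + energyPoly A v w := by
  simp only [energyPoly, moment_add, Fin.sum_univ_two]
  ring

theorem energyPoly_smul_left (A : Tensor4) (c : ℝ) (u w : Poly) :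
    energyPoly A (c • u) w = c • energyPoly A u w := by
  simp only [energyPoly, moment_smul, Finset.smul_sum, ← smul_neg, smul_mul_assoc]

theorem energyPoly_add_right (A : Tensor4) (u v w : Poly) :
    energyPoly A u (v + w) = energyPoly A u v + energyPoly A u w := by
  simp only [energyPoly, dd, map_add, Fin.sum_univ_two]
  ring

theorem energyPoly_smul_right (A : Tensor4) (c : ℝ) (u w : Poly) :
    energyPoly A u (c • w) = c • energyPoly A u w := by
  simp only [energyPoly, dd, Derivation.map_smul, Finset.smul_sum, mul_smul_comm]

/-- The energy form. -/
def energyForm (A : Tensor4) (φ : Poly →ₗ[ℝ] ℝ) : Poly →ₗ[ℝ] Poly →ₗ[ℝ] ℝ :=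
  LinearMap.mk₂ ℝ (fun u w => φ (energyPoly A u w))
    (fun u v w => (congrArg φ (energyPoly_add_left A u v w)).trans (map_add φ _ _))
    (fun c u w => (congrArg φ (energyPoly_smul_left A c u w)).trans (map_smul φ _ _))
    (fun u v w => (congrArg φ (energyPoly_add_right A u v w)).trans (map_add φ _ _))
    (fun c u w => (congrArg φ (energyPoly_smul_right A c u w)).trans (map_smul φ _ _))

section

variable {𝓕 : Type*} [Fintype 𝓕]

/-- The right-hand side of the reconstruction, as a linear form. -/
def recLin (A : Tensor4) (Ψ : Poly →ₗ[ℝ] ℝ) (Φ : 𝓕 → Poly →ₗ[ℝ] ℝ) (n : 𝓕 → Fin 2 → ℝ)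
    (v : Poly) (g : 𝓕 → Fin 2 → Poly) (t : 𝓕 → Poly) : Poly →ₗ[ℝ] ℝ where
  toFun := recForm A Ψ Φ n v g t
  map_add' w w' := by
    simp only [recForm, divDivMoment, divMoment, moment_add, dd, map_add, smul_add, mul_add,
      Finset.sum_add_distrib]
    ring
  map_smul' c w := by
    simp only [recForm, divDivMoment, divMoment, moment_smul, dd, Derivation.map_smul,
      RingHom.id_apply, smul_eq_mul, ← Finset.smul_sum, smul_comm _ c, mul_smul_comm, map_smul,
      ← Finset.mul_sum]
    ring

/-- Zero energy means zero Hessian, hence zero moments, so the right-hand side vanishes on the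
kernel of the energy. An affine correction, invisible to the energy, then adjusts the projection of
degree 1. -/
theorem exists_reconstruction {A : Tensor4} {T : Set Plane} (hA : A.IsSymmElliptic)
    (hTo : IsOpen T) (hne : T.Nonempty) (hT : IsNice ((volume : Measure Plane).restrict T))
    {c C : ℝ} (hc : 0 < c) (hE : EnergyBounds A (intForm hT) c C) (Φ : 𝓕 → Poly →ₗ[ℝ] ℝ)
    (n : 𝓕 → Fin 2 → ℝ) (v : Poly) (g : 𝓕 → Fin 2 → Poly) (t : 𝓕 → Poly) (l : ℕ) (hl : 1 ≤ l) :
    ∃ p ∈ polyDeg l, (∀ w ∈ polyDeg l,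
      intForm hT (energyPoly A p w) = recForm A (intForm hT) Φ n v g t w) ∧
      ∀ w ∈ polyDeg 1, intForm hT ((p - v) * w) = 0 := by
  obtain ⟨p, hp⟩ := exists_eq_of_vanishes_on_ker
    ((energyForm A (intForm hT)).compl₁₂ (polyDeg l).subtype (polyDeg l).subtype)
    (fun x y => congrArg (intForm hT) (energyPoly_comm hA _ _))
    (recLin A (intForm hT) Φ n v g t ∘ₗ (polyDeg l).subtype) fun x hx => by
      have h1 : intForm hT (energyPoly A x x) = 0 := hx x
      have h2 := hE.lower x
      rw [h1] at h2
      have h3 := hessForm_nonneg (intForm_sq_nonneg hT) (x : Poly)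
      have h4 : hessForm (intForm hT) (x : Poly) x = 0 := by nlinarith
      have h5 := moment_eq_zero A (eq_zero_of_hessForm_eq_zero hTo hne hT h4)
      change recForm A (intForm hT) Φ n v g t x = 0
      simp [recForm, divDivMoment, divMoment, h5]
  obtain ⟨q, hq, hqw⟩ := exists_projection (intForm_sq_nonneg hT) 1 (p - v)
  refine ⟨p - q, sub_mem p.2 (polyDeg_mono hl hq), fun w hw => ?_, fun w hw => ?_⟩
  · rw [energyPoly_sub, energyPoly_eq_zero A (dd_dd_eq_zero hq), sub_zero]
    exact hp ⟨w, hw⟩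
  · rw [show (p - q - v) * w = -((q - (p - v)) * w) by ring, map_neg, hqw w hw, neg_zero]

end

theorem aElem_eq {T : Set Plane} (hT : IsNice ((volume : Measure Plane).restrict T)) (A : Tensor4)
    (u w : Poly) : aElem A T u w = intForm hT (energyPoly A u w) := by
  simp only [aElem, intForm_apply, ev_energyPoly]

section

variable {k : ℕ} {FT : Finset (Set Plane)} {A : Tensor4} {T : Set Plane}

theorem recRhs_eq (hT : IsNice ((volume : Measure Plane).restrict T))
    (hm : ∀ F : FT, MeasurableSet F.1) (hF : ∀ F : FT, IsNice (arcLength.restrict F.1))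
    (v : LocalUnknowns k FT) {g : FT → Fin 2 → Poly} {t : FT → Poly}
    (hg : ∀ F i, v.grad F i = restrictTo F.1 (g F i)) (ht : ∀ F, v.trace F = restrictTo F.1 (t F))
    (w : Poly) : recRhs A T v w = recForm A (intForm hT) (fun F => intForm (hF F))
      (fun F i => outwardNormal T F.1 i) v.elem g t w := by
  have h1 : ∀ (F : FT) (x : Fin 2 → Poly), (fun y : F.1 => ∑ j, ev (x j) y * outwardNormal T F.1 j)
      = restrictTo F.1 (∑ j, outwardNormal T F.1 j • x j) := fun F x => by
    ext y
    change _ = ev _ _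
    simp [mul_comm]
  simp only [recRhs, recForm, innerElem_eq hT, hg, ht, h1, innerFace_eq (hm _) (hF _)]

theorem reconstruction_spec (hA : A.IsSymmElliptic) (hTo : IsOpen T) (hne : T.Nonempty)
    (hT : IsNice ((volume : Measure Plane).restrict T)) {c C : ℝ} (hc : 0 < c)
    (hE : EnergyBounds A (intForm hT) c C)
    (hm : ∀ F : FT, MeasurableSet F.1) (hF : ∀ F : FT, IsNice (arcLength.restrict F.1))
    (v : LocalUnknowns k FT) {g : FT → Fin 2 → Poly} {t : FT → Poly}
    (hg : ∀ F i, v.grad F i = restrictTo F.1 (g F i))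
    (ht : ∀ F, v.trace F = restrictTo F.1 (t F)) :
    (∀ w ∈ polyDeg (k + 2), intForm hT (energyPoly A (reconstruction A T v) w)
      = recForm A (intForm hT) (fun F => intForm (hF F))
        (fun F i => outwardNormal T F.1 i) v.elem g t w) ∧
    ∀ w ∈ polyDeg 1, intForm hT ((reconstruction A T v - v.elem) * w) = 0 := by
  obtain ⟨p, hp, hpw, hpo⟩ := exists_reconstruction hA hTo hne hT hc hE (fun F => intForm (hF F))
    (fun F i => outwardNormal T F.1 i) v.elem g t (k + 2) (by omega)
  -- The conditions defining the two projections are equivalent, so the same element is chosen for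
  -- both and no uniqueness argument is needed.
  have hproj : projElem 1 T (ev p) = projElem 1 T (ev v.elem) := by
    unfold projElem
    congr 1
    ext q
    refine forall_congr' fun w => ?_
    have h1 : ∀ u : Poly, innerElem T (fun x => ev q x - ev u x) (ev w)
        = intForm hT ((q - u) * w) := fun u => by
      rw [← innerElem_eq hT]
      congr 1
      ext x
      rw [ev_sub]
    rw [h1, h1, show ((q : Poly) - v.elem) * w = (q - p) * w + (p - v.elem) * w by ring, map_add,
      hpo w w.2, add_zero]
  have := Classical.epsilon_spec (p := fun p : PolyElem (k + 2) =>
    (∀ w : PolyElem (k + 2), aElem A T p w = recRhs A T v w) ∧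
      projElem 1 T (ev p) = projElem 1 T (ev v.elem))
    ⟨⟨p, hp⟩, fun w => by
      rw [aElem_eq hT, recRhs_eq hT hm hF v hg ht]; exact hpw w w.2, hproj⟩
  refine ⟨fun w hw => ?_, fun w hw => ?_⟩
  · have h := this.1 ⟨w, hw⟩
    rw [aElem_eq hT, recRhs_eq hT hm hF v hg ht] at h
    exact h
  · have h1 := projElem_spec hT 1 (p := reconstruction A T v) rfl w hw
    have h2 := projElem_spec hT 1 (p := v.elem) rfl w hw
    have h3 : projElem 1 T (ev (reconstruction A T v)) = projElem 1 T (ev v.elem) := this.2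
    rw [h3] at h1
    rw [show ((reconstruction A T v : Poly) - v.elem) * w
      = ((projElem 1 T (ev v.elem) : Poly) - v.elem) * w
        - ((projElem 1 T (ev v.elem) : Poly) - reconstruction A T v) * w by ring, map_sub, h1, h2,
      sub_zero]

theorem innerFace_self_nonneg {F : Set Plane} (f : F → ℝ) : 0 ≤ innerFace F f f :=
  integral_nonneg fun _ => mul_self_nonneg _

theorem seminormSq_nonneg (hA : A.IsSymmElliptic) (v : LocalUnknowns k FT) :
    0 ≤ seminormSq A T v := by
  have h1 := hA.maxEig_pos.le
  refine add_nonneg (add_nonneg (integral_nonneg fun x => frob_self_nonneg _) ?_) ?_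
  · exact mul_nonneg (div_nonneg h1 Metric.diam_nonneg) (Finset.sum_nonneg fun F _ =>
      Finset.sum_nonneg fun i _ => innerFace_self_nonneg _)
  · exact mul_nonneg (div_nonneg h1 (pow_nonneg Metric.diam_nonneg 3))
      (Finset.sum_nonneg fun F _ => innerFace_self_nonneg _)

end

/-! ### Return from polynomial representatives to the discrete unknowns -/

theorem exists_equivalence {A : Tensor4} (hA : A.IsSymmElliptic) {ρ : ℝ} (hρ : 0 < ρ) {k : ℕ}
    (hk : 1 ≤ k) : ∃ C, 0 < C ∧ ∀ (Ω : Set Plane), IsPolygon Ω → ∀ M : Mesh Ω, M.IsRegular ρ →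
      ∀ T ∈ M.elements, ∀ v : LocalUnknowns k (M.facesOf T),
        seminormSq A T v ≤ C * aT A T v v ∧ aT A T v v ≤ C * seminormSq A T v := by
  obtain ⟨K, hK, hL⟩ := exists_localBounds hρ (k + 2)
  obtain ⟨c, C, hc, hC, hE⟩ := hA.exists_energyBounds
  obtain ⟨D, hD, hmain⟩ := exists_local_equivalence hc hC hK hA.maxEig_pos k hk
  refine ⟨D, hD, fun Ω hΩ M hM T hTM v => ?_⟩
  have hP := M.isPolygon T hTM
  have hT := hP.isNice
  have hseg : ∀ F : M.facesOf T, IsOpenSegment F.1 := fun F =>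
    M.isOpenSegment F (Mesh.mem_facesOf.1 F.2).1
  have hm := fun F => (hseg F).measurableSet
  have hF := fun F => (hseg F).isNice
  have hg : ∀ (F : M.facesOf T) (i : Fin 2), ∃ g ∈ polyDeg k, v.grad F i = restrictTo F.1 g :=
    fun F i => by
      obtain ⟨g, hg, h⟩ := (v.2.1 F i).2
      exact ⟨g, hg, h.symm⟩
  have ht : ∀ F : M.facesOf T, ∃ t ∈ polyDeg k, v.trace F = restrictTo F.1 t := fun F => by
    obtain ⟨t, ht, h⟩ := (v.2.2 F).2
    exact ⟨t, ht, h.symm⟩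
  choose g hgk hg using hg
  choose t htk ht using ht
  obtain ⟨hrec, horth⟩ := reconstruction_spec hA hP.isOpen hP.isConnected.nonempty hT hc
    (hE _ hT) hm hF v hg ht
  set p : PolyElem (k + 2) := reconstruction A T v with hp
  have hrg := fun (F : M.facesOf T) (i : Fin 2) => projFace_spec (hm F) (hF F) k
    (f := fun x => ev (dd i p) x - v.grad F i x) (p := dd i p - g F i) (by
      rw [hg]; ext x; exact (ev_sub _ _ _).symm)
  have hrt := fun F : M.facesOf T => projFace_spec (hm F) (hF F) k
    (f := fun x => ev p x - v.trace F x) (p := p - t F) (by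
      rw [ht]; ext x; exact (ev_sub _ _ _).symm)
  choose rg hrgk hrg hrgw using hrg
  choose rt hrtk hrt hrtw using hrt
  have hr := projElem_spec hT k (f := fun x => ev p x - ev v.elem x) (p := p - v.elem)
    (by ext x; rw [ev_sub])
  have key := hmain (intForm hT) (fun F => intForm (hF F)) (fun F i => outwardNormal T F.1 i)
    (Metric.diam T) A hA (hL Ω hΩ M hM T hTM hT hF) (hE _ hT) v.elem v.1.2 p p.2 g hgk t htk hrec
    horth _ (resElem A T v).2 hr rg hrgk hrgw rt hrtk hrtw
  have hsemi : seminormSq A T v = intForm hT (energyPoly A v.elem v.elem) + A.maxEig *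
      ((∑ F, ∑ i, intForm (hF F) ((g F i - dd i v.elem) * (g F i - dd i v.elem))) / Metric.diam T +
        (∑ F, intForm (hF F) ((t F - v.elem) * (t F - v.elem))) / Metric.diam T ^ 3) := by
    have h1 : ∀ (F : M.facesOf T) i, (fun x : F.1 => v.grad F i x - ev (dd i v.elem) x)
        = restrictTo F.1 (g F i - dd i v.elem) := fun F i => by
      rw [hg]; ext x; exact (ev_sub _ _ _).symm
    have h2 : ∀ F : M.facesOf T, (fun x : F.1 => v.trace F x - ev v.elem x)
        = restrictTo F.1 (t F - v.elem) := fun F => by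
      rw [ht]; ext x; exact (ev_sub _ _ _).symm
    simp only [seminormSq, h1, h2, innerFace_eq (hm _) (hF _), hA.frob_sqrt, ← ev_energyPoly]
    rw [← intForm_apply hT]
    ring
  have haT : aT A T v v = intForm hT (energyPoly A p p) + A.maxEig *
      (intForm hT (resElem A T v * resElem A T v) / Metric.diam T ^ 4 +
        (∑ F, ∑ i, intForm (hF F) (rg F i * rg F i)) / Metric.diam T +
        (∑ F, intForm (hF F) (rt F * rt F)) / Metric.diam T ^ 3) := by
    have h1 : ∀ (F : M.facesOf T) i, (resGrad A T v F i : F.1 → ℝ) = restrictTo F.1 (rg F i) :=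
      hrg
    have h2 : ∀ F : M.facesOf T, (resTrace A T v F : F.1 → ℝ) = restrictTo F.1 (rt F) := hrt
    simp only [aT, stab, h1, h2, innerFace_eq (hm _) (hF _), innerElem_eq hT, aElem_eq hT, ← hp]
    ring
  rw [hsemi, haT]
  exact key

end PlateHHO

end

theorem lemma3p3 {ι : Type*} [Finite ι] (A : ι → PlateHHO.Tensor4)
    (hA : ∀ i, (A i).IsSymmElliptic) (ρ : ℝ) (hρ : 0 < ρ) (k : ℕ) (hk : 1 ≤ k) :
    ∃ C : ℝ, 0 < C ∧
      ∀ (Ω : Set PlateHHO.Plane), PlateHHO.IsPolygon Ω →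
      ∀ (P : ι → Set PlateHHO.Plane), PlateHHO.IsPolygonalPartition Ω P →
      ∀ (M : PlateHHO.Mesh Ω), M.IsRegular ρ → (∀ T ∈ M.elements, ∃! i, T ⊆ P i) →
      ∀ T ∈ M.elements, ∀ i, T ⊆ P i →
      ∀ v : PlateHHO.LocalUnknowns k (M.facesOf T),
        C⁻¹ * PlateHHO.seminormSq (A i) T v ≤ PlateHHO.aT (A i) T v v ∧
          PlateHHO.aT (A i) T v v ≤ C * PlateHHO.seminormSq (A i) T v := by
  cases nonempty_fintype ι
  choose D hD hmain using fun i => PlateHHO.exists_equivalence (hA i) hρ hk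
  -- The sum dominates each constant of the finite family of tensors; the added 1 keeps it positive
  -- even when the family is empty.
  have hle : ∀ i, D i ≤ ∑ i, D i + 1 := fun i =>
    (Finset.single_le_sum (fun i _ => (hD i).le) (Finset.mem_univ i)).trans (by linarith)
  have hpos : 0 < ∑ i, D i + 1 := add_pos_of_nonneg_of_pos
    (Finset.sum_nonneg fun i _ => (hD i).le) one_pos
  refine ⟨∑ i, D i + 1, hpos, fun Ω hΩ P _ M hM _ T hT i _ v => ?_⟩
  obtain ⟨h1, h2⟩ := hmain i Ω hΩ M hM T hT v
  have h3 := PlateHHO.seminormSq_nonneg (T := T) (hA i) v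
  -- Nonnegativity of `aT` is read off from the lower bound, so that the constant may be enlarged.
  have h4 : 0 ≤ PlateHHO.aT (A i) T v v := nonneg_of_mul_nonneg_right (h3.trans h1) (hD i)
  rw [inv_mul_le_iff₀ hpos]
  exact ⟨h1.trans (mul_le_mul_of_nonneg_right (hle i) h4),
    h2.trans (mul_le_mul_of_nonneg_right (hle i) h3)⟩
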